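/- Let $n\ge 2$. For $p,\widetilde p\in[1,\infty)$ and a function $f$ on $\mathbb{R}^n$ put $$\|f\|_{L^{p}_{|x|}L^{\widetilde p}_\theta}=\Big(\int_0^\infty \|f(\rho\,\cdot)\|_{L^{\widetilde p}(\mathbb{S}^{n-1})}^p\,\rho^{n-1}\,d\rho\Big)^{1/p},$$ where $\mathbb{S}^{n-1}$ carries its surface measure, and for an integer $\sigma\ge1$ put $$\||x|^{-\alpha}D^{\sigma}u\|_{L^{p}_{|x|}L^{\widetilde p}_\theta}=\sum_{|\nu|=\sigma}\||x|^{-\alpha}D^{\nu}u\|_{L^{p}_{|x|}L^{\widetilde p}_\theta},\qquad \nu\in\mathbb{N}^n .$$ **(1)** Let $\sigma\in\{1,\dots,n-1\}$, $r,\widetilde r,p,\widetilde p,q,\widetilde q\in[1,\infty)$, $0<a\le1$ and $\alpha,\beta,\gamma\in\mathbb{R}$ with $$\gamma<\frac nr,\qquad \beta<\frac nq,\qquad \alpha<\frac np-\sigma,$$ $$\gamma-\frac nr=a\Big(\alpha+\sigma-\frac np\Big)+(1-a)\Big(\beta-\frac nq\Big).$$ Define $$\Delta=a\sigma+n\Big(\frac1r-\frac{1-a}{q}-\frac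 ap\Big),\qquad \widetilde\Delta=a\sigma+n\Big(\frac1{\widetilde r}-\frac{1-a}{\widetilde q}-\frac a{\widetilde p}\Big),$$ and assume $$\Delta+(n-1)\widetilde\Delta\ge0,\qquad 1<p,\qquad a\Big(\sigma-\frac np\Big)<\Delta\le a\sigma,\qquad a\Big(\sigma-\frac n{\widetilde p}\Big)\le\widetilde\Delta\le a\sigma;$$ if $\Delta+(n-1)\widetilde\Delta>0$, then the conditions $1<p$ and $a(\sigma-n/p)<\Delta$ may be relaxed to $1\le p$ and $a(\sigma-n/p)\le\Delta$. Then there is a constant $C$, independent of $u$, such that for all complex-valued $u\in C_c^\infty(\mathbb{R}^n)$ $$\||x|^{-\gamma}u\|_{L^{r}_{|x|}L^{\widetilde r}_\theta}\le C\,\||x|^{-\alpha}D^{\sigma}u\|^{a}_{L^{p}_{|x|}L^{\widetilde p}_\theta}\,\||x|^{-\beta}u\|^{1-a}_{L^{q}_{|x|}L^{\widetilde q}_\theta}.$$ No lower bound on $\alpha$ is required. **(2)** In particular, let $\sigma=1$, $p,q\in[1,\infty)$, $0<r<\infty$, $0<a\le1$, $\gamma<n/r$, $\beta<n/q$, $\alpha<n/p-1$,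 and $\gamma-\frac nr=a(\alpha+1-\frac np)+(1-a)(\beta-\frac nq)$, and let $\Delta$ be as above. Consider the inequality in ordinary Lebesgue norms $$\||x|^{-\gamma}u\|_{L^{r}(\mathbb{R}^n)}\le C\,\||x|^{-\alpha}\nabla u\|^{a}_{L^{p}(\mathbb{R}^n)}\,\||x|^{-\beta}u\|^{1-a}_{L^{q}(\mathbb{R}^n)}\qquad(*)$$ with $C$ independent of $u$. * (Caffarelli–Kohn–Nirenberg) If $0\le\Delta\le a$, $p>1$ and $a(1-\frac np)<\Delta$, or if $0<\Delta\le a$ and $a(1-\frac np)\le\Delta$, then $(*)$ holds for all $u\in C_c^\infty(\mathbb{R}^n)$. * (De Nápoli–Drelichman–Durán) If $a(1-\frac np)\le\Delta\le a$, the first inequality being strict when $p=1$, then $(*)$ holds for all radial $u\in C_c^\infty(\mathbb{R}^n)$. -/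

import Mathlib

open MeasureTheory
open scoped NNReal ContDiff

noncomputable section

/-- The mixed radial-angular norm
`(∫₀^∞ ‖f(ρ ·)‖_{L^p'(S^{n-1})}^p ρ^(n-1) dρ)^(1/p)` for finite exponents `p` (radial) and `p'`
(angular), as an extended nonnegative number. `Measure.toSphere volume` is the surface measure of
the unit sphere of `ℝⁿ`. -/
def mixedNorm {n : ℕ} (p p' : ℝ) (f : EuclideanSpace ℝ (Fin n) → ℂ) : ENNReal :=
  (∫⁻ ρ in Set.Ioi (0 : ℝ),
      ((∫⁻ θ : Metric.sphere (0 : EuclideanSpace ℝ (Fin n)) 1,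
          ‖f (ρ • (θ : EuclideanSpace ℝ (Fin n)))‖ₑ ^ p'
          ∂(volume : Measure (EuclideanSpace ℝ (Fin n))).toSphere) ^ (1 / p')) ^ p
        * ENNReal.ofReal (ρ ^ (n - 1))) ^ (1 / p)

/-- The function `|x|^s f(x)`. -/
def powWeight {n : ℕ} (s : ℝ) (f : EuclideanSpace ℝ (Fin n) → ℂ) :
    EuclideanSpace ℝ (Fin n) → ℂ :=
  fun x => (‖x‖ ^ s : ℝ) • f x

/-- The partial derivative `∂f/∂x_i`. -/
def partialD {n : ℕ} (i : Fin n) (f : EuclideanSpace ℝ (Fin n) → ℂ) :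
    EuclideanSpace ℝ (Fin n) → ℂ :=
  fun x => fderiv ℝ f x (EuclideanSpace.single i 1)

/-- The derivative `D^ν f = ∂₁^{ν₁} ⋯ ∂ₙ^{νₙ} f` for a multi-index `ν`. -/
def multiD {n : ℕ} (ν : Fin n → ℕ) (f : EuclideanSpace ℝ (Fin n) → ℂ) :
    EuclideanSpace ℝ (Fin n) → ℂ :=
  (List.finRange n).foldr (fun i g => (partialD i)^[ν i] g) f

/-- `∑_{|ν| = σ} ‖ |x|^s D^ν u ‖` in the mixed norm with exponents `p`, `p'`. -/
def mixedNormD {n : ℕ} (p p' s : ℝ) (σ : ℕ) (u : EuclideanSpace ℝ (Fin n) → ℂ) : ENNReal :=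
  ∑ ν ∈ Finset.piAntidiag (Finset.univ : Finset (Fin n)) σ,
    mixedNorm p p' (powWeight s (multiD ν u))

/-- The quantity `aσ + n (1/r - (1-a)/q - a/p)`. -/
def cknDelta (n σ : ℕ) (a p q r : ℝ) : ℝ :=
  a * σ + n * (1 / r - (1 - a) / q - a / p)

/-- The length `|∇u(x)| = (∑ i, |∂_i u(x)|²)^(1/2)` of the gradient. -/
def gradLength {n : ℕ} (u : EuclideanSpace ℝ (Fin n) → ℂ) (x : EuclideanSpace ℝ (Fin n)) : ℝ :=
  Real.sqrt (∑ i, ‖partialD i u x‖ ^ 2)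

/-- The classical first order weighted interpolation inequality
`‖|x|^{-γ} u‖_{L^r} ≤ C ‖|x|^{-α} ∇u‖_{L^p}^a ‖|x|^{-β} u‖_{L^q}^{1-a}` in ordinary Lebesgue
norms on `ℝⁿ`. -/
def ClassicalCKN {n : ℕ} (α β γ a p q r : ℝ) (C : ℝ≥0)
    (u : EuclideanSpace ℝ (Fin n) → ℂ) : Prop :=
  eLpNorm (powWeight (-γ) u) (ENNReal.ofReal r) volume ≤
    C * eLpNorm (fun x => ‖x‖ ^ (-α) * gradLength u x) (ENNReal.ofReal p) volume ^ a
      * eLpNorm (powWeight (-β) u) (ENNReal.ofReal q) volume ^ (1 - a)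

end

/-! Exponents enter through their reciprocals (`recipNorm i` is the `L^(1/i)` norm), so that every
condition is linear, and the radius through `t = log ρ`. In that variable a norm with weight `|x|^s`
is the `L^p(dt)` norm of `e^{(n/p+s)t}` times the angular norm on the sphere of radius `e^t`. The
scaling condition becomes an identity between the exponential rates, and `α < n/p - σ` says that the
rate `c = n/p - α - σ` is positive.

First order. The fundamental theorem of calculus is averaged over the rays from `x` whose direction
lies within distance 1 of `x/|x|`. These rays never enter the ball `|z| < |x|`, hence `|u(x)| ≤ C
∫_{|z| ≥ |x|} |z-x|^{1-n} |∇u(z)| dz`. Only the gradient farther from the origin occurs, so `c > 0`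
alone makes the estimates converge and no lower bound on `α` is needed. In polar coordinates, with
`ρ = |x| < R = |z|`, the kernel is dominated by `max(1-ρ/R, |η-ξ|)^{-(n-1)}`. On the sphere it maps
`L^(1/j')` to `L^(1/i')` with norm at most a constant times `(1-ρ/R)^{-κ}`, for any `κ > 0` with `κ
≥ (n-1)(j'-i')`. There remains a one-sided convolution on the line with `e^{-cx} (1-e^{-x})^{-κ}`.
It maps `L^(1/j)` to `L^(1/i)` by Young's inequality if `κ < 1-(j-i)`, and by
Hardy–Littlewood–Sobolev if equality holds and `0 < i < j < 1`. The resulting condition is `(j-i) +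
(n-1)(j'-i') ≤ 1` (`logNorm_le_fderiv`).

When equality holds with `i = j`, the whole gain is angular and fractional integration in `t` gives
nothing. The Sobolev inequality on each sphere, carried over from `ℝ^(n-1)` by gnomonic charts,
takes its place (`logNorm_le_fderiv_angular`). Order `σ` follows by induction, each derivative
taking an equal share of both gains (`logNorm_le_sum_multiD`).

Interpolation. Define `i`, `i'` by `1/r = a i + (1-a)/q` and `1/r' = a i' + (1-a)/q'`, and put `D =
(1/p-i) + (n-1)(1/p'-i')`. Then `Δ + (n-1)Δ̃ = n a (σ-D)`, and Hölder's inequality combines the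
order `σ` bound with the norm of `u`. One case escapes: `D = σ`, `i = 1/p`, `i' = 0`, which would
call for an embedding into `L^∞` of the sphere that is false in general. There `a < 1`, and the
multiplicative inequality on the sphere still holds, by applying the `L^1` Sobolev inequality
repeatedly to powers of `|w|` (`recipNorm_sphere_le_critical`).

The classical inequality is the case of equal radial and angular exponents. For radial functions all
angular exponents may be taken equal to 1. This makes `Δ̃ = a`, which leaves room for negative `Δ`.
-/

/-- The `L^(1/i)` seminorm of a nonnegative function, parametrized by the reciprocal exponent `i`;
`i = 0` gives the essential supremum. -/
noncomputable def recipNorm {X : Type*} [MeasurableSpace X] (i : ℝ) (f : X → ENNReal)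
    (μ : Measure X) : ENNReal :=
  if i = 0 then essSup f μ else (∫⁻ x, f x ^ (1 / i) ∂μ) ^ i

/-! ### Minkowski, Hölder and Young inequalities in reciprocal exponents. -/

section RecipNorm

variable {X Y : Type*} [MeasurableSpace X] [MeasurableSpace Y] {μ : Measure X} {ν : Measure Y}

theorem recipNorm_zero (f : X → ENNReal) : recipNorm 0 f μ = essSup f μ := by simp [recipNorm]

theorem recipNorm_of_ne_zero {i : ℝ} (hi : i ≠ 0) (f : X → ENNReal) :
    recipNorm i f μ = (∫⁻ x, f x ^ (1 / i) ∂μ) ^ i := by simp [recipNorm, hi]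

theorem recipNorm_one (f : X → ENNReal) : recipNorm 1 f μ = ∫⁻ x, f x ∂μ := by
  simp [recipNorm]

theorem recipNorm_one_div {p : ℝ} (hp : 0 < p) (f : X → ENNReal) :
    recipNorm (1 / p) f μ = (∫⁻ x, f x ^ p ∂μ) ^ (1 / p) := by
  rw [recipNorm_of_ne_zero (by positivity), one_div_one_div]

theorem recipNorm_rpow {i : ℝ} (hi : i ≠ 0) (f : X → ENNReal) :
    recipNorm i f μ ^ (1 / i) = ∫⁻ x, f x ^ (1 / i) ∂μ := by
  rw [recipNorm_of_ne_zero hi, ← ENNReal.rpow_mul, mul_one_div_cancel hi, ENNReal.rpow_one]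

theorem recipNorm_mono_ae {i : ℝ} (hi : 0 ≤ i) {f g : X → ENNReal} (h : ∀ᵐ x ∂μ, f x ≤ g x) :
    recipNorm i f μ ≤ recipNorm i g μ := by
  rcases hi.eq_or_lt with rfl | hi
  · simpa [recipNorm_zero] using essSup_mono_ae h
  · rw [recipNorm_of_ne_zero hi.ne', recipNorm_of_ne_zero hi.ne']
    refine ENNReal.rpow_le_rpow (lintegral_mono_ae ?_) hi.le
    filter_upwards [h] with x hx
    exact ENNReal.rpow_le_rpow hx (by positivity)

theorem recipNorm_mono {i : ℝ} (hi : 0 ≤ i) {f g : X → ENNReal} (h : ∀ x, f x ≤ g x) :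
    recipNorm i f μ ≤ recipNorm i g μ :=
  recipNorm_mono_ae hi (Filter.Eventually.of_forall h)

theorem recipNorm_const_mul {i : ℝ} (hi : 0 ≤ i) {c : ENNReal} (hc : c ≠ ⊤) (f : X → ENNReal) :
    recipNorm i (fun x => c * f x) μ = c * recipNorm i f μ := by
  rcases hi.eq_or_lt with rfl | hi
  · simp only [recipNorm_zero]
    exact ENNReal.essSup_const_mul
  · rw [recipNorm_of_ne_zero hi.ne', recipNorm_of_ne_zero hi.ne']
    simp_rw [ENNReal.mul_rpow_of_nonneg _ _ (by positivity : 0 ≤ 1 / i)]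
    rw [lintegral_const_mul' _ _ (ENNReal.rpow_ne_top_of_nonneg (by positivity) hc),
      ENNReal.mul_rpow_of_nonneg _ _ hi.le, ← ENNReal.rpow_mul, one_div_mul_cancel hi.ne',
      ENNReal.rpow_one]

theorem recipNorm_zero_fun {i : ℝ} (hi : 0 ≤ i) : recipNorm i (fun _ : X => 0) μ = 0 := by
  simpa using recipNorm_const_mul (μ := μ) hi ENNReal.zero_ne_top (fun _ => (1 : ENNReal))

theorem recipNorm_add_le {i : ℝ} (hi : 0 ≤ i) (hi1 : i ≤ 1) {f g : X → ENNReal}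
    (hf : Measurable f) (hg : Measurable g) :
    recipNorm i (fun x => f x + g x) μ ≤ recipNorm i f μ + recipNorm i g μ := by
  rcases hi.eq_or_lt with rfl | hi
  · simp only [recipNorm_zero]
    exact ENNReal.essSup_add_le f g
  · simp only [recipNorm_of_ne_zero hi.ne']
    have := ENNReal.lintegral_Lp_add_le (μ := μ) hf.aemeasurable hg.aemeasurable
      (p := 1 / i) ((one_le_div hi).2 hi1)
    simpa using this

theorem recipNorm_sum_le {ι : Type*} {i : ℝ} (hi : 0 ≤ i) (hi1 : i ≤ 1) (s : Finset ι)
    {f : ι → X → ENNReal} (hf : ∀ j, Measurable (f j)) :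
    recipNorm i (fun x => ∑ j ∈ s, f j x) μ ≤ ∑ j ∈ s, recipNorm i (f j) μ := by
  classical
  induction s using Finset.induction_on with
  | empty => simp [recipNorm_zero_fun hi]
  | insert a s ha ih =>
    simp only [Finset.sum_insert ha]
    exact (recipNorm_add_le hi hi1 (hf a) (Finset.measurable_sum s fun j _ => hf j)).trans
      (by gcongr)

/-- At `i = 0` this rests on the fact that `essSup ≤ c` holds exactly when the section of `{c < f}`
is null, and measures of sections depend measurably on the parameter. -/
theorem measurable_recipNorm [SFinite μ] {i : ℝ} {f : X → Y → ENNReal}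
    (hf : Measurable (Function.uncurry f)) : Measurable fun y => recipNorm i (fun x => f x y) μ := by
  by_cases hi : i = 0
  · subst hi
    simp only [recipNorm_zero]
    refine measurable_of_Iic fun c => ?_
    have : (fun y => essSup (fun x => f x y) μ) ⁻¹' Set.Iic c
        = {y | μ ((fun x => (x, y)) ⁻¹' {z : X × Y | c < f z.1 z.2}) = 0} := by
      ext y
      simp only [Set.mem_preimage, Set.mem_Iic, Set.mem_ofPred_eq]
      constructor
      · intro h
        refine measure_mono_null ?_ (meas_essSup_lt (μ := μ) (f := fun x => f x y))
        intro x hx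
        exact lt_of_le_of_lt h hx
      · intro h
        refine essSup_le_of_ae_le c ?_
        rw [Filter.EventuallyLE, ae_iff]
        simpa using h
    rw [this]
    have hm : MeasurableSet {z : X × Y | c < f z.1 z.2} := measurableSet_lt measurable_const hf
    exact measurable_measure_prodMk_right hm (measurableSet_singleton 0)
  · simp only [recipNorm_of_ne_zero hi]
    refine Measurable.pow_const ?_ _
    refine Measurable.lintegral_prod_left' (f := fun z : X × Y => f z.1 z.2 ^ (1 / i)) ?_
    exact hf.pow_const _

/-- Minkowski's integral inequality. -/
theorem recipNorm_lintegral_le [SFinite μ] [SFinite ν] {i : ℝ} (hi : 0 ≤ i) (hi1 : i ≤ 1)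
    {f : X → Y → ENNReal} (hf : Measurable (Function.uncurry f)) :
    recipNorm i (fun x => ∫⁻ y, f x y ∂ν) μ ≤ ∫⁻ y, recipNorm i (fun x => f x y) μ ∂ν := by
  have hw := measurable_recipNorm (μ := μ) (i := i) hf
  set w : Y → ENNReal := fun y => recipNorm i (fun x => f x y) μ with hwdef
  have hfx : ∀ x, Measurable (f x) := fun x => hf.comp measurable_prodMk_left
  have hfy : ∀ y, Measurable fun x => f x y := fun y => hf.comp measurable_prodMk_right
  rcases hi.eq_or_lt with rfl | hi
  · rw [recipNorm_zero]
    refine essSup_le_of_ae_le _ ?_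
    have h1 : ∀ᵐ y ∂ν, ∀ᵐ x ∂μ, f x y ≤ w y := Filter.Eventually.of_forall fun y => by
      simpa only [hwdef, recipNorm_zero] using ENNReal.ae_le_essSup fun x => f x y
    have h2 : ∀ᵐ x ∂μ, ∀ᵐ y ∂ν, f x y ≤ w y :=
      (Measure.ae_ae_comm (p := fun x y => f x y ≤ w y)
        (measurableSet_le hf (hw.comp measurable_snd))).2 h1
    filter_upwards [h2] with x hx
    exact lintegral_mono_ae hx
  · by_cases hM : ∫⁻ y, w y ∂ν = ⊤
    · rw [hM]; exact le_top
    set M := ∫⁻ y, w y ∂ν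
    set s := 1 / i with hs
    have hs1 : 1 ≤ s := (one_le_div hi).2 hi1
    have hs0 : 0 < s := by linarith
    have his : i = 1 / s := by rw [hs, one_div_one_div]
    have hws : ∀ y, w y ^ s = ∫⁻ x, f x y ^ s ∂μ := fun y => recipNorm_rpow hi.ne' _
    -- Where the slice norm `w y` vanishes so does the slice, almost everywhere; this makes the
    -- negative powers of `w` below harmless.
    have h1 : ∀ᵐ y ∂ν, ∀ᵐ x ∂μ, w y = 0 → f x y = 0 := by
      refine Filter.Eventually.of_forall fun y => ?_
      by_cases h0 : w y = 0
      · have := hws y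
        rw [h0, ENNReal.zero_rpow_of_pos hs0, eq_comm,
          lintegral_eq_zero_iff ((hfy y).pow_const _)] at this
        filter_upwards [this] with x hx _
        simpa [hs0, hs0.not_gt] using hx
      · exact Filter.Eventually.of_forall fun x h => absurd h h0
    have h2 : ∀ᵐ x ∂μ, ∀ᵐ y ∂ν, w y = 0 → f x y = 0 := by
      refine (Measure.ae_ae_comm (p := fun x y => w y = 0 → f x y = 0) ?_).2 h1
      have : {z : X × Y | w z.2 = 0 → f z.1 z.2 = 0}
          = {z : X × Y | w z.2 = 0}ᶜ ∪ {z : X × Y | f z.1 z.2 = 0} := by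
        ext z; simp [imp_iff_not_or]
      rw [this]
      exact ((hw.comp measurable_snd) (measurableSet_singleton 0)).compl.union
        (hf (measurableSet_singleton 0))
    have h3 : ∀ᵐ y ∂ν, w y < ⊤ := ae_lt_top hw hM
    -- Duality is avoided by writing `f = (f^s w^(1-s))^(1/s) * w^(1-1/s)` and applying Hölder in
    -- `y`. Integration in `x` then turns `f^s` into `w^s`, and the weight collapses to `w`.
    have key : ∀ᵐ x ∂μ, (∫⁻ y, f x y ∂ν) ^ s
        ≤ (∫⁻ y, f x y ^ s * w y ^ (1 - s) ∂ν) * M ^ (s - 1) := by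
      filter_upwards [h2] with x hx
      have e1 : ∫⁻ y, f x y ∂ν
          ≤ ∫⁻ y, (f x y ^ s * w y ^ (1 - s)) ^ (1 / s) * w y ^ (1 - 1 / s) ∂ν := by
        refine lintegral_mono_ae ?_
        filter_upwards [hx, h3] with y hy hy'
        by_cases h0 : w y = 0
        · rw [hy h0]; exact zero_le
        · rw [ENNReal.mul_rpow_of_nonneg _ _ (by positivity), ← ENNReal.rpow_mul,
            ← ENNReal.rpow_mul, mul_one_div_cancel hs0.ne', ENNReal.rpow_one, mul_assoc,
            ← ENNReal.rpow_add _ _ h0 hy'.ne]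
          have : (1 - s) * (1 / s) + (1 - 1 / s) = 0 := by field_simp; ring
          rw [this, ENNReal.rpow_zero, mul_one]
      have e2 := ENNReal.lintegral_mul_norm_pow_le (μ := ν)
        (f := fun y => f x y ^ s * w y ^ (1 - s)) (g := w)
        (((hfx x).pow_const _).mul (hw.pow_const _)).aemeasurable hw.aemeasurable
        (p := 1 / s) (q := 1 - 1 / s) (by positivity)
        (by rw [sub_nonneg, div_le_one hs0]; exact hs1) (by ring)
      refine (ENNReal.rpow_le_rpow (e1.trans e2) hs0.le).trans ?_
      rw [ENNReal.mul_rpow_of_nonneg _ _ hs0.le, ← ENNReal.rpow_mul, ← ENNReal.rpow_mul,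
        one_div_mul_cancel hs0.ne', ENNReal.rpow_one, sub_mul, one_div_mul_cancel hs0.ne', one_mul]
    rw [recipNorm_of_ne_zero hi.ne', ← hs]
    have fin : ∫⁻ x, (∫⁻ y, f x y ∂ν) ^ s ∂μ ≤ M ^ s := by
      calc ∫⁻ x, (∫⁻ y, f x y ∂ν) ^ s ∂μ
          ≤ ∫⁻ x, (∫⁻ y, f x y ^ s * w y ^ (1 - s) ∂ν) * M ^ (s - 1) ∂μ := lintegral_mono_ae key
        _ = (∫⁻ x, ∫⁻ y, f x y ^ s * w y ^ (1 - s) ∂ν ∂μ) * M ^ (s - 1) :=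
            lintegral_mul_const' _ _ (ENNReal.rpow_ne_top_of_nonneg (by linarith) hM)
        _ = (∫⁻ y, ∫⁻ x, f x y ^ s * w y ^ (1 - s) ∂μ ∂ν) * M ^ (s - 1) := by
            rw [lintegral_lintegral_swap]
            exact ((hf.pow_const _).mul ((hw.comp measurable_snd).pow_const _)).aemeasurable
        _ = (∫⁻ y, w y ^ s * w y ^ (1 - s) ∂ν) * M ^ (s - 1) := by
            congr 1
            refine lintegral_congr fun y => ?_
            rw [lintegral_mul_const _ ((hfy y).pow_const _), hws]
        _ ≤ M * M ^ (s - 1) := by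
            gcongr
            refine lintegral_mono_ae ?_
            filter_upwards [h3] with y hy
            by_cases h0 : w y = 0
            · simp [h0, hs0]
            · rw [← ENNReal.rpow_add _ _ h0 hy.ne]
              simp
        _ = M ^ s := by
            nth_rw 1 [← ENNReal.rpow_one M]
            rw [← ENNReal.rpow_add_of_nonneg _ _ zero_le_one (by linarith)]
            congr 1; ring
    calc (∫⁻ x, (∫⁻ y, f x y ∂ν) ^ s ∂μ) ^ i ≤ (M ^ s) ^ i := ENNReal.rpow_le_rpow fin hi.le
      _ = M := by rw [← ENNReal.rpow_mul, his, mul_one_div_cancel hs0.ne', ENNReal.rpow_one]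

/-- Interpolation between two exponents by Hölder's inequality. -/
theorem recipNorm_interpolate {i j k a : ℝ} (hi : 0 < i) (hj : 0 ≤ j) (hk : 0 < k) (ha : 0 < a)
    (ha1 : a ≤ 1) (hijk : i = a * j + (1 - a) * k) {f g h : X → ENNReal} (hg : Measurable g)
    (hh : Measurable h) (hfgh : ∀ x, f x ≤ g x ^ a * h x ^ (1 - a)) :
    recipNorm i f μ ≤ recipNorm j g μ ^ a * recipNorm k h μ ^ (1 - a) := by
  have ha1' : 0 ≤ 1 - a := by linarith
  refine (recipNorm_mono hi.le hfgh).trans ?_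
  rcases hj.eq_or_lt with rfl | hj
  -- If `a = 1` and `j = 0` then `i = 0`, against `0 < i`.
  · have ha2 : 1 - a ≠ 0 := by rintro h0; rw [h0] at hijk; simp at hijk; linarith
    have hik : (1 - a) * (1 / i) = 1 / k := by
      have : i = (1 - a) * k := by linarith
      rw [this]; field_simp
    have e1 : recipNorm i (fun x => g x ^ a * h x ^ (1 - a)) μ
        ≤ recipNorm i (fun x => (essSup g μ) ^ a * h x ^ (1 - a)) μ := by
      refine recipNorm_mono_ae hi.le ?_
      filter_upwards [ENNReal.ae_le_essSup g] with x hx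
      gcongr
    refine e1.trans ?_
    rw [recipNorm_zero, recipNorm_of_ne_zero hi.ne', recipNorm_of_ne_zero hk.ne']
    simp_rw [ENNReal.mul_rpow_of_nonneg _ _ (by positivity : 0 ≤ 1 / i), ← ENNReal.rpow_mul, hik]
    rw [lintegral_const_mul _ (hh.pow_const _), ENNReal.mul_rpow_of_nonneg _ _ hi.le,
      ← ENNReal.rpow_mul, mul_assoc, one_div_mul_cancel hi.ne', mul_one]
    have : i = k * (1 - a) := by linarith
    rw [← this]
  · rw [recipNorm_of_ne_zero hi.ne', recipNorm_of_ne_zero hj.ne', recipNorm_of_ne_zero hk.ne']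
    have := ENNReal.lintegral_mul_norm_pow_le (μ := μ) (f := fun x => g x ^ (1 / j))
      (g := fun x => h x ^ (1 / k)) (hg.pow_const _).aemeasurable (hh.pow_const _).aemeasurable
      (p := a * j / i) (q := (1 - a) * k / i) (by positivity) (by positivity)
      (by rw [← add_div, ← hijk, div_self hi.ne'])
    have e : ∀ x, (g x ^ a * h x ^ (1 - a)) ^ (1 / i)
        = (g x ^ (1 / j)) ^ (a * j / i) * (h x ^ (1 / k)) ^ ((1 - a) * k / i) := by
      intro x
      rw [ENNReal.mul_rpow_of_nonneg _ _ (by positivity), ← ENNReal.rpow_mul, ← ENNReal.rpow_mul,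
        ← ENNReal.rpow_mul, ← ENNReal.rpow_mul]
      congr 2 <;> field_simp
    simp_rw [e]
    refine (ENNReal.rpow_le_rpow this hi.le).trans (le_of_eq ?_)
    rw [ENNReal.mul_rpow_of_nonneg _ _ hi.le, ← ENNReal.rpow_mul, ← ENNReal.rpow_mul,
      ← ENNReal.rpow_mul, ← ENNReal.rpow_mul]
    congr 2 <;> field_simp

/-- Young's inequality for an integral operator whose kernel is in `L^m` in each variable. -/
theorem recipNorm_kernel_le [SFinite μ] [SFinite ν] {i j m : ℝ} (hi : 0 ≤ i) (hj1 : j ≤ 1)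
    (hij : i ≤ j) (hj : 0 < j) (hm : 0 < m) (hijm : 1 + i = 1 / m + j)
    {k : X → Y → ENNReal} (hk : Measurable (Function.uncurry k)) {K : ENNReal}
    (hK : K ≠ ⊤)
    (hk1 : ∀ x, ∫⁻ y, k x y ^ m ∂ν ≤ K ^ m) (hk2 : ∀ y, ∫⁻ x, k x y ^ m ∂μ ≤ K ^ m)
    {g : Y → ENNReal} (hg : Measurable g) :
    recipNorm i (fun x => ∫⁻ y, k x y * g y ∂ν) μ ≤ K * recipNorm j g ν := by
  have hkx : ∀ x, Measurable (k x) := fun x => hk.comp measurable_prodMk_left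
  have hky : ∀ y, Measurable fun x => k x y := fun y => hk.comp measurable_prodMk_right
  set G := ∫⁻ y, g y ^ (1 / j) ∂ν with hG
  have hmj : 1 / m - i = 1 - j := by linarith
  -- Hölder with the three weights `i`, `1 - j`, `j - i`, of sum 1: `k g = (k^m g^(1/j))^i
  -- (k^m)^(1-j) (g^(1/j))^(j-i)`, because `m (i + 1 - j) = 1`.
  have point : ∀ x, ∫⁻ y, k x y * g y ∂ν
      ≤ (∫⁻ y, k x y ^ m * g y ^ (1 / j) ∂ν) ^ i * (∫⁻ y, k x y ^ m ∂ν) ^ (1 - j) * G ^ (j - i) := by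
    intro x
    have := ENNReal.lintegral_prod_norm_pow_le (μ := ν) (Finset.univ : Finset (Fin 3))
      (f := ![fun y => k x y ^ m * g y ^ (1 / j), fun y => k x y ^ m, fun y => g y ^ (1 / j)])
      (p := ![i, 1 - j, j - i])
      (by
        intro l _
        fin_cases l
        · exact (((hkx x).pow_const _).mul (hg.pow_const _)).aemeasurable
        · exact ((hkx x).pow_const _).aemeasurable
        · exact (hg.pow_const _).aemeasurable)
      (by simp only [Fin.sum_univ_three, Matrix.cons_val_zero, Matrix.cons_val_one, Matrix.cons_val]; ring)
      (by
        intro l _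
        fin_cases l
        · exact hi
        · simpa using hj1
        · simpa using hij)
    simp only [Fin.prod_univ_three, Matrix.cons_val_zero, Matrix.cons_val_one,
      Matrix.cons_val] at this
    refine le_trans (le_of_eq (lintegral_congr fun y => ?_)) this
    rw [ENNReal.mul_rpow_of_nonneg _ _ hi, ← ENNReal.rpow_mul, ← ENNReal.rpow_mul,
      ← ENNReal.rpow_mul, ← ENNReal.rpow_mul,
      mul_right_comm (k x y ^ (m * i)) (g y ^ (1 / j * i)) (k x y ^ (m * (1 - j))),
      ← ENNReal.rpow_add_of_nonneg _ _ (by positivity)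
        (mul_nonneg hm.le (by linarith)), mul_assoc,
      ← ENNReal.rpow_add_of_nonneg _ _ (by positivity) (mul_nonneg (by positivity) (by linarith))]
    have e1 : m * i + m * (1 - j) = 1 := by
      rw [← hmj]; field_simp; ring
    have e2 : 1 / j * i + 1 / j * (j - i) = 1 := by field_simp; ring
    rw [e1, e2, ENNReal.rpow_one, ENNReal.rpow_one]
  have point2 : ∀ x, ∫⁻ y, k x y * g y ∂ν
      ≤ (K ^ (m * (1 - j)) * G ^ (j - i)) * (∫⁻ y, k x y ^ m * g y ^ (1 / j) ∂ν) ^ i := by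
    intro x
    refine (point x).trans ?_
    rw [mul_assoc, mul_comm]
    gcongr
    rw [ENNReal.rpow_mul]
    exact ENNReal.rpow_le_rpow (hk1 x) (by linarith)
  rw [recipNorm_of_ne_zero hj.ne', ← hG]
  rcases hi.eq_or_lt with rfl | hi
  · rw [recipNorm_zero]
    refine essSup_le_of_ae_le _ (Filter.Eventually.of_forall fun x => (point2 x).trans ?_)
    have : m * (1 - j) = 1 := by
      have : 1 - j = 1 / m := by linarith
      rw [this]; field_simp
    rw [this]; simp
  -- Pulling the constant out of the norm requires `G` finite. For infinite `G` the bound is trivial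
  -- unless `K = 0`, where `0 * ⊤ = 0` and the kernel itself must be seen to vanish.
  · rcases eq_or_ne G ⊤ with hGt | hGt
    · rcases eq_or_ne K 0 with hK0 | hK0
      · have : ∀ x, ∫⁻ y, k x y * g y ∂ν = 0 := by
          intro x
          have h1 := hk1 x
          rw [hK0, ENNReal.zero_rpow_of_pos hm, nonpos_iff_eq_zero,
            lintegral_eq_zero_iff ((hkx x).pow_const _)] at h1
          rw [lintegral_eq_zero_iff (by fun_prop)]
          filter_upwards [h1] with y hy
          have : k x y = 0 := by simpa [hm, hm.not_gt] using hy
          simp [this]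
        simp [this, recipNorm_zero_fun hi.le]
      · rw [hGt, ENNReal.top_rpow_of_pos hj, ENNReal.mul_top hK0]
        exact le_top
    refine (recipNorm_mono hi.le point2).trans ?_
    rw [recipNorm_const_mul hi.le (ENNReal.mul_ne_top
      (ENNReal.rpow_ne_top_of_nonneg (mul_nonneg hm.le (by linarith)) hK)
      (ENNReal.rpow_ne_top_of_nonneg (by linarith) hGt)), recipNorm_of_ne_zero hi.ne']
    simp_rw [← ENNReal.rpow_mul, mul_one_div_cancel hi.ne', ENNReal.rpow_one]
    have : ∫⁻ x, ∫⁻ y, k x y ^ m * g y ^ (1 / j) ∂ν ∂μ ≤ K ^ m * G := by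
      rw [lintegral_lintegral_swap
        ((hk.pow_const _).mul ((hg.comp measurable_snd).pow_const _)).aemeasurable]
      calc ∫⁻ y, ∫⁻ x, k x y ^ m * g y ^ (1 / j) ∂μ ∂ν
          = ∫⁻ y, (∫⁻ x, k x y ^ m ∂μ) * g y ^ (1 / j) ∂ν :=
            lintegral_congr fun y => lintegral_mul_const _ ((hky y).pow_const _)
        _ ≤ ∫⁻ y, K ^ m * g y ^ (1 / j) ∂ν := by
            gcongr with y
            exact hk2 y
        _ = K ^ m * G := lintegral_const_mul _ (hg.pow_const _)
    calc K ^ (m * (1 - j)) * G ^ (j - i) * (∫⁻ x, ∫⁻ y, k x y ^ m * g y ^ (1 / j) ∂ν ∂μ) ^ i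
        ≤ K ^ (m * (1 - j)) * G ^ (j - i) * (K ^ m * G) ^ i := by gcongr
      _ = (K ^ (m * (1 - j)) * K ^ (m * i)) * (G ^ (j - i) * G ^ i) := by
          rw [ENNReal.mul_rpow_of_nonneg _ _ hi.le, ← ENNReal.rpow_mul]; ring
      _ = K * G ^ j := by
          rw [← ENNReal.rpow_add_of_nonneg _ _ (mul_nonneg hm.le (by linarith)) (by positivity),
            ← ENNReal.rpow_add_of_nonneg _ _ (by linarith) hi.le]
          have e1 : m * (1 - j) + m * i = 1 := by rw [← hmj]; field_simp; ring
          rw [e1, ENNReal.rpow_one, sub_add_cancel]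

end RecipNorm

/-! ### Maximal function and fractional integration on the line. -/

/-- The centered maximal function on the line, over dyadic radii. -/
noncomputable def dyadicMaximal (f : ℝ → ENNReal) (t : ℝ) : ENNReal :=
  ⨆ k : ℤ, ENNReal.ofReal ((2 : ℝ) ^ (-k)) * ∫⁻ x in Metric.closedBall t ((2 : ℝ) ^ k), f x

/-- Dyadic radii make the supremum countable, so only a single average has to be shown measurable.
-/
theorem measurable_dyadicMaximal {f : ℝ → ENNReal} (hf : Measurable f) :
    Measurable (dyadicMaximal f) := by
  refine Measurable.iSup fun k => Measurable.const_mul ?_ _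
  have : (fun t => ∫⁻ x in Metric.closedBall t ((2 : ℝ) ^ k), f x)
      = fun t => ∫⁻ x, ({z : ℝ × ℝ | dist z.2 z.1 ≤ (2 : ℝ) ^ k}.indicator (fun z => f z.2)) (t, x) := by
    ext t
    rw [← lintegral_indicator Metric.isClosed_closedBall.measurableSet]
    rfl
  rw [this]
  refine Measurable.lintegral_prod_right' (Measurable.indicator (hf.comp measurable_snd) ?_)
  exact measurableSet_le (by fun_prop) measurable_const

theorem lintegral_closedBall_le_dyadicMaximal (f : ℝ → ENNReal) (t : ℝ) {r : ℝ} (hr : 0 < r) :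
    ∫⁻ x in Metric.closedBall t r, f x ≤ ENNReal.ofReal (2 * r) * dyadicMaximal f t := by
  obtain ⟨k, hk1, hk2⟩ := exists_mem_Ioc_zpow hr (one_lt_two : (1 : ℝ) < 2)
  have h2 : (2 : ℝ) ^ (k + 1) = 2 ^ k * 2 := zpow_add_one₀ two_ne_zero k
  calc ∫⁻ x in Metric.closedBall t r, f x
      ≤ ∫⁻ x in Metric.closedBall t ((2 : ℝ) ^ (k + 1)), f x :=
        lintegral_mono_set (Metric.closedBall_subset_closedBall hk2)
    _ = ENNReal.ofReal ((2 : ℝ) ^ (k + 1)) * (ENNReal.ofReal ((2 : ℝ) ^ (-(k + 1))) *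
          ∫⁻ x in Metric.closedBall t ((2 : ℝ) ^ (k + 1)), f x) := by
        rw [← mul_assoc, ← ENNReal.ofReal_mul (by positivity), zpow_neg,
          mul_inv_cancel₀ (by positivity), ENNReal.ofReal_one, one_mul]
    _ ≤ ENNReal.ofReal (2 * r) * dyadicMaximal f t := by
        gcongr
        · linarith
        · exact le_iSup (fun k : ℤ => ENNReal.ofReal ((2 : ℝ) ^ (-k)) *
            ∫⁻ x in Metric.closedBall t ((2 : ℝ) ^ k), f x) (k + 1)

/-- The weak type `(1, 1)` maximal inequality. -/
theorem mul_volume_dyadicMaximal_le (f : ℝ → ENNReal) {l : ℝ} (hl : 0 < l) :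
    ENNReal.ofReal l * volume {t | ENNReal.ofReal l < dyadicMaximal f t} ≤ 8 * ∫⁻ x, f x := by
  by_cases hf : ∫⁻ x, f x = ⊤
  · simp [hf]
  set A := {t | ENNReal.ofReal l < dyadicMaximal f t} with hA
  have hk : ∀ t : A, ∃ k : ℤ, ENNReal.ofReal (l * (2 : ℝ) ^ k)
      < ∫⁻ x in Metric.closedBall (t : ℝ) ((2 : ℝ) ^ k), f x := by
    rintro ⟨t, ht⟩
    have ht' : ENNReal.ofReal l < dyadicMaximal f t := ht
    obtain ⟨k, hk⟩ := lt_iSup_iff.1 ht'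
    refine ⟨k, ?_⟩
    have h1 := ENNReal.mul_lt_mul_left (a := ENNReal.ofReal ((2 : ℝ) ^ k))
      (by simp; positivity) ENNReal.ofReal_ne_top hk
    rwa [mul_right_comm, ← ENNReal.ofReal_mul (by positivity), ← ENNReal.ofReal_mul (by positivity),
      zpow_neg, inv_mul_cancel₀ (by positivity), ENNReal.ofReal_one, one_mul] at h1
  choose k hk using hk
  -- An average exceeding `l` bounds the radius by `‖f‖₁ / l`; Vitali's lemma needs such a uniform
  -- bound.
  set R : ℝ := (∫⁻ x, f x).toReal / l
  have hR : ∀ t ∈ (Set.univ : Set A), (2 : ℝ) ^ (k t) ≤ R := by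
    intro t _
    rw [le_div_iff₀ hl, ← ENNReal.ofReal_le_iff_le_toReal hf, mul_comm]
    exact (hk t).le.trans (setLIntegral_le_lintegral _ _)
  -- Vitali's lemma permits any enlargement factor above 3. With 4, the enlarged interval has length
  -- `8 * 2^k`, whence the constant 8.
  obtain ⟨u, -, hdisj, hcov⟩ := Vitali.exists_disjoint_subfamily_covering_enlargement_closedBall
    (Set.univ : Set A) (fun t => (t : ℝ)) (fun t => (2 : ℝ) ^ (k t)) R hR 4 (by norm_num)
  have hcount : u.Countable := by
    refine hdisj.countable_of_nonempty_interior fun t _ => ?_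
    refine ⟨t, Metric.ball_subset_interior_closedBall (Metric.mem_ball_self (by positivity))⟩
  have hsub : A ⊆ ⋃ t ∈ u, Metric.closedBall (t : ℝ) (4 * (2 : ℝ) ^ (k t)) := by
    intro t ht
    obtain ⟨b, hb, hb'⟩ := hcov ⟨t, ht⟩ trivial
    exact Set.mem_biUnion hb (hb' (Metric.mem_closedBall_self (by positivity)))
  have := hcount.to_subtype
  calc ENNReal.ofReal l * volume A
      ≤ ENNReal.ofReal l * ∑' t : u, volume (Metric.closedBall (t.1 : ℝ) (4 * (2 : ℝ) ^ (k t.1))) := by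
        gcongr
        refine (measure_mono hsub).trans ?_
        exact measure_biUnion_le _ hcount _
    _ = ∑' t : u, 8 * ENNReal.ofReal (l * (2 : ℝ) ^ (k t.1)) := by
        rw [← ENNReal.tsum_mul_left]
        congr 1; ext t
        rw [Real.volume_closedBall, ← ENNReal.ofReal_mul hl.le]
        have : (8 : ENNReal) = ENNReal.ofReal 8 := by simp
        rw [this, ← ENNReal.ofReal_mul (by norm_num)]
        congr 1; ring
    _ ≤ ∑' t : u, 8 * ∫⁻ x in Metric.closedBall (t.1 : ℝ) ((2 : ℝ) ^ (k t.1)), f x := by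
        gcongr with t
        exact (hk t.1).le
    _ = 8 * ∫⁻ x in ⋃ t ∈ u, Metric.closedBall (t : ℝ) ((2 : ℝ) ^ (k t)), f x := by
        rw [ENNReal.tsum_mul_left, lintegral_biUnion hcount
          (fun t _ => Metric.isClosed_closedBall.measurableSet) hdisj]
    _ ≤ 8 * ∫⁻ x, f x := by
        gcongr
        exact Measure.restrict_le_self

theorem lintegral_Ioi_indicator_rpow {p b : ℝ} (hp : 0 < p) (hb : 0 ≤ b) :
    ∫⁻ l in Set.Ioi (0 : ℝ), (Set.Iio b).indicator (fun l => ENNReal.ofReal (p * l ^ (p - 1))) l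
      = ENNReal.ofReal (b ^ p) := by
  rw [lintegral_indicator measurableSet_Iio, Measure.restrict_restrict measurableSet_Iio,
    Set.Iio_inter_Ioi, restrict_Ioo_eq_restrict_Ioc]
  have hint : IntervalIntegrable (fun l : ℝ => p * l ^ (p - 1)) volume 0 b :=
    (intervalIntegral.intervalIntegrable_rpow' (by linarith)).const_mul p
  rw [← ofReal_integral_eq_lintegral_ofReal]
  · rw [← intervalIntegral.integral_of_le hb, intervalIntegral.integral_const_mul,
      integral_rpow (Or.inl (by linarith)), sub_add_cancel, Real.zero_rpow hp.ne', sub_zero,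
      mul_div_cancel₀ _ hp.ne']
  · exact (intervalIntegrable_iff_integrableOn_Ioc_of_le hb).1 hint
  · filter_upwards [ae_restrict_mem measurableSet_Ioc] with l hl
    have := hl.1
    simp only [Pi.zero_apply]; positivity

/-- Layer-cake formula for one value. The case `c = ⊤` follows by comparison with finite levels
`b^(1/p)`, for every `b`. -/
theorem rpow_eq_lintegral_layer {p : ℝ} (hp : 0 < p) (c : ENNReal) :
    c ^ p = ∫⁻ l in Set.Ioi (0 : ℝ),
      {l : ℝ | ENNReal.ofReal l < c}.indicator (fun l => ENNReal.ofReal (p * l ^ (p - 1))) l := by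
  have fin : ∀ b : ℝ≥0, (b : ENNReal) ^ p = ∫⁻ l in Set.Ioi (0 : ℝ),
      {l : ℝ | ENNReal.ofReal l < b}.indicator (fun l => ENNReal.ofReal (p * l ^ (p - 1))) l := by
    intro b
    have h := lintegral_Ioi_indicator_rpow hp b.coe_nonneg
    have e : ((b : ENNReal)) ^ p = ENNReal.ofReal ((b : ℝ) ^ p) := by
      rw [← ENNReal.ofReal_rpow_of_nonneg b.coe_nonneg hp.le, ENNReal.ofReal_coe_nnreal]
    rw [e]
    refine h.symm.trans ?_
    refine setLIntegral_congr_fun measurableSet_Ioi fun l hl => ?_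
    have : l ∈ Set.Iio (b : ℝ) ↔ l ∈ {l : ℝ | ENNReal.ofReal l < b} := by
      rw [Set.mem_Iio, Set.mem_ofPred_eq, ← ENNReal.ofReal_coe_nnreal,
        ENNReal.ofReal_lt_ofReal_iff_of_nonneg (le_of_lt hl)]
    by_cases h : l ∈ Set.Iio (b : ℝ)
    · rw [Set.indicator_of_mem h, Set.indicator_of_mem (this.1 h)]
    · rw [Set.indicator_of_notMem h, Set.indicator_of_notMem (fun h' => h (this.2 h'))]
  rcases eq_or_ne c ⊤ with rfl | hc
  · rw [ENNReal.top_rpow_of_pos hp, eq_comm, eq_top_iff]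
    refine ENNReal.le_of_forall_nnreal_lt fun b _ => ?_
    have hb := fin (b ^ (1 / p))
    rw [ENNReal.coe_rpow_of_nonneg _ (by positivity), ← ENNReal.rpow_mul, one_div_mul_cancel hp.ne',
      ENNReal.rpow_one] at hb
    rw [hb]
    refine lintegral_mono fun l => Set.indicator_le_indicator_of_subset ?_ (fun _ => zero_le) l
    intro l _
    exact ENNReal.ofReal_lt_top
  · lift c to ℝ≥0 using hc
    exact fin c

/-- The strong type maximal inequality. -/
theorem lintegral_dyadicMaximal_rpow_le {p : ℝ} (hp : 1 < p) :
    ∃ C : ℝ≥0, ∀ f : ℝ → ENNReal, Measurable f →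
      ∫⁻ t, dyadicMaximal f t ^ p ≤ C * ∫⁻ t, f t ^ p := by
  have hp0 : 0 < p := by linarith
  have hp1 : 0 < p - 1 := by linarith
  refine ⟨Real.toNNReal (16 * (p / (p - 1)) * 4 ^ (p - 1)), fun f hf => ?_⟩
  have hM := measurable_dyadicMaximal hf
  -- Truncation of `f` at height `l/4`. With the normalization `2^(-k)` on intervals of length `2 *
  -- 2^k`, the discarded part contributes at most `l/2` to the maximal function, so that of `T l`
  -- must exceed `l/2`.
  set T : ℝ → ℝ → ENNReal := fun l t => if ENNReal.ofReal l < 4 * f t then f t else 0 with hT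
  have hTm : Measurable (Function.uncurry T) := by
    refine Measurable.ite (measurableSet_lt (by fun_prop) (by fun_prop)) (by fun_prop) (by fun_prop)
  have weak : ∀ l : ℝ, 0 < l → volume {t | ENNReal.ofReal l < dyadicMaximal f t}
      ≤ ENNReal.ofReal (16 / l) * ∫⁻ t, T l t := by
    intro l hl
    have hsub : {t | ENNReal.ofReal l < dyadicMaximal f t}
        ⊆ {t | ENNReal.ofReal (l / 2) < dyadicMaximal (T l) t} := by
      intro t ht
      by_contra hcon
      simp only [Set.mem_ofPred_eq, not_lt] at hcon
      rw [Set.mem_ofPred_eq] at ht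
      refine absurd ht (not_lt.2 (iSup_le fun k => ?_))
      have h4 : ∀ x, f x ≤ T l x + ENNReal.ofReal (l / 4) := by
        intro x
        simp only [hT]
        split_ifs with h
        · exact le_self_add
        · rw [not_lt] at h
          rw [zero_add, ENNReal.ofReal_div_of_pos (by norm_num),
            ENNReal.le_div_iff_mul_le (by simp) (by simp)]
          simpa [mul_comm] using h
      calc ENNReal.ofReal ((2 : ℝ) ^ (-k)) * ∫⁻ x in Metric.closedBall t ((2 : ℝ) ^ k), f x
          ≤ ENNReal.ofReal ((2 : ℝ) ^ (-k)) * ∫⁻ x in Metric.closedBall t ((2 : ℝ) ^ k),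
              (T l x + ENNReal.ofReal (l / 4)) := by gcongr with x; exact h4 x
        _ = ENNReal.ofReal ((2 : ℝ) ^ (-k)) * (∫⁻ x in Metric.closedBall t ((2 : ℝ) ^ k), T l x)
              + ENNReal.ofReal ((2 : ℝ) ^ (-k) * (l / 4 * (2 * 2 ^ k))) := by
            rw [lintegral_add_right _ measurable_const, setLIntegral_const, Real.volume_closedBall,
              mul_add, ← ENNReal.ofReal_mul (by positivity), ← ENNReal.ofReal_mul (by positivity)]
        _ ≤ ENNReal.ofReal (l / 2) + ENNReal.ofReal (l / 2) := by
            gcongr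
            · exact (le_iSup (fun k : ℤ => ENNReal.ofReal ((2 : ℝ) ^ (-k)) *
                ∫⁻ x in Metric.closedBall t ((2 : ℝ) ^ k), T l x) k).trans hcon
            · rw [zpow_neg]
              have : (0 : ℝ) < 2 ^ k := by positivity
              field_simp; norm_num
        _ = ENNReal.ofReal l := by
            rw [← ENNReal.ofReal_add (by positivity) (by positivity)]; congr 1; ring
    have := mul_volume_dyadicMaximal_le (T l) (l := l / 2) (by positivity)
    calc volume {t | ENNReal.ofReal l < dyadicMaximal f t}
        ≤ volume {t | ENNReal.ofReal (l / 2) < dyadicMaximal (T l) t} := measure_mono hsub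
      _ = ENNReal.ofReal (2 / l) * (ENNReal.ofReal (l / 2) *
            volume {t | ENNReal.ofReal (l / 2) < dyadicMaximal (T l) t}) := by
          rw [← mul_assoc, ← ENNReal.ofReal_mul (by positivity)]
          have : 2 / l * (l / 2) = 1 := by field_simp
          rw [this, ENNReal.ofReal_one, one_mul]
      _ ≤ ENNReal.ofReal (2 / l) * (8 * ∫⁻ t, T l t) := by gcongr
      _ = ENNReal.ofReal (16 / l) * ∫⁻ t, T l t := by
          rw [← mul_assoc]
          have h8 : (8 : ENNReal) = ENNReal.ofReal 8 := by simp
          rw [h8, ← ENNReal.ofReal_mul (by positivity)]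
          congr 2; ring
  calc ∫⁻ t, dyadicMaximal f t ^ p
      = ∫⁻ t, ∫⁻ l in Set.Ioi (0 : ℝ), {z : ℝ × ℝ | ENNReal.ofReal z.2 < dyadicMaximal f z.1}.indicator
          (fun z => ENNReal.ofReal (p * z.2 ^ (p - 1))) (t, l) := by
        refine lintegral_congr fun t => ?_
        rw [rpow_eq_lintegral_layer hp0]; rfl
    _ = ∫⁻ l in Set.Ioi (0 : ℝ), ∫⁻ t, {z : ℝ × ℝ | ENNReal.ofReal z.2 < dyadicMaximal f z.1}.indicator
          (fun z => ENNReal.ofReal (p * z.2 ^ (p - 1))) (t, l) := by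
        refine lintegral_lintegral_swap (Measurable.aemeasurable ?_)
        exact Measurable.indicator (by fun_prop)
          (measurableSet_lt (by fun_prop) (hM.comp measurable_fst))
    _ = ∫⁻ l in Set.Ioi (0 : ℝ), ENNReal.ofReal (p * l ^ (p - 1)) *
          volume {t | ENNReal.ofReal l < dyadicMaximal f t} := by
        refine lintegral_congr fun l => ?_
        rw [← lintegral_indicator_const (measurableSet_lt measurable_const hM)]
        rfl
    _ ≤ ∫⁻ l in Set.Ioi (0 : ℝ), ENNReal.ofReal (p * l ^ (p - 1)) *
          (ENNReal.ofReal (16 / l) * ∫⁻ t, T l t) := by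
        refine setLIntegral_mono' measurableSet_Ioi fun l hl => ?_
        gcongr
        exact weak l hl
    _ = ∫⁻ l in Set.Ioi (0 : ℝ), ∫⁻ t, ENNReal.ofReal (16 * p * l ^ (p - 1 - 1)) * T l t := by
        refine setLIntegral_congr_fun measurableSet_Ioi fun l hl => ?_
        have hl0 : (0 : ℝ) < l := hl
        have hTl : Measurable fun t => T l t := hTm.comp measurable_prodMk_left
        rw [lintegral_const_mul _ hTl, ← mul_assoc,
          ← ENNReal.ofReal_mul (by positivity), Real.rpow_sub_one hl0.ne' (p - 1)]
        congr 2; ring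
    _ = ∫⁻ t, ∫⁻ l in Set.Ioi (0 : ℝ), ENNReal.ofReal (16 * p * l ^ (p - 1 - 1)) * T l t := by
        refine lintegral_lintegral_swap (Measurable.aemeasurable ?_)
        exact (by fun_prop : Measurable fun z : ℝ × ℝ =>
          ENNReal.ofReal (16 * p * z.1 ^ (p - 1 - 1))).mul hTm
    _ = ∫⁻ t, ENNReal.ofReal (16 * (p / (p - 1)) * 4 ^ (p - 1)) * f t ^ p := by
        refine lintegral_congr fun t => ?_
        -- For fixed `t` the truncation restricts to `l < 4 f(t)`, and the layer-cake formula with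
        -- exponent `p - 1 > 0` yields `(4 f(t))^(p-1) / (p-1)`.
        have e : ∀ l, ENNReal.ofReal (16 * p * l ^ (p - 1 - 1)) * T l t
            = (ENNReal.ofReal (16 * (p / (p - 1))) * f t) *
              {l : ℝ | ENNReal.ofReal l < 4 * f t}.indicator
                (fun l => ENNReal.ofReal ((p - 1) * l ^ (p - 1 - 1))) l := by
          intro l
          simp only [hT, Set.indicator, Set.mem_ofPred_eq]
          split_ifs
          · have : 16 * p * l ^ (p - 1 - 1) = 16 * (p / (p - 1)) * ((p - 1) * l ^ (p - 1 - 1)) := by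
              field_simp
            rw [this, ENNReal.ofReal_mul (by positivity)]; ring
          · simp
        simp_rw [e]
        rw [lintegral_const_mul, ← rpow_eq_lintegral_layer hp1,
          ENNReal.mul_rpow_of_nonneg _ _ hp1.le]
        · have h4 : (4 : ENNReal) ^ (p - 1) = ENNReal.ofReal (4 ^ (p - 1)) := by
            rw [← ENNReal.ofReal_rpow_of_pos (by norm_num)]; simp
          have hfp : f t * f t ^ (p - 1) = f t ^ p := by
            nth_rw 1 [← ENNReal.rpow_one (f t)]
            rw [← ENNReal.rpow_add_of_nonneg _ _ zero_le_one hp1.le]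
            congr 1; ring
          rw [h4, ← hfp, ENNReal.ofReal_mul (p := 16 * (p / (p - 1))) (by positivity)]; ring
        · exact Measurable.indicator (by fun_prop) (measurableSet_lt (by fun_prop) measurable_const)
    _ = _ := by rw [lintegral_const_mul _ (hf.pow_const _)]; rfl

/-- Hedberg's pointwise estimate for the one-sided fractional integral. -/
theorem fractional_le_of_pos {p th : ℝ} (hp : 1 < p) (hth : 0 < th) (hthp : th < 1 / p) :
    ∃ C : ℝ≥0, ∀ f : ℝ → ENNReal, Measurable f → ∀ t r : ℝ, 0 < r →
      ∫⁻ x in Set.Ioi (0 : ℝ), ENNReal.ofReal (x ^ (th - 1)) * f (t + x)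
        ≤ C * (ENNReal.ofReal (r ^ th) * dyadicMaximal f t +
          ENNReal.ofReal (r ^ (th - 1 / p)) * recipNorm (1 / p) f volume) := by
  have hp0 : 0 < p := by linarith
  have hip : 1 / p < 1 := by rw [div_lt_one hp0]; exact hp
  set q : ℝ := 1 / (1 - 1 / p) with hq
  have hq0 : 0 < q := by rw [hq]; apply one_div_pos.2; linarith
  have hqe : (th - 1) * q < -1 := by
    rw [hq, mul_one_div, div_lt_iff₀ (by linarith)]; linarith
  have hsum : Summable fun j : ℕ => ((2 : ℝ) ^ (-th)) ^ j :=
    summable_geometric_of_lt_one (by positivity)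
      (Real.rpow_lt_one_of_one_lt_of_neg (by norm_num) (by linarith))
  set S := ∑' j : ℕ, ((2 : ℝ) ^ (-th)) ^ j with hS
  set c1 : ℝ := 2 ^ (1 - th) * 2 * S with hc1
  have hS0 : 0 ≤ S := tsum_nonneg fun j => by positivity
  set c2 : ℝ := (1 / (-((th - 1) * q + 1))) ^ (1 / q) with hc2
  have hc20 : 0 ≤ c2 := by
    rw [hc2]; apply Real.rpow_nonneg; apply one_div_nonneg.2; linarith
  refine ⟨Real.toNNReal (c1 + c2), fun f hf t r hr => ?_⟩
  have hft : Measurable fun x => f (t + x) := hf.comp (measurable_const_add t)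
  -- On the shell `r 2^(-j-1) < x ≤ r 2^(-j)` the kernel is essentially constant and the integral of
  -- `f` is bounded by the maximal function; the shells sum geometrically with ratio `2^(-th)`.
  have near : ∫⁻ x in Set.Ioc (0 : ℝ) r, ENNReal.ofReal (x ^ (th - 1)) * f (t + x)
      ≤ ENNReal.ofReal c1 * (ENNReal.ofReal (r ^ th) * dyadicMaximal f t) := by
    have hcov : Set.Ioc (0 : ℝ) r ⊆ ⋃ j : ℕ, Set.Ioc (r * (1 / 2) ^ (j + 1)) (r * (1 / 2) ^ j) := by
      intro x hx
      obtain ⟨j, hj1, hj2⟩ := exists_nat_pow_near_of_lt_one (x := x / r) (y := 1 / 2)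
        (div_pos hx.1 hr) ((div_le_one hr).2 hx.2) (by norm_num) (by norm_num)
      refine Set.mem_iUnion.2 ⟨j, ?_, ?_⟩
      · rw [mul_comm]; exact (lt_div_iff₀ hr).1 hj1
      · rw [mul_comm]; exact (div_le_iff₀ hr).1 hj2
    calc ∫⁻ x in Set.Ioc (0 : ℝ) r, ENNReal.ofReal (x ^ (th - 1)) * f (t + x)
        ≤ ∑' j : ℕ, ∫⁻ x in Set.Ioc (r * (1 / 2) ^ (j + 1)) (r * (1 / 2) ^ j),
            ENNReal.ofReal (x ^ (th - 1)) * f (t + x) :=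
          (lintegral_mono_set hcov).trans (lintegral_iUnion_le _ _)
      _ ≤ ∑' j : ℕ, ENNReal.ofReal (2 ^ (1 - th) * 2 * ((2 : ℝ) ^ (-th)) ^ j) *
            (ENNReal.ofReal (r ^ th) * dyadicMaximal f t) := by
          refine ENNReal.tsum_le_tsum fun j => ?_
          have hpos : (0 : ℝ) < r * (1 / 2) ^ (j + 1) := by positivity
          calc ∫⁻ x in Set.Ioc (r * (1 / 2) ^ (j + 1)) (r * (1 / 2) ^ j),
                ENNReal.ofReal (x ^ (th - 1)) * f (t + x)
              ≤ ∫⁻ x in Set.Ioc (r * (1 / 2) ^ (j + 1)) (r * (1 / 2) ^ j),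
                ENNReal.ofReal ((r * (1 / 2) ^ (j + 1)) ^ (th - 1)) * f (t + x) := by
                refine setLIntegral_mono' measurableSet_Ioc fun x hx => ?_
                exact mul_le_mul' (ENNReal.ofReal_le_ofReal
                  (Real.rpow_le_rpow_of_nonpos hpos hx.1.le (by linarith))) le_rfl
            _ ≤ ENNReal.ofReal ((r * (1 / 2) ^ (j + 1)) ^ (th - 1)) *
                  ∫⁻ x in Metric.closedBall t (r * (1 / 2) ^ j), f x := by
                rw [lintegral_const_mul _ hft]
                refine mul_le_mul' le_rfl ?_
                rw [← lintegral_indicator measurableSet_Ioc,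
                  ← lintegral_indicator Metric.isClosed_closedBall.measurableSet,
                  ← lintegral_add_left_eq_self ((Metric.closedBall t _).indicator f) t]
                refine lintegral_mono fun x => ?_
                refine Set.indicator_apply_le' (fun hx => ?_) fun _ => zero_le
                rw [Set.indicator_of_mem]
                rw [Metric.mem_closedBall, Real.dist_eq, add_sub_cancel_left, abs_of_pos
                  (hpos.trans hx.1)]
                exact hx.2
            _ ≤ ENNReal.ofReal ((r * (1 / 2) ^ (j + 1)) ^ (th - 1)) *
                  (ENNReal.ofReal (2 * (r * (1 / 2) ^ j)) * dyadicMaximal f t) := by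
                gcongr
                exact lintegral_closedBall_le_dyadicMaximal f t (by positivity)
            _ = _ := by
                rw [← mul_assoc, ← mul_assoc (ENNReal.ofReal _) (ENNReal.ofReal _), ← ENNReal.ofReal_mul (by positivity),
                  ← ENNReal.ofReal_mul (by positivity)]
                congr 2
                have e1 : ((1 : ℝ) / 2) ^ j = 2 ^ (-(j : ℝ)) := by
                  rw [Real.rpow_neg (by norm_num), Real.rpow_natCast]; simp
                have e2 : ((1 : ℝ) / 2) ^ (j + 1) = 2 ^ (-(j : ℝ) - 1) := by
                  rw [pow_succ, e1, Real.rpow_sub_one (by norm_num)]; ring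
                rw [e1, e2, Real.mul_rpow hr.le (by positivity), ← Real.rpow_natCast,
                  ← Real.rpow_mul (by norm_num), ← Real.rpow_mul (by norm_num)]
                have e3 : r ^ th = r ^ (th - 1) * r := by
                  rw [Real.rpow_sub_one hr.ne']; field_simp
                have e4 : (2 : ℝ) ^ ((-(j : ℝ) - 1) * (th - 1)) * 2 ^ (-(j : ℝ))
                    = 2 ^ (1 - th) * 2 ^ (-th * j) := by
                  rw [← Real.rpow_add (by norm_num), ← Real.rpow_add (by norm_num)]
                  congr 1; ring
                rw [e3]
                linear_combination (2 * r ^ (th - 1) * r) * e4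
      _ = ENNReal.ofReal c1 * (ENNReal.ofReal (r ^ th) * dyadicMaximal f t) := by
          rw [ENNReal.tsum_mul_right, ← ENNReal.ofReal_tsum_of_nonneg (fun j => by positivity)
            (hsum.mul_left _), tsum_mul_left]
  -- Hölder with the conjugate exponent `q` of `p`; the tail converges because `(th - 1) q < -1` is
  -- the condition `th < 1/p`.
  have far : ∫⁻ x in Set.Ioi r, ENNReal.ofReal (x ^ (th - 1)) * f (t + x)
      ≤ ENNReal.ofReal c2 * (ENNReal.ofReal (r ^ (th - 1 / p)) * recipNorm (1 / p) f volume) := by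
    have hol := ENNReal.lintegral_mul_norm_pow_le (μ := volume.restrict (Set.Ioi r))
      (f := fun x => ENNReal.ofReal (x ^ ((th - 1) * q))) (g := fun x => f (t + x) ^ p)
      (by fun_prop) (hft.pow_const _).aemeasurable (p := 1 / q) (q := 1 / p)
      (by positivity) (by positivity) (by rw [hq, one_div_one_div]; ring)
    have e1 : ∫⁻ x in Set.Ioi r, ENNReal.ofReal (x ^ (th - 1)) * f (t + x)
        = ∫⁻ x in Set.Ioi r, ENNReal.ofReal (x ^ ((th - 1) * q)) ^ (1 / q) *
          (f (t + x) ^ p) ^ (1 / p) := by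
      refine setLIntegral_congr_fun measurableSet_Ioi fun x hx => ?_
      have hx0 : 0 < x := hr.trans hx
      rw [← ENNReal.rpow_mul, mul_one_div_cancel hp0.ne', ENNReal.rpow_one,
        ENNReal.ofReal_rpow_of_pos (by positivity), ← Real.rpow_mul hx0.le, mul_assoc,
        mul_one_div_cancel hq0.ne', mul_one]
    have e2 : ∫⁻ x in Set.Ioi r, ENNReal.ofReal (x ^ ((th - 1) * q))
        = ENNReal.ofReal (r ^ ((th - 1) * q + 1) * (1 / (-((th - 1) * q + 1)))) := by
      rw [← ofReal_integral_eq_lintegral_ofReal (integrableOn_Ioi_rpow_of_lt hqe hr),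
        integral_Ioi_rpow_of_lt hqe hr]
      · congr 1
        have : (th - 1) * q + 1 ≠ 0 := by linarith
        field_simp
      · filter_upwards [ae_restrict_mem measurableSet_Ioi] with x hx
        exact Real.rpow_nonneg (hr.trans hx).le _
    rw [e1]
    refine hol.trans ?_
    have hneg : 0 ≤ 1 / (-((th - 1) * q + 1)) := by apply one_div_nonneg.2; linarith
    rw [e2, ENNReal.ofReal_rpow_of_nonneg (by positivity) (by positivity),
      Real.mul_rpow (by positivity) hneg, ← Real.rpow_mul hr.le, recipNorm_one_div hp0, ← hc2]
    have e3 : ((th - 1) * q + 1) * (1 / q) = th - 1 / p := by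
      rw [add_mul, mul_assoc, mul_one_div_cancel hq0.ne', hq, one_div_one_div]; ring
    rw [e3, ENNReal.ofReal_mul (by positivity), mul_comm (ENNReal.ofReal (r ^ _)), mul_assoc]
    refine mul_le_mul' le_rfl (mul_le_mul' le_rfl (ENNReal.rpow_le_rpow ?_ (by positivity)))
    rw [← lintegral_add_left_eq_self (fun x => f x ^ p) t]
    exact setLIntegral_le_lintegral _ _
  rw [← Set.Ioc_union_Ioi_eq_Ioi hr.le]
  refine (lintegral_union_le _ _ _).trans ((add_le_add near far).trans ?_)
  rw [mul_add]
  have hc : (Real.toNNReal (c1 + c2) : ENNReal) = ENNReal.ofReal (c1 + c2) := rfl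
  rw [hc]
  gcongr
  · linarith
  · have : 0 ≤ c1 := by positivity
    linarith

/-- Every bounded set lies in a ball about `t`, so vanishing of the maximal function at one point
forces `f = 0` almost everywhere. This excludes division by zero when the radius is optimized in
Hedberg's estimate. -/
theorem recipNorm_eq_zero_of_dyadicMaximal_eq_zero {f : ℝ → ENNReal} (hf : Measurable f) {t i : ℝ}
    (hi : 0 ≤ i) (h : dyadicMaximal f t = 0) : recipNorm i f volume = 0 := by
  have h1 : ∀ k : ℕ, ∀ᵐ x ∂(volume.restrict (Metric.closedBall t ((k : ℝ) + 1))), f x = 0 := by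
    intro k
    have := lintegral_closedBall_le_dyadicMaximal f t (r := (k : ℝ) + 1) (by positivity)
    rw [h, mul_zero, nonpos_iff_eq_zero, lintegral_eq_zero_iff hf] at this
    exact this
  have h2 := (ae_restrict_iUnion_iff (μ := volume)
    (fun k : ℕ => Metric.closedBall t ((k : ℝ) + 1)) (fun x => f x = 0)).2 h1
  have h3 : ⋃ k : ℕ, Metric.closedBall t ((k : ℝ) + 1) = Set.univ := by
    refine Set.eq_univ_of_forall fun x => ?_
    obtain ⟨k, hk⟩ := exists_nat_ge (dist x t)
    exact Set.mem_iUnion.2 ⟨k, Metric.mem_closedBall.2 (by linarith)⟩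
  rw [h3, Measure.restrict_univ] at h2
  have := recipNorm_mono_ae (i := i) hi (f := f) (g := fun _ => 0)
    (by filter_upwards [h2] with x hx; rw [hx])
  rwa [recipNorm_zero_fun hi, nonpos_iff_eq_zero] at this

/-- The Hardy–Littlewood–Sobolev inequality for the one-sided fractional integral on the line. -/
theorem recipNorm_fractional_le {p i : ℝ} (hp : 1 < p) (hi : 0 < i) (hip : i < 1 / p) :
    ∃ C : ℝ≥0, ∀ f : ℝ → ENNReal, Measurable f →
      recipNorm i (fun t => ∫⁻ x in Set.Ioi (0 : ℝ),
        ENNReal.ofReal (x ^ (1 / p - i - 1)) * f (t + x)) volume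
        ≤ C * recipNorm (1 / p) f volume := by
  have hp0 : 0 < p := by linarith
  obtain ⟨C1, hC1⟩ := fractional_le_of_pos (th := 1 / p - i) hp (by linarith) (by linarith)
  obtain ⟨C2, hC2⟩ := lintegral_dyadicMaximal_rpow_le hp
  -- The summand 1 keeps the constant nonzero, so the bound is trivial when the right-hand norm is
  -- infinite.
  refine ⟨2 * C1 * C2 ^ i + 1, fun f hf => ?_⟩
  set N := recipNorm (1 / p) f volume with hN
  rcases eq_or_ne N ⊤ with hNt | hNt
  · rw [hNt, ENNReal.mul_top]
    · exact le_top
    · simp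
  have hpi : 0 < p * i := by positivity
  have hpi1 : p * i < 1 := by rw [mul_comm]; exact (lt_div_iff₀ hp0).1 hip
  have point : ∀ t, ∫⁻ x in Set.Ioi (0 : ℝ), ENNReal.ofReal (x ^ (1 / p - i - 1)) * f (t + x)
      ≤ (2 * C1 * N ^ (1 - p * i)) * dyadicMaximal f t ^ (p * i) := by
    intro t
    rcases eq_or_ne N 0 with hN0 | hN0
    · have hae : ∀ᵐ x, f x = 0 := by
        rw [hN, recipNorm_one_div hp0, ENNReal.rpow_eq_zero_iff] at hN0
        have : ∫⁻ x, f x ^ p = 0 := by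
          rcases hN0 with h | h
          · exact h.1
          · have := one_div_pos.2 hp0
            linarith [h.2]
        rw [lintegral_eq_zero_iff (hf.pow_const _)] at this
        filter_upwards [this] with x hx
        simpa [hp0, hp0.not_gt] using hx
      have h0 : ∫⁻ x in Set.Ioi (0 : ℝ), ENNReal.ofReal (x ^ (1 / p - i - 1)) * f (t + x) = 0 := by
        rw [lintegral_eq_zero_iff (by fun_prop)]
        refine ae_restrict_of_ae ?_
        have := (measurePreserving_add_left (volume : Measure ℝ) t).quasiMeasurePreserving.ae hae
        filter_upwards [this] with x hx
        simp [hx]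
      rw [h0]; exact zero_le
    set M := dyadicMaximal f t with hM
    have hM0 : M ≠ 0 := fun h => hN0 (recipNorm_eq_zero_of_dyadicMaximal_eq_zero hf
      (by positivity) h)
    rcases eq_or_ne M ⊤ with hMt | hMt
    · rcases eq_or_ne C1 0 with hC | hC
      · have := hC1 f hf t 1 one_pos
        rw [hC] at this
        simp only [ENNReal.coe_zero, zero_mul] at this
        exact this.trans zero_le
      · rw [hMt, ENNReal.top_rpow_of_pos hpi, ENNReal.mul_top]
        · exact le_top
        · refine mul_ne_zero (mul_ne_zero two_ne_zero (by simpa using hC)) ?_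
          rw [Ne, ENNReal.rpow_eq_zero_iff]
          rintro (h | h)
          · exact hN0 h.1
          · exact hNt h.1
    obtain ⟨m, hm0, hm⟩ : ∃ m : ℝ, 0 < m ∧ M = ENNReal.ofReal m :=
      ⟨M.toReal, ENNReal.toReal_pos hM0 hMt, (ENNReal.ofReal_toReal hMt).symm⟩
    obtain ⟨n, hn0, hn⟩ : ∃ n : ℝ, 0 < n ∧ N = ENNReal.ofReal n :=
      ⟨N.toReal, ENNReal.toReal_pos hN0 hNt, (ENNReal.ofReal_toReal hNt).symm⟩
    -- The radius `(N/M)^p` makes the two terms of Hedberg's estimate equal.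
    refine (hC1 f hf t ((n / m) ^ p) (by positivity)).trans (le_of_eq ?_)
    rw [← hN, ← hM, hm, hn, ENNReal.ofReal_rpow_of_pos hm0, ENNReal.ofReal_rpow_of_pos hn0,
      ← ENNReal.ofReal_mul (by positivity), ← ENNReal.ofReal_mul (by positivity)]
    have e1 : ((n / m) ^ p) ^ (1 / p - i) * m = n ^ (1 - p * i) * m ^ (p * i) := by
      rw [← Real.rpow_mul (by positivity), mul_sub, mul_one_div_cancel hp0.ne',
        Real.div_rpow hn0.le hm0.le, div_mul_eq_mul_div, mul_div_assoc]
      congr 1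
      rw [Real.rpow_sub hm0, Real.rpow_one]
      field_simp
    have e2 : ((n / m) ^ p) ^ (1 / p - i - 1 / p) * n = n ^ (1 - p * i) * m ^ (p * i) := by
      rw [← Real.rpow_mul (by positivity)]
      have : p * (1 / p - i - 1 / p) = -(p * i) := by ring
      rw [this, Real.rpow_neg (by positivity), Real.div_rpow hn0.le hm0.le, Real.rpow_sub hn0,
        Real.rpow_one]
      field_simp
    rw [e1, e2, ENNReal.ofReal_mul (by positivity), ← two_mul]
    ring
  refine (recipNorm_mono hi.le point).trans ?_
  rw [recipNorm_const_mul hi.le (by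
    refine ENNReal.mul_ne_top (ENNReal.mul_ne_top (by simp) (by simp)) ?_
    exact ENNReal.rpow_ne_top_of_nonneg (by linarith) hNt), recipNorm_of_ne_zero hi.ne']
  have e : ∀ t, (dyadicMaximal f t ^ (p * i)) ^ (1 / i) = dyadicMaximal f t ^ p := by
    intro t
    rw [← ENNReal.rpow_mul]; congr 1; field_simp
  simp_rw [e]
  have hNp : ∫⁻ x, f x ^ p = N ^ p := by
    rw [hN, recipNorm_one_div hp0, ← ENNReal.rpow_mul, one_div_mul_cancel hp0.ne', ENNReal.rpow_one]
  calc 2 * C1 * N ^ (1 - p * i) * (∫⁻ t, dyadicMaximal f t ^ p) ^ i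
      ≤ 2 * C1 * N ^ (1 - p * i) * (C2 * N ^ p) ^ i := by
        gcongr
        rw [← hNp]
        exact hC2 f hf
    _ = 2 * C1 * C2 ^ i * (N ^ (1 - p * i) * N ^ (p * i)) := by
        rw [ENNReal.mul_rpow_of_nonneg _ _ hi.le, ← ENNReal.rpow_mul]; ring
    _ = 2 * C1 * C2 ^ i * N := by
        rw [← ENNReal.rpow_add_of_nonneg _ _ (by linarith) hpi.le, sub_add_cancel, ENNReal.rpow_one]
    _ ≤ _ := by
        gcongr
        push_cast
        rw [← ENNReal.coe_rpow_of_nonneg _ hi.le]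
        exact le_self_add

/-! ### One-sided convolutions on the line. -/

/-- From `1 - e^(-x) ≥ x/(1+x)` the singular factor is at most `(1+x)^κ x^(-κ)`, and `(1+x)^κ ≤ 1+x`
is absorbed by giving up half of the exponential decay. -/
theorem exp_mul_one_sub_exp_rpow_le {c κ x : ℝ} (hc : 0 < c) (hκ : 0 < κ) (hκ1 : κ ≤ 1)
    (hx : 0 < x) :
    Real.exp (-c * x) * (1 - Real.exp (-x)) ^ (-κ)
      ≤ (1 + 2 / c) * (Real.exp (-(c / 2) * x) * x ^ (-κ)) := by
  have h1 : x / (1 + x) ≤ 1 - Real.exp (-x) := by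
    have h2 : Real.exp (-x) ≤ 1 / (1 + x) := by
      rw [Real.exp_neg, ← one_div]
      exact one_div_le_one_div_of_le (by positivity) (by linarith [Real.add_one_le_exp x])
    have : x / (1 + x) = 1 - 1 / (1 + x) := by field_simp; ring
    linarith
  have h3 : (1 - Real.exp (-x)) ^ (-κ) ≤ (1 + x) * x ^ (-κ) := by
    refine (Real.rpow_le_rpow_of_nonpos (by positivity) h1 (by linarith)).trans ?_
    rw [Real.div_rpow hx.le (by positivity), Real.rpow_neg (by positivity : (0 : ℝ) ≤ 1 + x),
      div_inv_eq_mul, mul_comm]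
    gcongr
    calc (1 + x) ^ κ ≤ (1 + x) ^ (1 : ℝ) := Real.rpow_le_rpow_of_exponent_le (by linarith) hκ1
      _ = 1 + x := Real.rpow_one _
  have h4 : Real.exp (-c * x) * (1 + x) ≤ (1 + 2 / c) * Real.exp (-(c / 2) * x) := by
    have h5 := Real.add_one_le_exp (c / 2 * x)
    have h6 : Real.exp (-c * x) = Real.exp (-(c / 2) * x) * Real.exp (-(c / 2) * x) := by
      rw [← Real.exp_add]; congr 1; ring
    have h7 : Real.exp (-(c / 2) * x) * Real.exp (c / 2 * x) = 1 := by
      rw [← Real.exp_add]; simp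
    have h8 : 1 + x ≤ (1 + 2 / c) * Real.exp (c / 2 * x) := by
      have : 1 + x ≤ (1 + 2 / c) * (c / 2 * x + 1) := by
        have : (1 + 2 / c) * (c / 2 * x + 1) = 1 + x + (2 / c + c / 2 * x) := by field_simp; ring
        rw [this]
        have : 0 < 2 / c + c / 2 * x := by positivity
        linarith
      exact this.trans (by gcongr)
    rw [h6, mul_assoc, mul_comm (1 + 2 / c)]
    gcongr
    calc Real.exp (-(c / 2) * x) * (1 + x)
        ≤ Real.exp (-(c / 2) * x) * ((1 + 2 / c) * Real.exp (c / 2 * x)) := by gcongr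
      _ = 1 + 2 / c := by linear_combination (1 + 2 / c) * h7
  calc Real.exp (-c * x) * (1 - Real.exp (-x)) ^ (-κ)
      ≤ Real.exp (-c * x) * ((1 + x) * x ^ (-κ)) := by gcongr
    _ = (Real.exp (-c * x) * (1 + x)) * x ^ (-κ) := by ring
    _ ≤ ((1 + 2 / c) * Real.exp (-(c / 2) * x)) * x ^ (-κ) := by gcongr
    _ = _ := by ring

theorem lintegral_Ioi_sub_eq (h V : ℝ → ENNReal) (t : ℝ) :
    ∫⁻ τ in Set.Ioi t, h (τ - t) * V τ = ∫⁻ x in Set.Ioi (0 : ℝ), h x * V (t + x) := by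
  rw [← lintegral_indicator measurableSet_Ioi, ← lintegral_indicator measurableSet_Ioi,
    ← lintegral_add_left_eq_self (fun τ => (Set.Ioi t).indicator (fun τ => h (τ - t) * V τ) τ) t]
  refine lintegral_congr fun x => ?_
  simp [Set.indicator]

/-- Young's inequality for a one-sided convolution with a decaying, mildly singular kernel. -/
theorem recipNorm_one_sided_young {b κ i j : ℝ} (hb : 0 < b) (hκ : 0 < κ) (hi : 0 ≤ i) (hij : i ≤ j)
    (hj : j ≤ 1) (hj0 : 0 < j) (hκij : κ < 1 - (j - i)) :
    ∃ C : ℝ≥0, ∀ V : ℝ → ENNReal, Measurable V →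
      recipNorm i (fun t => ∫⁻ τ in Set.Ioi t,
        ENNReal.ofReal (Real.exp (-b * (τ - t)) * (τ - t) ^ (-κ)) * V τ) volume
        ≤ C * recipNorm j V volume := by
  -- Young's exponent for the pair `i`, `j`. The kernel has finite `L^m` norm: `κ m < 1` controls it
  -- at 0 and the exponential at infinity.
  set m : ℝ := 1 / (1 - (j - i)) with hm
  have hm0 : 0 < m := by rw [hm]; apply one_div_pos.2; linarith
  set h : ℝ → ENNReal := (Set.Ioi (0 : ℝ)).indicator
    (fun x => ENNReal.ofReal (Real.exp (-b * x) * x ^ (-κ))) with hh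
  have hhm : Measurable h := Measurable.indicator (by fun_prop) measurableSet_Ioi
  have hκm : -1 < -κ * m := by
    have : κ * m < 1 := by rw [hm, mul_one_div, div_lt_one (by linarith)]; exact hκij
    linarith
  have hI : ∫⁻ x, h x ^ m ≠ ⊤ := by
    have hint := integrableOn_rpow_mul_exp_neg_mul_rpow (p := 1) (s := -κ * m) (b := b * m) hκm
      one_pos (by positivity)
    have e : ∫⁻ x, h x ^ m
        = ∫⁻ x in Set.Ioi (0 : ℝ), ‖x ^ (-κ * m) * Real.exp (-(b * m) * x ^ (1 : ℝ))‖ₑ := by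
      rw [← lintegral_indicator measurableSet_Ioi]
      refine lintegral_congr fun x => ?_
      simp only [hh, Set.indicator, Set.mem_Ioi]
      split_ifs with hx
      · rw [Real.enorm_of_nonneg (by positivity), ENNReal.ofReal_rpow_of_nonneg (by positivity) hm0.le,
          Real.mul_rpow (by positivity) (by positivity), ← Real.rpow_mul hx.le, ← Real.exp_mul,
          Real.rpow_one, mul_comm]
        congr 3; ring
      · exact ENNReal.zero_rpow_of_pos hm0
    rw [e]
    exact hint.2.ne
  set K := (∫⁻ x, h x ^ m) ^ (1 / m) with hK
  have hKt : K ≠ ⊤ := ENNReal.rpow_ne_top_of_nonneg (by positivity) hI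
  have hKm : K ^ m = ∫⁻ x, h x ^ m := by
    rw [hK, ← ENNReal.rpow_mul, one_div_mul_cancel hm0.ne', ENNReal.rpow_one]
  refine ⟨K.toNNReal, fun V hV => ?_⟩
  rw [ENNReal.coe_toNNReal hKt]
  have := recipNorm_kernel_le (μ := (volume : Measure ℝ)) (ν := (volume : Measure ℝ))
    (i := i) (j := j) (m := m) hi hj hij hj0 hm0 (by rw [hm, one_div_one_div]; ring)
    (k := fun t τ => h (τ - t)) (by
      exact hhm.comp (measurable_snd.sub measurable_fst)) hKt
    (fun t => by rw [hKm]; exact (lintegral_sub_right_eq_self (fun x => h x ^ m) t).le)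
    (fun τ => by rw [hKm]; exact (lintegral_sub_left_eq_self (fun x => h x ^ m) τ).le) hV
  refine le_trans (recipNorm_mono hi fun t => ?_) this
  rw [← lintegral_indicator measurableSet_Ioi]
  refine lintegral_mono fun τ => ?_
  simp only [Set.indicator, hh, Set.mem_Ioi, sub_pos]
  split_ifs <;> simp

/-- Boundedness of the one-sided convolution with `e^{-cx} (1 - e^{-x})^{-κ}`. -/
theorem recipNorm_one_sided_le {c κ i j : ℝ} (hc : 0 < c) (hκ : 0 < κ) (hi : 0 ≤ i) (hij : i ≤ j)
    (hj : j ≤ 1) (hj0 : 0 < j)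
    (h : κ < 1 - (j - i) ∨ κ = 1 - (j - i) ∧ j < 1 ∧ 0 < i ∧ i < j) :
    ∃ C : ℝ≥0, ∀ V : ℝ → ENNReal, Measurable V →
      recipNorm i (fun t => ∫⁻ τ in Set.Ioi t,
        ENNReal.ofReal (Real.exp (-c * (τ - t)) * (1 - Real.exp (-(τ - t))) ^ (-κ)) * V τ) volume
        ≤ C * recipNorm j V volume := by
  have hκ1 : κ ≤ 1 := by rcases h with h | h <;> linarith [h]
  have main : ∃ C : ℝ≥0, ∀ V : ℝ → ENNReal, Measurable V →
      recipNorm i (fun t => ∫⁻ τ in Set.Ioi t,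
        ENNReal.ofReal (Real.exp (-(c / 2) * (τ - t)) * (τ - t) ^ (-κ)) * V τ) volume
        ≤ C * recipNorm j V volume := by
    rcases h with h | ⟨h, hj1, hi0, hij'⟩
    · exact recipNorm_one_sided_young (by positivity) hκ hi hij hj hj0 h
    -- In the critical case `-κ = j - i - 1` is exactly the fractional integration exponent, and the
    -- exponential is simply bounded by 1.
    · obtain ⟨C, hC⟩ := recipNorm_fractional_le (p := 1 / j) (i := i) (by
        rw [lt_div_iff₀ hj0]; linarith) hi0 (by rw [one_div_one_div]; exact hij')
      refine ⟨C, fun V hV => ?_⟩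
      have hCV := hC V hV
      rw [one_div_one_div] at hCV
      refine le_trans (recipNorm_mono hi fun t => ?_) hCV
      rw [lintegral_Ioi_sub_eq (fun x => ENNReal.ofReal (Real.exp (-(c / 2) * x) * x ^ (-κ))) V t]
      refine setLIntegral_mono' measurableSet_Ioi fun x hx => ?_
      have hx0 : (0 : ℝ) < x := hx
      refine mul_le_mul' (ENNReal.ofReal_le_ofReal ?_) le_rfl
      have e : -κ = j - i - 1 := by linarith
      rw [e]
      refine mul_le_of_le_one_left (by positivity) (Real.exp_le_one_iff.2 ?_)
      have : 0 < c / 2 * x := by positivity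
      linarith
  obtain ⟨C, hC⟩ := main
  refine ⟨Real.toNNReal (1 + 2 / c) * C, fun V hV => ?_⟩
  refine le_trans (recipNorm_mono hi (g := fun t => ENNReal.ofReal (1 + 2 / c) * ∫⁻ τ in Set.Ioi t,
        ENNReal.ofReal (Real.exp (-(c / 2) * (τ - t)) * (τ - t) ^ (-κ)) * V τ) fun t => ?_) ?_
  · rw [← lintegral_const_mul' _ _ ENNReal.ofReal_ne_top]
    refine setLIntegral_mono' measurableSet_Ioi fun τ hτ => ?_
    rw [← mul_assoc, ← ENNReal.ofReal_mul (by positivity)]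
    exact mul_le_mul' (ENNReal.ofReal_le_ofReal
      (exp_mul_one_sub_exp_rpow_le hc hκ hκ1 (sub_pos.2 hτ))) le_rfl
  · rw [recipNorm_const_mul hi ENNReal.ofReal_ne_top, ENNReal.coe_mul, mul_assoc]
    exact mul_le_mul' le_rfl (hC V hV)

/-! ### Polar coordinates and kernels on the sphere. -/

/-- The unit sphere of `ℝⁿ`. -/
abbrev UnitSphere (n : ℕ) := Metric.sphere (0 : EuclideanSpace ℝ (Fin n)) 1

/-- The surface measure on the unit sphere of `ℝⁿ`. -/
noncomputable abbrev surfaceMeasure (n : ℕ) : Measure (UnitSphere n) :=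
  (volume : Measure (EuclideanSpace ℝ (Fin n))).toSphere

section Polar

open scoped Pointwise

variable {n : ℕ}

theorem nontrivial_euclideanSpace (hn : 1 ≤ n) : Nontrivial (EuclideanSpace ℝ (Fin n)) := by
  have : Nonempty (Fin n) := ⟨⟨0, hn⟩⟩
  infer_instance

theorem lintegral_polar {f : EuclideanSpace ℝ (Fin n) → ENNReal} (hn : 1 ≤ n) (hf : Measurable f) :
    ∫⁻ x, f x = ∫⁻ θ, (∫⁻ ρ in Set.Ioi (0 : ℝ),
      ENNReal.ofReal (ρ ^ (n - 1)) * f (ρ • (θ : EuclideanSpace ℝ (Fin n)))) ∂surfaceMeasure n := by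
  have := nontrivial_euclideanSpace hn
  have hmp := (volume : Measure (EuclideanSpace ℝ (Fin n))).measurePreserving_homeomorphUnitSphereProd
  have hmeas : Measurable fun z : UnitSphere n × Set.Ioi (0 : ℝ) =>
      f ((z.2 : ℝ) • (z.1 : EuclideanSpace ℝ (Fin n))) := by fun_prop
  have hcomp : ∀ x : ({0}ᶜ : Set (EuclideanSpace ℝ (Fin n))),
      f x = f (((homeomorphUnitSphereProd _ x).2 : ℝ) •
        ((homeomorphUnitSphereProd _ x).1 : EuclideanSpace ℝ (Fin n))) := by
    intro x
    have hx : ‖(x : EuclideanSpace ℝ (Fin n))‖ ≠ 0 := norm_ne_zero_iff.2 x.2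
    congr 1
    simp [smul_smul, mul_inv_cancel₀ hx]
  calc ∫⁻ x, f x = ∫⁻ x in ({0}ᶜ : Set (EuclideanSpace ℝ (Fin n))), f x := by
        rw [restrict_compl_singleton]
    _ = ∫⁻ x : ({0}ᶜ : Set (EuclideanSpace ℝ (Fin n))), f x ∂(volume.comap Subtype.val) := by
        rw [lintegral_subtype_comap (measurableSet_singleton _).compl]
    _ = ∫⁻ z : UnitSphere n × Set.Ioi (0 : ℝ), f ((z.2 : ℝ) • (z.1 : EuclideanSpace ℝ (Fin n)))
          ∂((surfaceMeasure n).prod (.volumeIoiPow (n - 1))) := by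
        have h := hmp.lintegral_comp hmeas
        simp only [finrank_euclideanSpace, Fintype.card_fin] at h
        rw [← h]
        exact lintegral_congr hcomp
    _ = ∫⁻ θ, (∫⁻ ρ : Set.Ioi (0 : ℝ), f ((ρ : ℝ) • (θ : EuclideanSpace ℝ (Fin n)))
          ∂(.volumeIoiPow (n - 1))) ∂surfaceMeasure n := by
        rw [lintegral_prod _ hmeas.aemeasurable]
    _ = _ := by
        refine lintegral_congr fun θ => ?_
        rw [Measure.volumeIoiPow, lintegral_withDensity_eq_lintegral_mul _ (by fun_prop)
          (by fun_prop)]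
        exact lintegral_subtype_comap measurableSet_Ioi (fun ρ : ℝ =>
          ENNReal.ofReal (ρ ^ (n - 1)) * f (ρ • (θ : EuclideanSpace ℝ (Fin n))))

/-- The surface measure of a cap is `n` times the volume of the cone over it. For `r < 1` the cone
is covered by at most `2/r` balls of radius `3r` centered on its axis, of total volume of order
`r^(n-1)`. For `r ≥ 1` the measure of the whole sphere suffices. -/
theorem surfaceMeasure_cap_le (hn : 1 ≤ n) :
    ∃ C : ℝ≥0, ∀ (ξ : UnitSphere n) (r : ℝ), 0 < r →
      surfaceMeasure n {η | dist η ξ ≤ r} ≤ C * ENNReal.ofReal (r ^ (n - 1)) := by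
  set V := (volume : Measure (EuclideanSpace ℝ (Fin n))) (Metric.ball 0 1) with hV
  have hVt : V ≠ ⊤ := measure_ball_lt_top.ne
  set U := surfaceMeasure n Set.univ with hU
  have hUt : U ≠ ⊤ := measure_ne_top _ _
  refine ⟨U.toNNReal + n * 3 * 3 ^ n * V.toNNReal, fun ξ r hr => ?_⟩
  push_cast
  rw [ENNReal.coe_toNNReal hUt, ENNReal.coe_toNNReal hVt, add_mul]
  rcases le_or_gt 1 r with hr1 | hr1
  · refine le_trans ?_ le_self_add
    calc surfaceMeasure n {η | dist η ξ ≤ r} ≤ U := measure_mono (Set.subset_univ _)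
      _ ≤ U * ENNReal.ofReal (r ^ (n - 1)) := by
        refine le_mul_of_one_le_right zero_le ?_
        rw [ENNReal.one_le_ofReal]
        exact one_le_pow₀ hr1
  · refine le_trans ?_ le_add_self
    have hms : MeasurableSet {η : UnitSphere n | dist η ξ ≤ r} :=
      (isClosed_le (by fun_prop) continuous_const).measurableSet
    rw [surfaceMeasure, Measure.toSphere_apply' _ hms]
    obtain ⟨N, hN⟩ : ∃ N : ℕ, N = ⌊1 / r⌋₊ + 1 := ⟨_, rfl⟩
    have hNr : (N : ℝ) ≤ 2 / r := by
      have : (⌊1 / r⌋₊ : ℝ) ≤ 1 / r := Nat.floor_le (by positivity)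
      have h1 : 1 ≤ 1 / r := (one_le_div hr).2 hr1.le
      rw [hN]; push_cast
      have : 2 / r = 1 / r + 1 / r := by ring
      linarith
    have hcov : (Set.Ioo (0 : ℝ) 1 • (Subtype.val '' {η : UnitSphere n | dist η ξ ≤ r}) :
        Set (EuclideanSpace ℝ (Fin n)))
        ⊆ ⋃ j ∈ Finset.range N, Metric.ball ((j * r) • (ξ : EuclideanSpace ℝ (Fin n))) (3 * r) := by
      rintro _ ⟨t, ht, _, ⟨η, hη, rfl⟩, rfl⟩
      have hη' : ‖(η : EuclideanSpace ℝ (Fin n)) - ξ‖ ≤ r := by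
        rw [← dist_eq_norm]; exact hη
      refine Set.mem_biUnion (x := ⌊t / r⌋₊) ?_ ?_
      · have : ⌊t / r⌋₊ ≤ ⌊1 / r⌋₊ := Nat.floor_le_floor (by gcongr; exact ht.2.le)
        simp only [Finset.coe_range, Set.mem_Iio]
        omega
      · have h1 : (⌊t / r⌋₊ : ℝ) ≤ t / r := Nat.floor_le (div_nonneg ht.1.le hr.le)
        have h2 : t / r < ⌊t / r⌋₊ + 1 := Nat.lt_floor_add_one _
        rw [le_div_iff₀ hr] at h1
        rw [div_lt_iff₀ hr] at h2
        have hξ : ‖(ξ : EuclideanSpace ℝ (Fin n))‖ = 1 := norm_eq_of_mem_sphere ξ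
        rw [Metric.mem_ball, dist_eq_norm]
        calc ‖t • (η : EuclideanSpace ℝ (Fin n)) - (⌊t / r⌋₊ * r) • (ξ : EuclideanSpace ℝ (Fin n))‖
            = ‖t • ((η : EuclideanSpace ℝ (Fin n)) - ξ) + (t - ⌊t / r⌋₊ * r) •
                (ξ : EuclideanSpace ℝ (Fin n))‖ := by congr 1; module
          _ ≤ t * ‖(η : EuclideanSpace ℝ (Fin n)) - ξ‖ + (t - ⌊t / r⌋₊ * r) * 1 := by
              refine (norm_add_le _ _).trans ?_
              rw [norm_smul, norm_smul, hξ, Real.norm_of_nonneg ht.1.le,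
                Real.norm_of_nonneg (by linarith)]
          _ ≤ 1 * r + r := by
              refine add_le_add (mul_le_mul ht.2.le hη' (norm_nonneg _) zero_le_one) ?_
              linarith
          _ < 3 * r := by linarith
    have hball : ∀ x : EuclideanSpace ℝ (Fin n),
        volume (Metric.ball x (3 * r)) = ENNReal.ofReal ((3 * r) ^ n) * V := by
      intro x
      have := nontrivial_euclideanSpace hn
      rw [Measure.addHaar_ball _ _ (by positivity)]
      simp [hV]
    calc (Module.finrank ℝ (EuclideanSpace ℝ (Fin n)) : ENNReal) * volume
          (Set.Ioo (0 : ℝ) 1 • (Subtype.val '' {η : UnitSphere n | dist η ξ ≤ r}) :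
            Set (EuclideanSpace ℝ (Fin n)))
        ≤ n * ∑ j ∈ Finset.range N, volume
            (Metric.ball ((j * r) • (ξ : EuclideanSpace ℝ (Fin n))) (3 * r)) := by
          rw [finrank_euclideanSpace, Fintype.card_fin]
          gcongr
          exact (measure_mono hcov).trans (measure_biUnion_finset_le _ _)
      _ = n * (N * (ENNReal.ofReal ((3 * r) ^ n) * V)) := by
          simp_rw [hball]; simp
      _ ≤ n * (ENNReal.ofReal (2 / r) * (ENNReal.ofReal ((3 * r) ^ n) * V)) := by
          gcongr
          rw [← ENNReal.ofReal_natCast]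
          exact ENNReal.ofReal_le_ofReal hNr
      _ = n * (ENNReal.ofReal (2 / r * (3 * r) ^ n) * V) := by
          rw [ENNReal.ofReal_mul (by positivity), mul_assoc]
      _ ≤ n * (ENNReal.ofReal (3 * 3 ^ n * r ^ (n - 1)) * V) := by
          refine mul_le_mul' le_rfl (mul_le_mul' (ENNReal.ofReal_le_ofReal ?_) le_rfl)
          obtain ⟨d, rfl⟩ : ∃ d, n = d + 1 := ⟨n - 1, by omega⟩
          rw [add_tsub_cancel_right, mul_pow, pow_succ r]
          have : 2 / r * (3 ^ (d + 1) * (r ^ d * r)) = 2 * 3 ^ (d + 1) * r ^ d := by field_simp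
          rw [this]
          gcongr; norm_num
      _ = _ := by
          rw [ENNReal.ofReal_mul (by positivity), ENNReal.ofReal_mul (by positivity),
            ENNReal.ofReal_pow (by norm_num)]
          simp only [ENNReal.ofReal_ofNat]
          ring

/-- Dyadic decomposition in `max ε |η-ξ| ~ 2^j ε`: the cap of radius `2^(j+1) ε` has measure of
order `(2^j ε)^(n-1)`, so the excess `e` over the dimension leaves a geometric series in `2^(-e)`.
-/
theorem lintegral_sphere_max_rpow_le (hn : 1 ≤ n) {e : ℝ} (he : 0 < e) :
    ∃ C : ℝ≥0, ∀ (ξ : UnitSphere n) (ε : ℝ), 0 < ε →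
      ∫⁻ η, ENNReal.ofReal ((max ε (dist η ξ)) ^ (-((n : ℝ) - 1 + e))) ∂surfaceMeasure n
        ≤ C * ENNReal.ofReal (ε ^ (-e)) := by
  obtain ⟨C, hC⟩ := surfaceMeasure_cap_le hn
  have hn1 : (1 : ℝ) ≤ n := by exact_mod_cast hn
  have hd : ((n - 1 : ℕ) : ℝ) = (n : ℝ) - 1 := by push_cast [hn]; ring
  set b : ℝ := (n : ℝ) - 1 + e with hb
  have hb0 : 0 < b := by linarith
  have hsum : Summable fun j : ℕ => ((2 : ℝ) ^ (-e)) ^ j :=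
    summable_geometric_of_lt_one (by positivity)
      (Real.rpow_lt_one_of_one_lt_of_neg (by norm_num) (by linarith))
  set S := ∑' j : ℕ, ((2 : ℝ) ^ (-e)) ^ j with hS
  refine ⟨C * Real.toNNReal (2 ^ (n - 1) * S), fun ξ ε hε => ?_⟩
  have hms : ∀ r : ℝ, MeasurableSet {η : UnitSphere n | dist η ξ ≤ r} := fun r =>
    (isClosed_le (by fun_prop) continuous_const).measurableSet
  have point : ∀ η : UnitSphere n, ENNReal.ofReal ((max ε (dist η ξ)) ^ (-b))
      ≤ ∑' j : ℕ, {η : UnitSphere n | dist η ξ ≤ 2 ^ (j + 1) * ε}.indicator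
        (fun _ => ENNReal.ofReal ((2 ^ j * ε) ^ (-b))) η := by
    intro η
    obtain ⟨j, hj1, hj2⟩ : ∃ j : ℕ, 2 ^ j * ε ≤ max ε (dist η ξ) ∧
        dist η ξ ≤ 2 ^ (j + 1) * ε := by
      obtain ⟨j, hj1, hj2⟩ := exists_nat_pow_near (x := max ε (dist η ξ) / ε) (y := 2)
        (by rw [le_div_iff₀ hε, one_mul]; exact le_max_left _ _) (by norm_num)
      refine ⟨j, (le_div_iff₀ hε).1 hj1, (le_max_right _ _).trans ((div_lt_iff₀ hε).1 hj2).le⟩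
    refine le_trans ?_ (ENNReal.le_tsum j)
    rw [Set.indicator_of_mem (by simpa using hj2)]
    exact ENNReal.ofReal_le_ofReal
      (Real.rpow_le_rpow_of_nonpos (by positivity) hj1 (by linarith))
  calc ∫⁻ η, ENNReal.ofReal ((max ε (dist η ξ)) ^ (-b)) ∂surfaceMeasure n
      ≤ ∫⁻ η, ∑' j : ℕ, {η : UnitSphere n | dist η ξ ≤ 2 ^ (j + 1) * ε}.indicator
        (fun _ => ENNReal.ofReal ((2 ^ j * ε) ^ (-b))) η ∂surfaceMeasure n := lintegral_mono point
    _ = ∑' j : ℕ, ENNReal.ofReal ((2 ^ j * ε) ^ (-b)) *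
          surfaceMeasure n {η : UnitSphere n | dist η ξ ≤ 2 ^ (j + 1) * ε} := by
        rw [lintegral_tsum fun j => (Measurable.indicator measurable_const (hms _)).aemeasurable]
        congr 1; ext j
        rw [lintegral_indicator_const (hms _)]
    _ ≤ ∑' j : ℕ, ENNReal.ofReal ((2 ^ j * ε) ^ (-b)) *
          (C * ENNReal.ofReal ((2 ^ (j + 1) * ε) ^ (n - 1))) := by
        gcongr with j
        exact hC ξ _ (by positivity)
    _ = ∑' j : ℕ, C * ENNReal.ofReal (2 ^ (n - 1) * ((2 : ℝ) ^ (-e)) ^ j * ε ^ (-e)) := by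
        congr 1; ext j
        rw [mul_left_comm, ← ENNReal.ofReal_mul (by positivity)]
        congr 2
        rw [← Real.rpow_natCast (2 ^ (j + 1) * ε), hd, pow_succ, mul_assoc, mul_comm 2 ε,
          ← mul_assoc, Real.mul_rpow (y := 2) (by positivity) (by norm_num), ← mul_assoc,
          ← Real.rpow_add (by positivity), ← hd, Real.rpow_natCast, hd]
        have : -b + ((n : ℝ) - 1) = -e := by rw [hb]; ring
        rw [this, Real.mul_rpow (by positivity) hε.le, ← Real.rpow_natCast 2 j,
          ← Real.rpow_mul (by norm_num), ← Real.rpow_natCast _ j, ← Real.rpow_mul (by norm_num),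
          mul_comm (j : ℝ)]
        ring
    _ = _ := by
        rw [ENNReal.tsum_mul_left, ← ENNReal.ofReal_tsum_of_nonneg (fun j => by positivity)
          ((hsum.mul_left _).mul_right _), tsum_mul_right, tsum_mul_left, ENNReal.coe_mul, mul_assoc,
          ← mul_assoc (_ ^ _) (∑' _, _),
          ENNReal.ofReal_mul (mul_nonneg (by positivity) (tsum_nonneg fun j => by positivity)),
          ← mul_assoc]
        rfl

/-- Smoothing of the truncated kernel `max(ε, |η - ξ|)^{-(n-1)}` on the sphere. -/
theorem recipNorm_sphere_kernel_le (hn : 1 ≤ n) {i j κ : ℝ} (hi : 0 ≤ i) (hij : i ≤ j) (hj : j ≤ 1)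
    (hj0 : 0 < j) (hκ : 0 < κ) (hij1 : j - i < 1) (hκij : (n - 1) * (j - i) ≤ κ) :
    ∃ C : ℝ≥0, ∀ ε : ℝ, 0 < ε → ε ≤ 1 → ∀ g : UnitSphere n → ENNReal, Measurable g →
      recipNorm i (fun ξ => ∫⁻ η, ENNReal.ofReal ((max ε (dist η ξ)) ^ (-((n : ℝ) - 1))) * g η
        ∂surfaceMeasure n) (surfaceMeasure n)
        ≤ C * ENNReal.ofReal (ε ^ (-κ)) * recipNorm j g (surfaceMeasure n) := by
  set m : ℝ := 1 / (1 - (j - i)) with hm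
  have hm0 : 0 < m := by rw [hm]; apply one_div_pos.2; linarith
  have hm1 : m - 1 = m * (j - i) := by
    rw [hm]; have : 1 - (j - i) ≠ 0 := by linarith
    field_simp; ring
  obtain ⟨C, hC⟩ := lintegral_sphere_max_rpow_le hn (e := κ * m) (by positivity)
  -- The exponent of the `m`-th power of the kernel is `-(n-1) m = f - (n-1+κ m)`. The hypothesis on
  -- `κ` says `f ≥ 0`, and since distances and `ε` are at most 2 this surplus costs only `2^f`.
  set f : ℝ := κ * m - ((n : ℝ) - 1) * (m * (j - i)) with hf
  have hf0 : 0 ≤ f := by rw [hf]; nlinarith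
  refine ⟨(C * Real.toNNReal (2 ^ f)) ^ (1 / m), fun ε hε hε1 g hg => ?_⟩
  set K : ENNReal := (((C * Real.toNNReal (2 ^ f)) ^ (1 / m) : ℝ≥0) : ENNReal)
    * ENNReal.ofReal (ε ^ (-κ)) with hK
  have hKm : K ^ m = ENNReal.ofReal (2 ^ f) * (C * ENNReal.ofReal (ε ^ (-(κ * m)))) := by
    rw [hK, ENNReal.mul_rpow_of_nonneg _ _ hm0.le, ← ENNReal.coe_rpow_of_nonneg _ hm0.le,
      ← NNReal.rpow_mul, one_div_mul_cancel hm0.ne', NNReal.rpow_one,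
      ENNReal.ofReal_rpow_of_nonneg (by positivity) hm0.le, ← Real.rpow_mul hε.le, neg_mul,
      ENNReal.coe_mul]
    change (C : ENNReal) * ENNReal.ofReal (2 ^ f) * _ = _
    ring
  have hbound : ∀ ξ : UnitSphere n, ∫⁻ η, ENNReal.ofReal
      ((max ε (dist η ξ)) ^ (-((n : ℝ) - 1))) ^ m ∂surfaceMeasure n ≤ K ^ m := by
    intro ξ
    rw [hKm]
    refine le_trans ?_ (mul_le_mul' le_rfl (hC ξ ε hε))
    rw [← lintegral_const_mul' _ _ ENNReal.ofReal_ne_top]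
    refine lintegral_mono fun η => ?_
    have hpos : 0 < max ε (dist η ξ) := lt_max_of_lt_left hε
    have h2 : max ε (dist η ξ) ≤ 2 := by
      refine max_le (by linarith) ?_
      have h1 : ‖(η : EuclideanSpace ℝ (Fin n))‖ = 1 := norm_eq_of_mem_sphere η
      have h2 : ‖(ξ : EuclideanSpace ℝ (Fin n))‖ = 1 := norm_eq_of_mem_sphere ξ
      calc dist η ξ = ‖(η : EuclideanSpace ℝ (Fin n)) - ξ‖ := by
            rw [Subtype.dist_eq, dist_eq_norm]
        _ ≤ 2 := by
          have := norm_sub_le (η : EuclideanSpace ℝ (Fin n)) ξ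
          linarith
    rw [ENNReal.ofReal_rpow_of_nonneg (by positivity) hm0.le, ← ENNReal.ofReal_mul (by positivity)]
    refine ENNReal.ofReal_le_ofReal ?_
    rw [← Real.rpow_mul hpos.le]
    have e : -((n : ℝ) - 1) * m = f + -((n : ℝ) - 1 + κ * m) := by
      rw [hf, ← hm1]; ring
    rw [e, Real.rpow_add hpos]
    gcongr
  refine recipNorm_kernel_le (i := i) (j := j) (m := m) hi hj hij hj0 hm0
    (by rw [hm, one_div_one_div]; ring)
    (k := fun ξ η => ENNReal.ofReal ((max ε (dist η ξ)) ^ (-((n : ℝ) - 1)))) (by fun_prop)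
    (by rw [hK]; exact ENNReal.mul_ne_top ENNReal.coe_ne_top ENNReal.ofReal_ne_top)
    hbound (fun η => ?_) hg
  simp_rw [dist_comm η]
  exact hbound η

end Polar

/-! ### Pointwise bound by the gradient in the exterior of a ball. -/

section Representation

variable {n : ℕ}

/-- The fundamental theorem of calculus from infinity, where `v` vanishes. The domain is a general
normed space because the bound also serves on `Fin 1 → ℝ`, for the circle. -/
theorem enorm_le_lintegral_ray {E F : Type*} [NormedAddCommGroup E] [NormedSpace ℝ E]
    [NormedAddCommGroup F] [NormedSpace ℝ F] {v : E → F} (hv : ContDiff ℝ 1 v)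
    (hvc : HasCompactSupport v) (x η : E) (hη : ‖η‖ = 1) :
    ‖v x‖ₑ ≤ ∫⁻ t in Set.Ioi (0 : ℝ), ‖fderiv ℝ v (x + t • η)‖ₑ := by
  have hiso : Isometry fun s : ℝ => x - s • η := by
    refine Isometry.of_dist_eq fun s t => ?_
    rw [dist_eq_norm, sub_sub_sub_cancel_left, ← sub_smul, norm_smul, hη, mul_one, dist_comm,
      dist_eq_norm]
  have hf : ContDiff ℝ 1 (v ∘ fun s : ℝ => x - s • η) := by fun_prop
  have h := HasCompactSupport.enorm_le_lintegral_Ici_deriv hf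
    (hvc.comp_isClosedEmbedding hiso.isClosedEmbedding) 0
  simp only [Function.comp_apply, zero_smul, sub_zero] at h
  refine h.trans ?_
  have hd : ∀ s : ℝ, ‖deriv (v ∘ fun s : ℝ => x - s • η) s‖ₑ ≤ ‖fderiv ℝ v (x - s • η)‖ₑ := by
    intro s
    have h1 : HasDerivAt (fun s : ℝ => x - s • η) (-η) s := by
      have := ((hasDerivAt_id s).smul_const η).const_sub x
      simpa using this
    have h2 : HasFDerivAt v (fderiv ℝ v (x - s • η)) (x - s • η) :=
      (hv.differentiable one_ne_zero _).hasFDerivAt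
    rw [(h2.comp_hasDerivAt s h1).deriv]
    calc ‖fderiv ℝ v (x - s • η) (-η)‖ₑ ≤ ‖fderiv ℝ v (x - s • η)‖ₑ * ‖-η‖ₑ :=
          ContinuousLinearMap.le_opENorm _ _
      _ = ‖fderiv ℝ v (x - s • η)‖ₑ := by
          have : ‖-η‖ₑ = 1 := by rw [enorm_neg, ← ofReal_norm, hη, ENNReal.ofReal_one]
          rw [this, mul_one]
  calc ∫⁻ s in Set.Iic (0 : ℝ), ‖deriv (v ∘ fun s : ℝ => x - s • η) s‖ₑ
      ≤ ∫⁻ s in Set.Iic (0 : ℝ), ‖fderiv ℝ v (x - s • η)‖ₑ := lintegral_mono hd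
    _ = ∫⁻ s in Set.Iio (0 : ℝ), ‖fderiv ℝ v (x - s • η)‖ₑ := by
        rw [restrict_Iio_eq_restrict_Iic]
    _ = ∫⁻ t in Set.Ioi (0 : ℝ), ‖fderiv ℝ v (x + t • η)‖ₑ := by
        rw [← lintegral_indicator measurableSet_Iio, ← lintegral_indicator measurableSet_Ioi,
          ← lintegral_neg_eq_self]
        refine lintegral_congr fun t => ?_
        simp [Set.indicator]

/-- Unit vectors at distance less than 1 have nonnegative inner product, so moving outward from `ρ
ξ` in the direction `η` cannot decrease the norm. This is the geometric fact that makes a lower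
bound on `α` unnecessary. -/
theorem norm_le_norm_add_smul {ξ η : UnitSphere n} (h : dist η ξ < 1) {ρ t : ℝ} (hρ : 0 ≤ ρ)
    (ht : 0 ≤ t) :
    ρ ≤ ‖ρ • (ξ : EuclideanSpace ℝ (Fin n)) + t • (η : EuclideanSpace ℝ (Fin n))‖ := by
  have h1 : ‖(ξ : EuclideanSpace ℝ (Fin n))‖ = 1 := norm_eq_of_mem_sphere ξ
  have h2 : ‖(η : EuclideanSpace ℝ (Fin n))‖ = 1 := norm_eq_of_mem_sphere η
  have h3 : ‖(η : EuclideanSpace ℝ (Fin n)) - ξ‖ < 1 := by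
    rwa [Subtype.dist_eq, dist_eq_norm] at h
  have h4 := norm_sub_sq_real (η : EuclideanSpace ℝ (Fin n)) ξ
  have h5 : 0 ≤ inner ℝ (η : EuclideanSpace ℝ (Fin n)) ξ := by
    rw [h1, h2] at h4
    nlinarith [norm_nonneg ((η : EuclideanSpace ℝ (Fin n)) - ξ)]
  have h6 := norm_add_sq_real (ρ • (ξ : EuclideanSpace ℝ (Fin n)))
    (t • (η : EuclideanSpace ℝ (Fin n)))
  rw [norm_smul, norm_smul, h1, h2, inner_smul_left, inner_smul_right, real_inner_comm] at h6
  simp only [Real.norm_eq_abs, mul_one, sq_abs, conj_trivial] at h6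
  refine le_of_sq_le_sq ?_ (norm_nonneg _)
  rw [h6]
  have := mul_nonneg hρ (mul_nonneg ht h5)
  nlinarith [sq_nonneg t]

/-- With `D` the right-hand side, `R - ρ ≤ D` by comparing norms, and `R |η-ξ| ≤ D + (R-ρ) ≤ 2D` by
the triangle inequality. -/
theorem max_le_norm_smul_sub (ξ η : UnitSphere n) {ρ R : ℝ} (hρ : 0 < ρ) (hR : ρ < R) :
    R / 2 * max (1 - ρ / R) (dist η ξ)
      ≤ ‖R • (η : EuclideanSpace ℝ (Fin n)) - ρ • (ξ : EuclideanSpace ℝ (Fin n))‖ := by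
  have hR0 : 0 < R := hρ.trans hR
  have h1 : ‖(ξ : EuclideanSpace ℝ (Fin n))‖ = 1 := norm_eq_of_mem_sphere ξ
  have h2 : ‖(η : EuclideanSpace ℝ (Fin n))‖ = 1 := norm_eq_of_mem_sphere η
  set D := ‖R • (η : EuclideanSpace ℝ (Fin n)) - ρ • (ξ : EuclideanSpace ℝ (Fin n))‖
  have h3 : R - ρ ≤ D := by
    have := norm_sub_norm_le (R • (η : EuclideanSpace ℝ (Fin n))) (ρ • (ξ : EuclideanSpace ℝ (Fin n)))
    rwa [norm_smul, norm_smul, h1, h2, Real.norm_of_nonneg hR0.le, Real.norm_of_nonneg hρ.le,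
      mul_one, mul_one] at this
  have h4 : R * dist η ξ ≤ D + (R - ρ) := by
    rw [Subtype.dist_eq, dist_eq_norm]
    calc R * ‖(η : EuclideanSpace ℝ (Fin n)) - ξ‖
        = ‖(R • (η : EuclideanSpace ℝ (Fin n)) - ρ • (ξ : EuclideanSpace ℝ (Fin n)))
            + (ρ - R) • (ξ : EuclideanSpace ℝ (Fin n))‖ := by
          rw [← Real.norm_of_nonneg hR0.le, ← norm_smul, Real.norm_of_nonneg hR0.le]
          congr 1; module
      _ ≤ D + (R - ρ) := by
          refine (norm_add_le _ _).trans ?_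
          rw [norm_smul, h1, mul_one, Real.norm_eq_abs, abs_sub_comm, abs_of_pos (by linarith)]
  rw [mul_max_of_nonneg _ _ (by positivity)]
  refine max_le ?_ (by linarith)
  have : R / 2 * (1 - ρ / R) = (R - ρ) / 2 := by field_simp
  rw [this]; linarith

/-- The ray bound is averaged over the directions within distance 1 of `ξ`, whose surface measure is
at least a constant `b` independent of `ξ`. Inserting `t^(n-1) t^(-(n-1))` turns the average into a
volume integral with kernel `|z-x|^(-(n-1))`. -/
theorem enorm_le_lintegral_outside (hn : 1 ≤ n) {F : Type*} [NormedAddCommGroup F]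
    [NormedSpace ℝ F] :
    ∃ C : ℝ≥0, ∀ v : EuclideanSpace ℝ (Fin n) → F, ContDiff ℝ 1 v → HasCompactSupport v →
      ∀ (ξ : UnitSphere n) (ρ : ℝ), 0 ≤ ρ →
      ‖v (ρ • (ξ : EuclideanSpace ℝ (Fin n)))‖ₑ ≤ C * ∫⁻ z, {z | ρ ≤ ‖z‖}.indicator
        (fun z => ENNReal.ofReal (‖z - ρ • (ξ : EuclideanSpace ℝ (Fin n))‖ ^ (-((n : ℝ) - 1))) *
          ‖fderiv ℝ v z‖ₑ) z := by
  have hd : ((n - 1 : ℕ) : ℝ) = (n : ℝ) - 1 := by push_cast [hn]; ring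
  have := nontrivial_euclideanSpace hn
  set b : ENNReal := (Measure.toSphereBallBound n 1 : ENNReal) *
    (volume : Measure (EuclideanSpace ℝ (Fin n))) (Metric.ball 0 1) with hb
  have hb0 : b ≠ 0 := mul_ne_zero
    (by simpa using (Measure.toSphereBallBound_pos n 1).ne')
    (Metric.measure_ball_pos _ _ one_pos).ne'
  refine ⟨(b⁻¹).toNNReal, fun v hv hvc ξ ρ hρ => ?_⟩
  rw [ENNReal.coe_toNNReal (by simpa using hb0)]
  set x : EuclideanSpace ℝ (Fin n) := ρ • (ξ : EuclideanSpace ℝ (Fin n)) with hx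
  have hbt : b ≠ ⊤ := ENNReal.mul_ne_top ENNReal.coe_ne_top measure_ball_lt_top.ne
  have hDv : Continuous (fderiv ℝ v) := hv.continuous_fderiv one_ne_zero
  have hbμ : b ≤ surfaceMeasure n (Metric.ball ξ 1) := by
    have := Measure.toSphereBallBound_mul_measure_unitBall_le_toSphere_ball
      (volume : Measure (EuclideanSpace ℝ (Fin n))) one_pos ξ
    simpa using this
  rw [← ENNReal.mul_le_iff_le_inv hb0 hbt]
  set H : EuclideanSpace ℝ (Fin n) → ENNReal := {z | ρ ≤ ‖z‖}.indicator
        (fun z => ENNReal.ofReal (‖z - x‖ ^ (-((n : ℝ) - 1))) * ‖fderiv ℝ v z‖ₑ) with hH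
  have hHm : Measurable H := Measurable.indicator (by fun_prop)
    (isClosed_le continuous_const continuous_norm).measurableSet
  calc b * ‖v x‖ₑ ≤ surfaceMeasure n (Metric.ball ξ 1) * ‖v x‖ₑ := by gcongr
    _ = ∫⁻ _ in Metric.ball ξ 1, ‖v x‖ₑ ∂surfaceMeasure n := by
        rw [setLIntegral_const, mul_comm]
    _ ≤ ∫⁻ η in Metric.ball ξ 1, (∫⁻ t in Set.Ioi (0 : ℝ), ENNReal.ofReal (t ^ (n - 1)) *
          H (x + t • (η : EuclideanSpace ℝ (Fin n)))) ∂surfaceMeasure n := by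
        refine setLIntegral_mono' Metric.isOpen_ball.measurableSet fun η hη => ?_
        have h1 : ‖(η : EuclideanSpace ℝ (Fin n))‖ = 1 := norm_eq_of_mem_sphere η
        refine (enorm_le_lintegral_ray hv hvc x η h1).trans ?_
        refine setLIntegral_mono' measurableSet_Ioi fun t ht => ?_
        have ht0 : (0 : ℝ) < t := ht
        rw [hH, Set.indicator_of_mem (by
          exact norm_le_norm_add_smul (Metric.mem_ball.1 hη) hρ ht0.le), ← mul_assoc,
          ← ENNReal.ofReal_mul (by positivity), add_sub_cancel_left, norm_smul, h1, mul_one,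
          Real.norm_of_nonneg ht0.le, ← Real.rpow_natCast, hd, ← Real.rpow_add ht0,
          add_neg_cancel, Real.rpow_zero, ENNReal.ofReal_one, one_mul]
    _ ≤ ∫⁻ η, (∫⁻ t in Set.Ioi (0 : ℝ), ENNReal.ofReal (t ^ (n - 1)) *
          H (x + t • (η : EuclideanSpace ℝ (Fin n)))) ∂surfaceMeasure n :=
        setLIntegral_le_lintegral _ _
    _ = ∫⁻ y, H (x + y) := (lintegral_polar hn (f := fun y => H (x + y)) (by fun_prop)).symm
    _ = ∫⁻ z, H z := lintegral_add_left_eq_self H x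

/-- Polar form of the bound by the derivative in the exterior of a ball. -/
theorem enorm_le_lintegral_polar (hn : 1 ≤ n) {F : Type*} [NormedAddCommGroup F]
    [NormedSpace ℝ F] :
    ∃ C : ℝ≥0, ∀ v : EuclideanSpace ℝ (Fin n) → F, ContDiff ℝ 1 v → HasCompactSupport v →
      ∀ (ξ : UnitSphere n) (ρ : ℝ), 0 < ρ →
      ‖v (ρ • (ξ : EuclideanSpace ℝ (Fin n)))‖ₑ ≤ C * ∫⁻ R in Set.Ioi ρ, (∫⁻ η,
        ENNReal.ofReal ((max (1 - ρ / R) (dist η ξ)) ^ (-((n : ℝ) - 1))) *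
          ‖fderiv ℝ v (R • (η : EuclideanSpace ℝ (Fin n)))‖ₑ ∂surfaceMeasure n) := by
  obtain ⟨C, hC⟩ := enorm_le_lintegral_outside hn (F := F)
  have hd : ((n - 1 : ℕ) : ℝ) = (n : ℝ) - 1 := by push_cast [hn]; ring
  have hn1 : (1 : ℝ) ≤ n := by exact_mod_cast hn
  refine ⟨C * Real.toNNReal (2 ^ ((n : ℝ) - 1)), fun v hv hvc ξ ρ hρ => ?_⟩
  have hDv : Continuous (fderiv ℝ v) := hv.continuous_fderiv one_ne_zero
  refine (hC v hv hvc ξ ρ hρ.le).trans ?_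
  rw [ENNReal.coe_mul, mul_assoc]
  refine mul_le_mul' le_rfl ?_
  set x : EuclideanSpace ℝ (Fin n) := ρ • (ξ : EuclideanSpace ℝ (Fin n)) with hx
  set H : EuclideanSpace ℝ (Fin n) → ENNReal := {z | ρ ≤ ‖z‖}.indicator
        (fun z => ENNReal.ofReal (‖z - x‖ ^ (-((n : ℝ) - 1))) * ‖fderiv ℝ v z‖ₑ) with hH
  have hHm : Measurable H := Measurable.indicator (by fun_prop)
    (isClosed_le continuous_const continuous_norm).measurableSet
  set c : ENNReal := ENNReal.ofReal (2 ^ ((n : ℝ) - 1)) with hc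
  have hcc : ((Real.toNNReal (2 ^ ((n : ℝ) - 1)) : ℝ≥0) : ENNReal) = c := rfl
  rw [hcc, lintegral_polar hn hHm, lintegral_lintegral_swap (Measurable.aemeasurable (by fun_prop)),
    ← lintegral_const_mul' _ _ ENNReal.ofReal_ne_top]
  have hsub : ∫⁻ R in Set.Ioi (0 : ℝ), (∫⁻ η : UnitSphere n, ENNReal.ofReal (R ^ (n - 1)) *
        H (R • (η : EuclideanSpace ℝ (Fin n))) ∂surfaceMeasure n)
      = ∫⁻ R in Set.Ioi ρ, (∫⁻ η : UnitSphere n, ENNReal.ofReal (R ^ (n - 1)) *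
        H (R • (η : EuclideanSpace ℝ (Fin n))) ∂surfaceMeasure n) := by
    rw [← Set.Ioc_union_Ioi_eq_Ioi hρ.le, lintegral_union measurableSet_Ioi
      (Set.disjoint_left.2 fun a ha hb => not_lt.2 ha.2 hb), ← restrict_Ioo_eq_restrict_Ioc,
      setLIntegral_congr_fun (g := fun _ => 0) measurableSet_Ioo, lintegral_zero, zero_add]
    intro R hR
    have : ∀ η : UnitSphere n, H (R • (η : EuclideanSpace ℝ (Fin n))) = 0 := by
      intro η
      rw [hH, Set.indicator_of_notMem]
      have h1 : ‖(η : EuclideanSpace ℝ (Fin n))‖ = 1 := norm_eq_of_mem_sphere η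
      rw [Set.mem_ofPred_eq, norm_smul, h1, mul_one, Real.norm_of_nonneg hR.1.le, not_le]
      exact hR.2
    simp [this]
  rw [hsub]
  refine setLIntegral_mono' measurableSet_Ioi fun R hR => ?_
  have hρR : ρ < R := hR
  have hR0 : 0 < R := hρ.trans hR
  rw [← lintegral_const_mul' _ _ ENNReal.ofReal_ne_top]
  refine lintegral_mono fun η => ?_
  have hmax : 0 < max (1 - ρ / R) (dist η ξ) :=
    lt_max_of_lt_left (by rw [sub_pos, div_lt_one hR0]; exact hρR)
  -- The polar Jacobian `R^(n-1)` cancels the factor `R` of this lower bound, leaving `2^(n-1)`.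
  have h1 := max_le_norm_smul_sub ξ η hρ hρR
  calc ENNReal.ofReal (R ^ (n - 1)) * H (R • (η : EuclideanSpace ℝ (Fin n)))
      ≤ ENNReal.ofReal (R ^ (n - 1)) * (ENNReal.ofReal
          (‖R • (η : EuclideanSpace ℝ (Fin n)) - x‖ ^ (-((n : ℝ) - 1))) *
            ‖fderiv ℝ v (R • (η : EuclideanSpace ℝ (Fin n)))‖ₑ) := by
        refine mul_le_mul' le_rfl ?_
        exact Set.indicator_apply_le' (fun _ => le_rfl) fun _ => zero_le
    _ ≤ ENNReal.ofReal (R ^ (n - 1)) * (ENNReal.ofReal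
          ((R / 2 * max (1 - ρ / R) (dist η ξ)) ^ (-((n : ℝ) - 1))) *
            ‖fderiv ℝ v (R • (η : EuclideanSpace ℝ (Fin n)))‖ₑ) := by
        refine mul_le_mul' le_rfl (mul_le_mul' (ENNReal.ofReal_le_ofReal ?_) le_rfl)
        exact Real.rpow_le_rpow_of_nonpos (by positivity) h1 (by linarith)
    _ = _ := by
        rw [← mul_assoc, ← mul_assoc, ← ENNReal.ofReal_mul (by positivity),
          ← ENNReal.ofReal_mul (by positivity)]
        congr 2
        rw [Real.mul_rpow (by positivity) hmax.le, Real.div_rpow hR0.le (by norm_num),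
          ← Real.rpow_natCast, hd, Real.rpow_neg hR0.le, Real.rpow_neg (by norm_num : (0 : ℝ) ≤ 2)]
        field_simp

end Representation

/-! ### The first order inequality in the logarithmic variable. -/

section LogNorm

variable {n : ℕ} {F : Type*} [NormedAddCommGroup F]

/-- The `L^(1/i)` norm of `θ ↦ f (ρ θ)` on the unit sphere. -/
noncomputable def angNorm (i : ℝ) (f : EuclideanSpace ℝ (Fin n) → F) (ρ : ℝ) : ENNReal :=
  recipNorm i (fun θ : UnitSphere n => ‖f (ρ • (θ : EuclideanSpace ℝ (Fin n)))‖ₑ) (surfaceMeasure n)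

/-- The mixed norm in the logarithmic radial variable: the `L^(1/i)(ℝ)` norm of
`t ↦ e^{ct} ‖f (e^t ·)‖_{L^(1/j)}`. -/
noncomputable def logNorm (c i j : ℝ) (f : EuclideanSpace ℝ (Fin n) → F) : ENNReal :=
  recipNorm i (fun t : ℝ => ENNReal.ofReal (Real.exp (c * t)) * angNorm j f (Real.exp t)) volume

theorem measurable_angNorm {f : EuclideanSpace ℝ (Fin n) → F} (hf : Continuous f) (i : ℝ) :
    Measurable (angNorm i f) :=
  measurable_recipNorm (f := fun (θ : UnitSphere n) (ρ : ℝ) =>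
    ‖f (ρ • (θ : EuclideanSpace ℝ (Fin n)))‖ₑ) (by
      refine Continuous.measurable ?_
      exact continuous_enorm.comp (hf.comp (by fun_prop)))

theorem measurable_exp_mul_angNorm {f : EuclideanSpace ℝ (Fin n) → F} (hf : Continuous f)
    (c i : ℝ) :
    Measurable fun t : ℝ => ENNReal.ofReal (Real.exp (c * t)) * angNorm i f (Real.exp t) := by
  have := (measurable_angNorm hf i).comp Real.measurable_exp
  exact Measurable.mul (by fun_prop) this

theorem measurable_enorm_smul_sphere {f : EuclideanSpace ℝ (Fin n) → F} (hf : Continuous f)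
    (ρ : ℝ) :
    Measurable fun θ : UnitSphere n => ‖f (ρ • (θ : EuclideanSpace ℝ (Fin n)))‖ₑ :=
  (continuous_enorm.comp (hf.comp (by fun_prop))).measurable

theorem angNorm_le_sum {ι : Type*} (s : Finset ι) {f : EuclideanSpace ℝ (Fin n) → F}
    {G : Type*} [NormedAddCommGroup G] {g : ι → EuclideanSpace ℝ (Fin n) → G}
    (hg : ∀ k, Continuous (g k)) {i : ℝ} (hi : 0 ≤ i) (hi1 : i ≤ 1)
    (h : ∀ x, ‖f x‖ₑ ≤ ∑ k ∈ s, ‖g k x‖ₑ) (ρ : ℝ) :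
    angNorm i f ρ ≤ ∑ k ∈ s, angNorm i (g k) ρ := by
  have h1 : angNorm i f ρ ≤ recipNorm i (fun θ : UnitSphere n =>
      ∑ k ∈ s, ‖g k (ρ • (θ : EuclideanSpace ℝ (Fin n)))‖ₑ) (surfaceMeasure n) :=
    recipNorm_mono hi fun θ => h (ρ • (θ : EuclideanSpace ℝ (Fin n)))
  exact h1.trans (recipNorm_sum_le hi hi1 s fun k => measurable_enorm_smul_sphere (hg k) ρ)

theorem logNorm_le_sum {ι : Type*} (s : Finset ι) {f : EuclideanSpace ℝ (Fin n) → F}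
    {G : Type*} [NormedAddCommGroup G] {g : ι → EuclideanSpace ℝ (Fin n) → G}
    (hg : ∀ k, Continuous (g k)) {c i j : ℝ} (hi : 0 ≤ i) (hi1 : i ≤ 1) (hj : 0 ≤ j) (hj1 : j ≤ 1)
    (h : ∀ x, ‖f x‖ₑ ≤ ∑ k ∈ s, ‖g k x‖ₑ) :
    logNorm c i j f ≤ ∑ k ∈ s, logNorm c i j (g k) := by
  refine (recipNorm_mono hi fun t => ?_).trans
    (recipNorm_sum_le hi hi1 s fun k => measurable_exp_mul_angNorm (hg k) c j)
  rw [← Finset.mul_sum]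
  exact mul_le_mul' le_rfl (angNorm_le_sum s hg hj hj1 h _)

theorem lintegral_Ioi_exp (φ : ℝ → ENNReal) (t : ℝ) :
    ∫⁻ R in Set.Ioi (Real.exp t), φ R
      = ∫⁻ τ in Set.Ioi t, ENNReal.ofReal (Real.exp τ) * φ (Real.exp τ) := by
  rw [← Real.image_exp_Ioi, lintegral_image_eq_lintegral_abs_deriv_mul measurableSet_Ioi
    (fun x _ => (Real.hasDerivAt_exp x).hasDerivWithinAt) Real.exp_injective.injOn]
  simp_rw [Real.abs_exp]

variable [NormedSpace ℝ F]

/-- Minkowski's inequality moves the angular norm inside the radial integral; the sphere kernel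
estimate then applies with `ε = 1 - ρ/R`. -/
theorem angNorm_le_lintegral (hn : 1 ≤ n) {i j κ : ℝ} (hi : 0 ≤ i) (hij : i ≤ j) (hj : j ≤ 1)
    (hj0 : 0 < j) (hκ : 0 < κ) (hij1 : j - i < 1) (hκij : (n - 1) * (j - i) ≤ κ) :
    ∃ C : ℝ≥0, ∀ v : EuclideanSpace ℝ (Fin n) → F, ContDiff ℝ 1 v → HasCompactSupport v →
      ∀ ρ : ℝ, 0 < ρ → angNorm i v ρ
        ≤ C * ∫⁻ R in Set.Ioi ρ, ENNReal.ofReal ((1 - ρ / R) ^ (-κ)) * angNorm j (fderiv ℝ v) R := by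
  obtain ⟨C1, hC1⟩ := enorm_le_lintegral_polar hn (F := F)
  obtain ⟨C2, hC2⟩ := recipNorm_sphere_kernel_le hn hi hij hj hj0 hκ hij1 hκij
  refine ⟨C1 * C2, fun v hv hvc ρ hρ => ?_⟩
  have hDv : Continuous (fderiv ℝ v) := hv.continuous_fderiv one_ne_zero
  have hG : Measurable (Function.uncurry fun (ξ : UnitSphere n) (R : ℝ) => ∫⁻ η,
        ENNReal.ofReal ((max (1 - ρ / R) (dist η ξ)) ^ (-((n : ℝ) - 1))) *
          ‖fderiv ℝ v (R • (η : EuclideanSpace ℝ (Fin n)))‖ₑ ∂surfaceMeasure n) := by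
    refine Measurable.lintegral_prod_right' (f := fun z : (UnitSphere n × ℝ) × UnitSphere n =>
      ENNReal.ofReal ((max (1 - ρ / z.1.2) (dist z.2 z.1.1)) ^ (-((n : ℝ) - 1))) *
          ‖fderiv ℝ v (z.1.2 • (z.2 : EuclideanSpace ℝ (Fin n)))‖ₑ) ?_
    refine Measurable.mul (Measurable.ennreal_ofReal (Measurable.pow_const
      (Measurable.max (by fun_prop) (by fun_prop)) _)) ?_
    exact (continuous_enorm.comp (hDv.comp (by fun_prop))).measurable
  refine (recipNorm_mono hi fun ξ => hC1 v hv hvc ξ ρ hρ).trans ?_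
  rw [recipNorm_const_mul hi ENNReal.coe_ne_top, ENNReal.coe_mul, mul_assoc]
  refine mul_le_mul' le_rfl ((recipNorm_lintegral_le hi (hij.trans hj) hG).trans ?_)
  rw [← lintegral_const_mul' _ _ ENNReal.coe_ne_top]
  refine setLIntegral_mono' measurableSet_Ioi fun R hR => ?_
  have hρR : ρ < R := hR
  have hR0 : 0 < R := hρ.trans hρR
  have hq : 0 < ρ / R := by positivity
  refine (hC2 (1 - ρ / R) (by rw [sub_pos, div_lt_one hR0]; exact hρR) (by linarith) _
    (measurable_enorm_smul_sphere hDv R)).trans (le_of_eq ?_)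
  rw [mul_assoc]; rfl

/-- The first order weighted Sobolev inequality with radial-angular exponents in the range reached
by fractional integration. -/
theorem logNorm_le_fderiv (hn : 2 ≤ n) {c i j i' j' : ℝ} (hc : 0 < c) (hi : 0 ≤ i) (hij : i ≤ j)
    (hj : j ≤ 1) (hj0 : 0 < j) (hi' : 0 ≤ i') (hij' : i' ≤ j') (hj' : j' ≤ 1) (hj0' : 0 < j')
    (h : (j - i) + (n - 1) * (j' - i') < 1 ∨
      (j - i) + (n - 1) * (j' - i') = 1 ∧ j < 1 ∧ 0 < i ∧ i < j) :
    ∃ C : ℝ≥0, ∀ v : EuclideanSpace ℝ (Fin n) → F, ContDiff ℝ 1 v → HasCompactSupport v →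
      logNorm c i i' v ≤ C * logNorm (c + 1) j j' (fderiv ℝ v) := by
  have hn1 : (1 : ℝ) ≤ n - 1 := by
    have : (2 : ℝ) ≤ n := by exact_mod_cast hn
    linarith
  have hB : 0 ≤ ((n : ℝ) - 1) * (j' - i') := mul_nonneg (by linarith) (by linarith)
  have hB1 : j' - i' ≤ ((n : ℝ) - 1) * (j' - i') := le_mul_of_one_le_left (by linarith) hn1
  -- `κ` must lie between `(n-1)(j'-i')` and `1-(j-i)`. The midpoint serves when these differ, and
  -- is positive even without angular gain; in the critical case they coincide.
  obtain ⟨κ, hκ0, hκ1, hκB, hκ⟩ : ∃ κ : ℝ, 0 < κ ∧ κ < 1 ∧ (n - 1) * (j' - i') ≤ κ ∧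
      (κ < 1 - (j - i) ∨ κ = 1 - (j - i) ∧ j < 1 ∧ 0 < i ∧ i < j) := by
    rcases h with h | ⟨h, h1, h2, h3⟩
    · refine ⟨(((n : ℝ) - 1) * (j' - i') + (1 - (j - i))) / 2, by linarith, by linarith,
        by linarith, Or.inl (by linarith)⟩
    · exact ⟨1 - (j - i), by linarith, by linarith, by linarith, Or.inr ⟨rfl, h1, h2, h3⟩⟩
  obtain ⟨C1, hC1⟩ := angNorm_le_lintegral (F := F) (by omega : 1 ≤ n) hi' hij' hj' hj0' hκ0
    (by linarith) hκB
  obtain ⟨C2, hC2⟩ := recipNorm_one_sided_le hc hκ0 hi hij hj hj0 hκ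
  refine ⟨C1 * C2, fun v hv hvc => ?_⟩
  have hDv : Continuous (fderiv ℝ v) := hv.continuous_fderiv one_ne_zero
  have hVm := measurable_exp_mul_angNorm hDv (c + 1) j'
  rw [ENNReal.coe_mul, mul_assoc]
  refine le_trans ?_ (mul_le_mul' le_rfl (hC2 _ hVm))
  rw [← recipNorm_const_mul hi ENNReal.coe_ne_top]
  refine recipNorm_mono hi fun t => ?_
  refine (mul_le_mul' le_rfl (hC1 v hv hvc _ (Real.exp_pos t))).trans ?_
  rw [mul_left_comm, lintegral_Ioi_exp, ← lintegral_const_mul' _ _ ENNReal.ofReal_ne_top]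
  refine mul_le_mul' le_rfl (le_of_eq (lintegral_congr fun τ => ?_))
  have e1 : Real.exp t / Real.exp τ = Real.exp (-(τ - t)) := by
    rw [← Real.exp_sub]; congr 1; ring
  -- The Jacobian `e^τ` of `R = e^τ` accounts for the shift of the weight from `c` to `c + 1`; what
  -- remains depends only on `τ - t`.
  have e2 : Real.exp (c * t) * Real.exp τ = Real.exp (-c * (τ - t)) * Real.exp ((c + 1) * τ) := by
    rw [← Real.exp_add, ← Real.exp_add]; congr 1; ring
  rw [e1, ENNReal.ofReal_mul (by positivity), ← mul_assoc, ← ENNReal.ofReal_mul (by positivity), e2,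
    ENNReal.ofReal_mul (by positivity)]
  ring

end LogNorm

/-! ### Gnomonic charts of the sphere over the faces of the cube. -/

section Charts

variable {d : ℕ}

/-- The sign `±1`. -/
def boolSign (b : Bool) : ℝ := if b then 1 else -1

theorem boolSign_mul_self (b : Bool) : boolSign b * boolSign b = 1 := by
  cases b <;> simp [boolSign]

theorem abs_boolSign (b : Bool) : |boolSign b| = 1 := by
  cases b <;> simp [boolSign]

theorem lintegral_boolSign_mul (b : Bool) (f : ℝ → ENNReal) :
    ∫⁻ t, f (boolSign b * t) = ∫⁻ t, f t := by
  cases b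
  · simpa [boolSign] using lintegral_neg_eq_self f
  · simp [boolSign]

/-- The point with `i`-th coordinate `±1` and the other coordinates `y`. -/
noncomputable def facePoint (k : Fin (d + 1) × Bool) (y : Fin d → ℝ) :
    EuclideanSpace ℝ (Fin (d + 1)) :=
  WithLp.toLp 2 (k.1.insertNth (α := fun _ => ℝ) (boolSign k.2) y)

/-- The gnomonic chart of the sphere centered at a coordinate vector. -/
noncomputable def sphereChart (k : Fin (d + 1) × Bool) (y : Fin d → ℝ) :
    EuclideanSpace ℝ (Fin (d + 1)) :=
  ‖facePoint k y‖⁻¹ • facePoint k y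

theorem facePoint_apply_self (k : Fin (d + 1) × Bool) (y : Fin d → ℝ) :
    facePoint k y k.1 = boolSign k.2 := by simp [facePoint]

theorem facePoint_apply_succAbove (k : Fin (d + 1) × Bool) (y : Fin d → ℝ) (j : Fin d) :
    facePoint k y (k.1.succAbove j) = y j := by simp [facePoint]

theorem facePoint_ne_zero (k : Fin (d + 1) × Bool) (y : Fin d → ℝ) : facePoint k y ≠ 0 := by
  intro h
  have h1 := facePoint_apply_self k y
  have h2 := abs_boolSign k.2
  rw [h] at h1
  simp [← h1] at h2

theorem contDiff_facePoint (k : Fin (d + 1) × Bool) : ContDiff ℝ ∞ (facePoint (d := d) k) := by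
  rw [contDiff_euclidean]
  intro i
  rcases Fin.eq_self_or_eq_succAbove k.1 i with rfl | ⟨j, rfl⟩
  · simp_rw [facePoint_apply_self]; exact contDiff_const
  · simp_rw [facePoint_apply_succAbove]; fun_prop

theorem contDiff_sphereChart (k : Fin (d + 1) × Bool) : ContDiff ℝ ∞ (sphereChart (d := d) k) :=
  (((contDiff_facePoint k).norm ℝ (facePoint_ne_zero k)).inv
    fun y => norm_ne_zero_iff.2 (facePoint_ne_zero k y)).smul (contDiff_facePoint k)

/-- The part of a cone over a cube face between two parallel hyperplanes. -/
def coneSlab (k : Fin (d + 1) × Bool) (a : ℝ) : Set (EuclideanSpace ℝ (Fin (d + 1))) :=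
  {x | boolSign k.2 * x k.1 ∈ Set.Icc (1 : ℝ) 2 ∧ ∀ j : Fin d, |x (k.1.succAbove j)| ≤ a * |x k.1|}

theorem measurableSet_coneSlab (k : Fin (d + 1) × Bool) (a : ℝ) :
    MeasurableSet (coneSlab k a) := by
  refine MeasurableSet.inter ?_ ?_
  · exact (isClosed_Icc.preimage (by fun_prop :
      Continuous fun x : EuclideanSpace ℝ (Fin (d + 1)) => boolSign k.2 * x k.1)).measurableSet
  · have : {x : EuclideanSpace ℝ (Fin (d + 1)) | ∀ j : Fin d, |x (k.1.succAbove j)| ≤ a * |x k.1|}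
        = ⋂ j : Fin d, {x | |x (k.1.succAbove j)| ≤ a * |x k.1|} := by ext; simp
    exact (this ▸ isClosed_iInter fun j => isClosed_le (by fun_prop) (by fun_prop)).measurableSet

theorem smul_facePoint (k : Fin (d + 1) × Bool) (t : ℝ) (y : Fin d → ℝ) :
    t • facePoint k y
      = WithLp.toLp 2 (k.1.insertNth (α := fun _ => ℝ) (boolSign k.2 * t) (t • y)) := by
  ext i
  rcases Fin.eq_self_or_eq_succAbove k.1 i with rfl | ⟨j, rfl⟩
  · simp [facePoint, mul_comm]
  · simp [facePoint]

theorem smul_facePoint_mem_coneSlab (k : Fin (d + 1) × Bool) {a t : ℝ} (ht : 0 < t) (ha : 0 ≤ a)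
    (y : Fin d → ℝ) :
    t • facePoint k y ∈ coneSlab k a ↔ t ∈ Set.Icc (1 : ℝ) 2 ∧ y ∈ Metric.closedBall 0 a := by
  have h1 : boolSign k.2 * (t * boolSign k.2) = t := by
    rw [mul_left_comm, boolSign_mul_self, mul_one]
  simp only [coneSlab, Set.mem_ofPred_eq, PiLp.smul_apply, facePoint_apply_self,
    facePoint_apply_succAbove, smul_eq_mul, h1, abs_mul, abs_boolSign, mul_one, abs_of_pos ht]
  refine and_congr Iff.rfl ?_
  rw [mem_closedBall_zero_iff, pi_norm_le_iff_of_nonneg ha]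
  refine forall_congr' fun j => ?_
  rw [mul_comm a, mul_le_mul_iff_right₀ ht, Real.norm_eq_abs]

/-- The slice at height `t` is the face dilated by `t`, with Jacobian `t^d`, while `f(x/‖x‖)` is
independent of `t`. Chart integrals are thus compared with surface integrals through Lebesgue
measure, without the Jacobian of the chart. -/
theorem lintegral_coneSlab (k : Fin (d + 1) × Bool) {a : ℝ} (ha : 0 ≤ a)
    {f : EuclideanSpace ℝ (Fin (d + 1)) → ENNReal} (hf : Measurable f) :
    ∫⁻ x in coneSlab k a, f (‖x‖⁻¹ • x)
      = (∫⁻ t in Set.Icc (1 : ℝ) 2, ENNReal.ofReal (t ^ d)) *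
        ∫⁻ y in Metric.closedBall 0 a, f (sphereChart k y) := by
  set g : EuclideanSpace ℝ (Fin (d + 1)) → ENNReal :=
    (coneSlab k a).indicator fun x => f (‖x‖⁻¹ • x) with hg
  have hgm : Measurable g := Measurable.indicator (by fun_prop) (measurableSet_coneSlab k a)
  rw [← lintegral_indicator (measurableSet_coneSlab k a), ← hg]
  have e1 : ∫⁻ x, g x = ∫⁻ v : Fin (d + 1) → ℝ, g (WithLp.toLp 2 v) :=
    ((PiLp.volume_preserving_toLp (Fin (d + 1))).lintegral_comp hgm).symm
  have hins : Measurable fun z : ℝ × (Fin d → ℝ) =>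
      (k.1.insertNth (α := fun _ => ℝ) z.1 z.2 : Fin (d + 1) → ℝ) :=
    (MeasurableEquiv.piFinSuccAbove (fun _ : Fin (d + 1) => ℝ) k.1).symm.measurable
  have e2 : ∫⁻ v : Fin (d + 1) → ℝ, g (WithLp.toLp 2 v)
      = ∫⁻ s : ℝ, ∫⁻ z : Fin d → ℝ, g (WithLp.toLp 2 (k.1.insertNth (α := fun _ => ℝ) s z)) := by
    rw [← ((volume_preserving_piFinSuccAbove (fun _ : Fin (d + 1) => ℝ) k.1).symm _).lintegral_comp
      (f := fun v => g (WithLp.toLp 2 v)) (hgm.comp (by fun_prop)), Measure.volume_eq_prod,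
      lintegral_prod]
    · rfl
    · exact (hgm.comp ((by fun_prop : Measurable (WithLp.toLp 2)).comp hins)).aemeasurable
  rw [e1, e2, ← lintegral_boolSign_mul k.2]
  have hzero : ∀ t : ℝ, t ∉ Set.Icc (1 : ℝ) 2 → ∫⁻ z : Fin d → ℝ,
      g (WithLp.toLp 2 (k.1.insertNth (α := fun _ => ℝ) (boolSign k.2 * t) z)) = 0 := by
    intro t ht
    have : ∀ z : Fin d → ℝ,
        g (WithLp.toLp 2 (k.1.insertNth (α := fun _ => ℝ) (boolSign k.2 * t) z)) = 0 := by
      intro z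
      refine Set.indicator_of_notMem (fun h => ht ?_) _
      have := h.1
      simpa [← mul_assoc, boolSign_mul_self] using this
    simp [this]
  have hslice : ∀ t ∈ Set.Icc (1 : ℝ) 2, ∫⁻ z : Fin d → ℝ,
      g (WithLp.toLp 2 (k.1.insertNth (α := fun _ => ℝ) (boolSign k.2 * t) z))
        = ENNReal.ofReal (t ^ d) * ∫⁻ y in Metric.closedBall 0 a, f (sphereChart k y) := by
    intro t ht
    have ht0 : 0 < t := lt_of_lt_of_le one_pos ht.1
    have hm : Measurable fun z : Fin d → ℝ =>
        g (WithLp.toLp 2 (k.1.insertNth (α := fun _ => ℝ) (boolSign k.2 * t) z)) :=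
      hgm.comp ((by fun_prop : Measurable (WithLp.toLp 2)).comp
        (hins.comp (measurable_prodMk_left (x := boolSign k.2 * t))))
    have h1 := Measure.map_addHaar_smul (volume : Measure (Fin d → ℝ)) ht0.ne'
    have h2 := lintegral_map hm (measurable_const_smul t : Measurable fun y : Fin d → ℝ => t • y)
      (μ := volume)
    rw [h1, lintegral_smul_measure, Module.finrank_fin_fun, abs_of_pos (by positivity),
      smul_eq_mul] at h2
    have h3 : ∫⁻ y : Fin d → ℝ, g (WithLp.toLp 2 (k.1.insertNth (α := fun _ => ℝ)
        (boolSign k.2 * t) (t • y))) = ∫⁻ y in Metric.closedBall 0 a, f (sphereChart k y) := by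
      rw [← lintegral_indicator Metric.isClosed_closedBall.measurableSet]
      refine lintegral_congr fun y => ?_
      rw [← smul_facePoint, hg]
      have hiff := smul_facePoint_mem_coneSlab k ht0 ha y
      by_cases hy : y ∈ Metric.closedBall 0 a
      · rw [Set.indicator_of_mem (hiff.2 ⟨ht, hy⟩), Set.indicator_of_mem hy, sphereChart,
          norm_smul, Real.norm_of_nonneg ht0.le, smul_smul, mul_inv]
        congr 2
        field_simp
      · rw [Set.indicator_of_notMem (fun h => hy (hiff.1 h).2), Set.indicator_of_notMem hy]
    rw [← h3, ← h2, ← mul_assoc, ← ENNReal.ofReal_mul (by positivity),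
      mul_inv_cancel₀ (by positivity), ENNReal.ofReal_one, one_mul]
  rw [← lintegral_mul_const _ (by fun_prop), ← lintegral_indicator measurableSet_Icc]
  refine lintegral_congr fun t => ?_
  by_cases ht : t ∈ Set.Icc (1 : ℝ) 2
  · rw [Set.indicator_of_mem ht, hslice t ht]
  · rw [Set.indicator_of_notMem ht, hzero t ht]

theorem norm_le_of_mem_coneSlab {k : Fin (d + 1) × Bool} {x : EuclideanSpace ℝ (Fin (d + 1))}
    (hx : x ∈ coneSlab k 2) : ‖x‖ ≤ 4 * (d + 1) := by
  have h1 : |x k.1| ≤ 2 := by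
    have := hx.1.2
    have h2 : boolSign k.2 * x k.1 = |x k.1| := by
      rw [← abs_of_nonneg (zero_le_one.trans hx.1.1), abs_mul, abs_boolSign, one_mul]
    linarith
  have h2 : ∀ i, |x i| ≤ 4 := by
    intro i
    rcases Fin.eq_self_or_eq_succAbove k.1 i with rfl | ⟨j, rfl⟩
    · linarith
    · linarith [hx.2 j]
  rw [EuclideanSpace.norm_eq]
  refine Real.sqrt_le_iff.2 ⟨by positivity, ?_⟩
  calc ∑ i, ‖x i‖ ^ 2 ≤ ∑ _i : Fin (d + 1), (4 : ℝ) ^ 2 := by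
        gcongr with i
        exact h2 i
    _ = 4 ^ 2 * ((d : ℝ) + 1) := by simp; ring
    _ ≤ (4 * ((d : ℝ) + 1)) ^ 2 := by
        have : (0 : ℝ) ≤ d := Nat.cast_nonneg d
        nlinarith

theorem one_le_lintegral_Icc_pow : 1 ≤ ∫⁻ t in Set.Icc (1 : ℝ) 2, ENNReal.ofReal (t ^ d) := by
  calc (1 : ENNReal) = ∫⁻ _t in Set.Icc (1 : ℝ) 2, 1 := by simp; norm_num
    _ ≤ _ := by
      refine setLIntegral_mono' measurableSet_Icc fun t ht => ?_
      rw [ENNReal.one_le_ofReal]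
      exact one_le_pow₀ ht.1

/-- The slab lies in a ball of radius `R = 4(d+1)`, where polar coordinates bound the integral of a
homogeneous function by `R^d * R` times its surface integral. -/
theorem lintegral_sphereChart_le :
    ∃ C : ℝ≥0, ∀ f : EuclideanSpace ℝ (Fin (d + 1)) → ENNReal, Measurable f →
      ∀ k : Fin (d + 1) × Bool, ∫⁻ y in Metric.closedBall 0 2, f (sphereChart k y)
        ≤ C * ∫⁻ θ : UnitSphere (d + 1), f θ ∂surfaceMeasure (d + 1) := by
  set R : ℝ := 4 * (d + 1) with hR
  have hR0 : 0 < R := by positivity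
  refine ⟨Real.toNNReal (R ^ d) * Real.toNNReal R, fun f hf k => ?_⟩
  calc ∫⁻ y in Metric.closedBall 0 2, f (sphereChart k y)
      ≤ (∫⁻ t in Set.Icc (1 : ℝ) 2, ENNReal.ofReal (t ^ d)) *
        ∫⁻ y in Metric.closedBall 0 2, f (sphereChart k y) :=
        le_mul_of_one_le_left zero_le one_le_lintegral_Icc_pow
    _ = ∫⁻ x in coneSlab k 2, f (‖x‖⁻¹ • x) := (lintegral_coneSlab k (by norm_num) hf).symm
    _ ≤ ∫⁻ x in Metric.closedBall 0 R, f (‖x‖⁻¹ • x) :=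
        lintegral_mono_set fun x hx => mem_closedBall_zero_iff.2 (norm_le_of_mem_coneSlab hx)
    _ = ∫⁻ x, (Metric.closedBall 0 R).indicator (fun x => f (‖x‖⁻¹ • x)) x :=
        (lintegral_indicator Metric.isClosed_closedBall.measurableSet _).symm
    _ = ∫⁻ θ : UnitSphere (d + 1), (∫⁻ ρ in Set.Ioi (0 : ℝ), ENNReal.ofReal (ρ ^ d) *
          (Metric.closedBall 0 R).indicator (fun x => f (‖x‖⁻¹ • x))
            (ρ • (θ : EuclideanSpace ℝ (Fin (d + 1))))) ∂surfaceMeasure (d + 1) := by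
        rw [lintegral_polar (by omega) (Measurable.indicator (by fun_prop)
          Metric.isClosed_closedBall.measurableSet)]
        simp
    _ ≤ ∫⁻ θ : UnitSphere (d + 1), (ENNReal.ofReal (R ^ d) * ENNReal.ofReal R) * f θ
          ∂surfaceMeasure (d + 1) := by
        refine lintegral_mono fun θ => ?_
        have h1 : ‖(θ : EuclideanSpace ℝ (Fin (d + 1)))‖ = 1 := norm_eq_of_mem_sphere θ
        calc ∫⁻ ρ in Set.Ioi (0 : ℝ), ENNReal.ofReal (ρ ^ d) *
              (Metric.closedBall 0 R).indicator (fun x => f (‖x‖⁻¹ • x))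
                (ρ • (θ : EuclideanSpace ℝ (Fin (d + 1))))
            ≤ ∫⁻ ρ in Set.Ioi (0 : ℝ), (Set.Iic R).indicator
                (fun _ => ENNReal.ofReal (R ^ d) * f θ) ρ := by
              refine setLIntegral_mono' measurableSet_Ioi fun ρ hρ => ?_
              have hρ0 : 0 < ρ := hρ
              have hnorm : ‖ρ • (θ : EuclideanSpace ℝ (Fin (d + 1)))‖ = ρ := by
                rw [norm_smul, h1, mul_one, Real.norm_of_nonneg hρ0.le]
              by_cases h : ρ ≤ R
              · rw [Set.indicator_of_mem (by rw [mem_closedBall_zero_iff, hnorm]; exact h),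
                  Set.indicator_of_mem (by exact h), hnorm, smul_smul,
                  inv_mul_cancel₀ hρ0.ne', one_smul]
                gcongr
              · rw [Set.indicator_of_notMem (by rw [mem_closedBall_zero_iff, hnorm]; exact h),
                  mul_zero]
                exact zero_le
          _ = ENNReal.ofReal (R ^ d) * f θ * ENNReal.ofReal R := by
              rw [lintegral_indicator_const measurableSet_Iic,
                Measure.restrict_apply measurableSet_Iic, Set.Iic_inter_Ioi, Real.volume_Ioc,
                sub_zero]
          _ = _ := by ring
    _ = _ := by
        rw [lintegral_const_mul' _ _ (by finiteness), ENNReal.coe_mul]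
        rfl

/-- The coordinate of largest modulus selects the face; hence the charts on balls of radius 1
already cover the sphere. -/
theorem exists_le_abs_coord (θ : UnitSphere (d + 1)) :
    ∃ k : Fin (d + 1) × Bool, 0 < boolSign k.2 * (θ : EuclideanSpace ℝ (Fin (d + 1))) k.1 ∧
      boolSign k.2 * (θ : EuclideanSpace ℝ (Fin (d + 1))) k.1 ≤ 1 ∧
      ∀ j : Fin d, |(θ : EuclideanSpace ℝ (Fin (d + 1))) (k.1.succAbove j)|
        ≤ |(θ : EuclideanSpace ℝ (Fin (d + 1))) k.1| := by
  have h1 : ‖(θ : EuclideanSpace ℝ (Fin (d + 1)))‖ = 1 := norm_eq_of_mem_sphere θ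
  obtain ⟨i, -, hi⟩ := Finset.exists_max_image (Finset.univ : Finset (Fin (d + 1)))
    (fun i => |(θ : EuclideanSpace ℝ (Fin (d + 1))) i|) Finset.univ_nonempty
  have hne : (θ : EuclideanSpace ℝ (Fin (d + 1))) i ≠ 0 := by
    intro h0
    have : (θ : EuclideanSpace ℝ (Fin (d + 1))) = 0 := by
      ext j
      have := hi j (Finset.mem_univ j)
      rw [h0, abs_zero] at this
      exact abs_nonpos_iff.1 this
    rw [this, norm_zero] at h1
    exact zero_ne_one h1
  have hle : |(θ : EuclideanSpace ℝ (Fin (d + 1))) i| ≤ 1 := by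
    rw [← h1]; exact PiLp.norm_apply_le (θ : EuclideanSpace ℝ (Fin (d + 1))) i
  rcases lt_or_gt_of_ne hne with h | h
  · exact ⟨(i, false), by simpa [boolSign] using h, by
      rw [abs_of_neg h] at hle; simpa [boolSign] using hle, fun j => hi _ (Finset.mem_univ _)⟩
  · exact ⟨(i, true), by simpa [boolSign] using h, by
      rw [abs_of_pos h] at hle; simpa [boolSign] using hle, fun j => hi _ (Finset.mem_univ _)⟩

/-- The ray through `θ` meets the slab of its face in `[1/c, 2/c]`, with `c ≤ 1` the modulus of its
largest coordinate. This interval has length at least 1 and `ρ^d ≥ 1` on it. -/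
theorem lintegral_sphere_le_sum_chart :
    ∃ C : ℝ≥0, ∀ f : EuclideanSpace ℝ (Fin (d + 1)) → ENNReal, Measurable f →
      ∫⁻ θ : UnitSphere (d + 1), f θ ∂surfaceMeasure (d + 1)
        ≤ C * ∑ k : Fin (d + 1) × Bool, ∫⁻ y in Metric.closedBall 0 1, f (sphereChart k y) := by
  refine ⟨2 ^ d, fun f hf => ?_⟩
  set g : Fin (d + 1) × Bool → EuclideanSpace ℝ (Fin (d + 1)) → ENNReal := fun k =>
    (coneSlab k 1).indicator fun x => f (‖x‖⁻¹ • x) with hg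
  have hgm : ∀ k, Measurable (g k) := fun k =>
    Measurable.indicator (by fun_prop) (measurableSet_coneSlab k 1)
  have point : ∀ θ : UnitSphere (d + 1), f θ ≤ ∑ k, ∫⁻ ρ in Set.Ioi (0 : ℝ),
      ENNReal.ofReal (ρ ^ d) * g k (ρ • (θ : EuclideanSpace ℝ (Fin (d + 1)))) := by
    intro θ
    have h1 : ‖(θ : EuclideanSpace ℝ (Fin (d + 1)))‖ = 1 := norm_eq_of_mem_sphere θ
    obtain ⟨k, hk0, hk1, hk⟩ := exists_le_abs_coord θ
    refine le_trans ?_ (Finset.single_le_sum (fun _ _ => zero_le) (Finset.mem_univ k))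
    set c := boolSign k.2 * (θ : EuclideanSpace ℝ (Fin (d + 1))) k.1 with hc
    have h1c : 1 ≤ 1 / c := (one_le_div hk0).2 hk1
    calc f θ = ∫⁻ _ρ in Set.Icc (1 : ℝ) 2, f θ := by simp; norm_num
      _ ≤ f θ * volume (Set.Icc (1 / c) (2 / c)) := by
          rw [setLIntegral_const]
          refine mul_le_mul' le_rfl ?_
          rw [Real.volume_Icc, Real.volume_Icc]
          refine ENNReal.ofReal_le_ofReal ?_
          have : 2 / c - 1 / c = 1 / c := by ring
          linarith
      _ = ∫⁻ _ρ in Set.Icc (1 / c) (2 / c), f θ := (setLIntegral_const _ _).symm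
      _ ≤ ∫⁻ ρ in Set.Icc (1 / c) (2 / c),
            ENNReal.ofReal (ρ ^ d) * g k (ρ • (θ : EuclideanSpace ℝ (Fin (d + 1)))) := by
          refine setLIntegral_mono' measurableSet_Icc fun ρ hρ => ?_
          have hρ1 : 1 ≤ ρ := h1c.trans hρ.1
          have hρ0 : 0 < ρ := by linarith
          have hmem : ρ • (θ : EuclideanSpace ℝ (Fin (d + 1))) ∈ coneSlab k 1 := by
            refine ⟨?_, fun j => ?_⟩
            · have e : boolSign k.2 * (ρ • (θ : EuclideanSpace ℝ (Fin (d + 1)))) k.1 = ρ * c := by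
                rw [hc, PiLp.smul_apply, smul_eq_mul]; ring
              rw [e]
              exact ⟨(div_le_iff₀ hk0).1 hρ.1, (le_div_iff₀ hk0).1 hρ.2⟩
            · rw [PiLp.smul_apply, PiLp.smul_apply, smul_eq_mul, smul_eq_mul, abs_mul, abs_mul,
                one_mul]
              exact mul_le_mul_of_nonneg_left (hk j) (abs_nonneg _)
          simp only [hg]
          rw [Set.indicator_of_mem hmem, norm_smul, h1, mul_one, Real.norm_of_nonneg hρ0.le,
            smul_smul, inv_mul_cancel₀ hρ0.ne', one_smul]
          refine le_mul_of_one_le_left zero_le ?_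
          rw [ENNReal.one_le_ofReal]
          exact one_le_pow₀ hρ1
      _ ≤ _ := lintegral_mono_set fun ρ hρ =>
          lt_of_lt_of_le (by positivity : (0 : ℝ) < 1 / c) hρ.1
  calc ∫⁻ θ : UnitSphere (d + 1), f θ ∂surfaceMeasure (d + 1)
      ≤ ∫⁻ θ : UnitSphere (d + 1), ∑ k, (∫⁻ ρ in Set.Ioi (0 : ℝ), ENNReal.ofReal (ρ ^ d) *
          g k (ρ • (θ : EuclideanSpace ℝ (Fin (d + 1))))) ∂surfaceMeasure (d + 1) :=
        lintegral_mono point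
    _ = ∑ k, ∫⁻ θ : UnitSphere (d + 1), (∫⁻ ρ in Set.Ioi (0 : ℝ), ENNReal.ofReal (ρ ^ d) *
          g k (ρ • (θ : EuclideanSpace ℝ (Fin (d + 1))))) ∂surfaceMeasure (d + 1) := by
        refine lintegral_finsetSum _ fun k _ => ?_
        refine Measurable.lintegral_prod_right' (f := fun z : UnitSphere (d + 1) × ℝ =>
          ENNReal.ofReal (z.2 ^ d) * g k (z.2 • (z.1 : EuclideanSpace ℝ (Fin (d + 1))))) ?_
        exact Measurable.mul (by fun_prop) ((hgm k).comp (by fun_prop))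
    _ = ∑ k, ∫⁻ x, g k x := by
        refine Finset.sum_congr rfl fun k _ => ?_
        rw [lintegral_polar (by omega) (hgm k)]
        simp
    _ = ∑ k, (∫⁻ t in Set.Icc (1 : ℝ) 2, ENNReal.ofReal (t ^ d)) *
          ∫⁻ y in Metric.closedBall 0 1, f (sphereChart k y) := by
        refine Finset.sum_congr rfl fun k _ => ?_
        rw [← lintegral_coneSlab k zero_le_one hf, lintegral_indicator (measurableSet_coneSlab k 1)]
    _ ≤ _ := by
        rw [← Finset.mul_sum]
        refine mul_le_mul' ?_ le_rfl
        calc ∫⁻ t in Set.Icc (1 : ℝ) 2, ENNReal.ofReal (t ^ d)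
            ≤ ∫⁻ _t in Set.Icc (1 : ℝ) 2, 2 ^ d := by
              refine setLIntegral_mono' measurableSet_Icc fun t ht => ?_
              rw [ENNReal.ofReal_pow (zero_le_one.trans ht.1)]
              gcongr
              rw [← ENNReal.ofReal_ofNat]
              exact ENNReal.ofReal_le_ofReal ht.2
          _ = _ := by simp; norm_num

end Charts

/-! ### Sobolev inequalities on the sphere. -/

section SphereSobolev

theorem recipNorm_restrict_le {X : Type*} [MeasurableSpace X] {μ : Measure X} {i : ℝ} (hi : 0 ≤ i)
    (s : Set X) (f : X → ENNReal) : recipNorm i f (μ.restrict s) ≤ recipNorm i f μ := by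
  rcases hi.eq_or_lt with rfl | hi
  · rw [recipNorm_zero, recipNorm_zero]
    exact essSup_mono_measure' Measure.restrict_le_self
  · rw [recipNorm_of_ne_zero hi.ne', recipNorm_of_ne_zero hi.ne']
    exact ENNReal.rpow_le_rpow (setLIntegral_le_lintegral _ _) hi.le

theorem recipNorm_indicator {X : Type*} [MeasurableSpace X] {μ : Measure X} {i : ℝ} (hi : 0 < i)
    {s : Set X} (hs : MeasurableSet s) (f : X → ENNReal) :
    recipNorm i (s.indicator f) μ = recipNorm i f (μ.restrict s) := by
  rw [recipNorm_of_ne_zero hi.ne', recipNorm_of_ne_zero hi.ne', ← lintegral_indicator hs]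
  congr 2
  ext x
  by_cases hx : x ∈ s
  · rw [Set.indicator_of_mem hx, Set.indicator_of_mem hx]
  · rw [Set.indicator_of_notMem hx, Set.indicator_of_notMem hx,
      ENNReal.zero_rpow_of_pos (by positivity)]

variable {d : ℕ}

/-- The ball has twice the radius of the one in `recipNorm_sphere_le_of_chart`, which leaves room
for the cutoff. -/
theorem recipNorm_sphereChart_le {j : ℝ} (hj : 0 < j) :
    ∃ C : ℝ≥0, ∀ g : EuclideanSpace ℝ (Fin (d + 1)) → ENNReal, Measurable g →
      ∀ k : Fin (d + 1) × Bool,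
        recipNorm j (fun y => g (sphereChart k y)) (volume.restrict (Metric.closedBall 0 2))
          ≤ C * recipNorm j (fun θ : UnitSphere (d + 1) => g θ) (surfaceMeasure (d + 1)) := by
  obtain ⟨C, hC⟩ := lintegral_sphereChart_le (d := d)
  refine ⟨C ^ j, fun g hg k => ?_⟩
  rw [recipNorm_of_ne_zero hj.ne', recipNorm_of_ne_zero hj.ne', ENNReal.coe_rpow_of_nonneg _ hj.le,
    ← ENNReal.mul_rpow_of_nonneg _ _ hj.le]
  exact ENNReal.rpow_le_rpow (hC (fun x => g x ^ (1 / j)) (hg.pow_const _) k) hj.le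

theorem recipNorm_sphere_le_of_chart {i : ℝ} (hi : 0 ≤ i) :
    ∃ C : ℝ≥0, ∀ g : EuclideanSpace ℝ (Fin (d + 1)) → ENNReal, Measurable g → ∀ K : ENNReal,
      (∀ k : Fin (d + 1) × Bool,
        recipNorm i (fun y => g (sphereChart k y)) (volume.restrict (Metric.closedBall 0 1)) ≤ K) →
      recipNorm i (fun θ : UnitSphere (d + 1) => g θ) (surfaceMeasure (d + 1)) ≤ C * K := by
  obtain ⟨C, hC⟩ := lintegral_sphere_le_sum_chart (d := d)
  have hchart : ∀ k : Fin (d + 1) × Bool, Measurable (sphereChart (d := d) k) := fun k =>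
    (contDiff_sphereChart k).continuous.measurable
  rcases hi.eq_or_lt with rfl | hi
  · refine ⟨1, fun g hg K hK => ?_⟩
    rw [ENNReal.coe_one, one_mul, recipNorm_zero]
    refine essSup_le_of_ae_le _ ?_
    -- The supremum bound is reduced to the integral comparison by testing the indicator of `{K <
    -- g}`, which vanishes almost everywhere in each chart.
    set f : EuclideanSpace ℝ (Fin (d + 1)) → ENNReal := {x | K < g x}.indicator fun _ => 1 with hf
    have hms : MeasurableSet {x | K < g x} := measurableSet_lt measurable_const hg
    have hfm : Measurable f := Measurable.indicator measurable_const hms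
    have h0 : ∀ k : Fin (d + 1) × Bool,
        ∫⁻ y in Metric.closedBall 0 1, f (sphereChart k y) = 0 := by
      intro k
      rw [lintegral_eq_zero_iff (f := fun y => f (sphereChart k y)) (hfm.comp (hchart k))]
      have h1 := ENNReal.ae_le_essSup (μ := volume.restrict (Metric.closedBall 0 1))
        (fun y => g (sphereChart k y))
      filter_upwards [h1] with y hy
      have h2 := hK k
      rw [recipNorm_zero] at h2
      exact Set.indicator_of_notMem (s := {x | K < g x}) (f := fun _ => (1 : ENNReal))
        (not_lt.2 (hy.trans h2))
    have h1 := hC f hfm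
    simp only [h0, Finset.sum_const_zero, mul_zero, nonpos_iff_eq_zero] at h1
    rw [lintegral_eq_zero_iff (f := fun θ : UnitSphere (d + 1) => f θ)
      (hfm.comp measurable_subtype_coe)] at h1
    filter_upwards [h1] with θ hθ
    by_contra hcon
    have hmem : (θ : EuclideanSpace ℝ (Fin (d + 1))) ∈ {x | K < g x} := not_le.1 hcon
    simp only [hf, Set.indicator_of_mem hmem, Pi.zero_apply] at hθ
    exact one_ne_zero hθ
  · refine ⟨(C * Fintype.card (Fin (d + 1) × Bool)) ^ i, fun g hg K hK => ?_⟩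
    rw [recipNorm_of_ne_zero hi.ne', ENNReal.coe_rpow_of_nonneg _ hi.le]
    have hKi : K = (K ^ (1 / i)) ^ i := by
      rw [← ENNReal.rpow_mul, one_div_mul_cancel hi.ne', ENNReal.rpow_one]
    rw [hKi, ← ENNReal.mul_rpow_of_nonneg _ _ hi.le]
    refine ENNReal.rpow_le_rpow ((hC (fun x => g x ^ (1 / i)) (hg.pow_const _)).trans ?_) hi.le
    rw [ENNReal.coe_mul, mul_assoc]
    refine mul_le_mul' le_rfl ?_
    calc ∑ k : Fin (d + 1) × Bool, ∫⁻ y in Metric.closedBall 0 1, g (sphereChart k y) ^ (1 / i)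
        ≤ ∑ _k : Fin (d + 1) × Bool, K ^ (1 / i) := by
          refine Finset.sum_le_sum fun k _ => ?_
          rw [← recipNorm_rpow hi.ne']
          exact ENNReal.rpow_le_rpow (hK k) (by positivity)
      _ = _ := by rw [Finset.sum_const, nsmul_eq_mul, Finset.card_univ]; simp

variable {F : Type*} [NormedAddCommGroup F] [NormedSpace ℝ F]

/-- The cut-off function in the chart domain. -/
noncomputable def chartCutoff (d : ℕ) : ContDiffBump (0 : Fin d → ℝ) where
  rIn := 1
  rOut := 2
  rIn_pos := one_pos
  rIn_lt_rOut := one_lt_two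

/-- Product and chain rule, with the derivatives of chart and cutoff bounded on the compact ball of
radius 2, outside which the localized function vanishes. -/
theorem exists_enorm_fderiv_chart_le (k : Fin (d + 1) × Bool) :
    ∃ K : ℝ≥0, ∀ w : EuclideanSpace ℝ (Fin (d + 1)) → F, ContDiff ℝ 1 w → ∀ y : Fin d → ℝ,
      ‖fderiv ℝ (fun y => chartCutoff d y • w (sphereChart k y)) y‖ₑ
        ≤ K * (Metric.closedBall 0 2).indicator
          (fun y => ‖w (sphereChart k y)‖ₑ + ‖fderiv ℝ w (sphereChart k y)‖ₑ) y := by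
  have hφ : ContDiff ℝ 1 (sphereChart (d := d) k) := (contDiff_sphereChart k).of_le (by simp)
  have hχ : ContDiff ℝ 1 (chartCutoff d : (Fin d → ℝ) → ℝ) := (chartCutoff d).contDiff
  obtain ⟨K1, hK1⟩ := (isCompact_closedBall (0 : Fin d → ℝ) 2).exists_bound_of_continuousOn
    (hφ.continuous_fderiv one_ne_zero).continuousOn
  obtain ⟨K2, hK2⟩ := (isCompact_closedBall (0 : Fin d → ℝ) 2).exists_bound_of_continuousOn
    (hχ.continuous_fderiv one_ne_zero).continuousOn
  refine ⟨Real.toNNReal K1 + Real.toNNReal K2, fun w hw y => ?_⟩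
  by_cases hy : y ∈ Metric.closedBall 0 2
  · rw [Set.indicator_of_mem hy]
    have h1 : HasFDerivAt (fun y => w (sphereChart k y))
        ((fderiv ℝ w (sphereChart k y)).comp (fderiv ℝ (sphereChart k) y)) y :=
      (hw.differentiable one_ne_zero _).hasFDerivAt.comp y
        (hφ.differentiable one_ne_zero _).hasFDerivAt
    have h2 : HasFDerivAt (chartCutoff d : (Fin d → ℝ) → ℝ) (fderiv ℝ (chartCutoff d) y) y :=
      (hχ.differentiable one_ne_zero _).hasFDerivAt
    have h3 := (h2.smul h1).fderiv
    have h4 : fderiv ℝ (fun y => chartCutoff d y • w (sphereChart k y)) y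
        = chartCutoff d y • (fderiv ℝ w (sphereChart k y)).comp (fderiv ℝ (sphereChart k) y)
          + (fderiv ℝ (chartCutoff d) y).smulRight (w (sphereChart k y)) := h3
    rw [h4]
    have hb1 : ‖fderiv ℝ (sphereChart k) y‖ₑ ≤ Real.toNNReal K1 := by
      rw [← ofReal_norm]; exact ENNReal.ofReal_le_ofReal (hK1 y hy)
    have hb2 : ‖fderiv ℝ (chartCutoff d) y‖ₑ ≤ Real.toNNReal K2 := by
      rw [← ofReal_norm]; exact ENNReal.ofReal_le_ofReal (hK2 y hy)
    have hb3 : ‖chartCutoff d y‖ₑ ≤ 1 := by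
      rw [Real.enorm_of_nonneg (chartCutoff d).nonneg, ENNReal.ofReal_le_one]
      exact (chartCutoff d).le_one
    have hc1 : ‖chartCutoff d y • (fderiv ℝ w (sphereChart k y)).comp
        (fderiv ℝ (sphereChart k) y)‖ₑ ≤ Real.toNNReal K1 * ‖fderiv ℝ w (sphereChart k y)‖ₑ := by
      rw [enorm_smul]
      calc _ ≤ 1 * (‖fderiv ℝ w (sphereChart k y)‖ₑ * ‖fderiv ℝ (sphereChart k) y‖ₑ) :=
            mul_le_mul' hb3 (ContinuousLinearMap.opENorm_comp_le _ _)
        _ ≤ _ := by rw [one_mul, mul_comm]; gcongr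
    have hc2 : ‖(fderiv ℝ (chartCutoff d) y).smulRight (w (sphereChart k y))‖ₑ
        ≤ Real.toNNReal K2 * ‖w (sphereChart k y)‖ₑ := by
      rw [← ofReal_norm, ContinuousLinearMap.norm_smulRight_apply,
        ENNReal.ofReal_mul (norm_nonneg _), ofReal_norm, ofReal_norm]
      gcongr
    rw [← ofReal_norm] at hc1 hc2 ⊢
    refine (ENNReal.ofReal_le_ofReal (norm_add_le _ _)).trans ?_
    rw [ENNReal.ofReal_add (norm_nonneg _) (norm_nonneg _)]
    refine (add_le_add hc1 hc2).trans ?_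
    rw [ENNReal.coe_add, add_mul, mul_add, mul_add]
    calc _ ≤ (Real.toNNReal K1 * ‖fderiv ℝ w (sphereChart k y)‖ₑ
          + Real.toNNReal K2 * ‖w (sphereChart k y)‖ₑ)
          + (Real.toNNReal K1 * ‖w (sphereChart k y)‖ₑ
          + Real.toNNReal K2 * ‖fderiv ℝ w (sphereChart k y)‖ₑ) := le_self_add
      _ = _ := by ring
  · rw [Set.indicator_of_notMem hy, mul_zero, nonpos_iff_eq_zero]
    have hts : y ∉ tsupport (fun y => chartCutoff d y • w (sphereChart k y)) := by
      intro h
      refine hy ?_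
      have h1 := tsupport_smul_subset_left (chartCutoff d : (Fin d → ℝ) → ℝ)
        (fun y => w (sphereChart k y)) h
      rwa [(chartCutoff d).tsupport_eq] at h1
    rw [image_eq_zero_of_notMem_tsupport (fun h => hts (tsupport_fderiv_subset ℝ h)),
      ← ofReal_norm, norm_zero, ENNReal.ofReal_zero]

/-- A Sobolev inequality on `ℝ^d` for compactly supported functions carries over to the sphere. -/
theorem recipNorm_sphere_le_of_euclidean {i j : ℝ} (hi : 0 ≤ i) (hj : 0 < j)
    (h : ∃ A : ℝ≥0, ∀ f : (Fin d → ℝ) → F, ContDiff ℝ 1 f → HasCompactSupport f →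
      recipNorm i (fun y => ‖f y‖ₑ) volume ≤ A * recipNorm j (fun y => ‖fderiv ℝ f y‖ₑ) volume) :
    ∃ C : ℝ≥0, ∀ w : EuclideanSpace ℝ (Fin (d + 1)) → F, ContDiff ℝ 1 w →
      recipNorm i (fun θ : UnitSphere (d + 1) => ‖w θ‖ₑ) (surfaceMeasure (d + 1))
        ≤ C * recipNorm j (fun θ : UnitSphere (d + 1) => ‖w θ‖ₑ + ‖fderiv ℝ w θ‖ₑ)
          (surfaceMeasure (d + 1)) := by
  obtain ⟨A, hA⟩ := h
  obtain ⟨C1, hC1⟩ := recipNorm_sphere_le_of_chart (d := d) hi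
  obtain ⟨C2, hC2⟩ := recipNorm_sphereChart_le (d := d) hj
  choose K hK using exists_enorm_fderiv_chart_le (d := d) (F := F)
  refine ⟨C1 * (A * (∑ k, K k) * C2), fun w hw => ?_⟩
  have hDw : Continuous (fderiv ℝ w) := hw.continuous_fderiv one_ne_zero
  have hwc := hw.continuous
  rw [ENNReal.coe_mul, mul_assoc]
  refine hC1 (fun x => ‖w x‖ₑ) hwc.enorm.measurable _ fun k => ?_
  have hφ : ContDiff ℝ 1 (sphereChart (d := d) k) := (contDiff_sphereChart k).of_le (by simp)
  have hχ : ContDiff ℝ 1 (chartCutoff d : (Fin d → ℝ) → ℝ) := (chartCutoff d).contDiff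
  set f : (Fin d → ℝ) → F := fun y => chartCutoff d y • w (sphereChart k y) with hf
  have hfc : ContDiff ℝ 1 f := hχ.smul (hw.comp hφ)
  have hfs : HasCompactSupport f := (chartCutoff d).hasCompactSupport.smul_right
  have hg : Measurable fun x => ‖w x‖ₑ + ‖fderiv ℝ w x‖ₑ := 
    (continuous_enorm.comp hwc).measurable.add (continuous_enorm.comp hDw).measurable
  calc recipNorm i (fun y => ‖w (sphereChart k y)‖ₑ) (volume.restrict (Metric.closedBall 0 1))
      = recipNorm i (fun y => ‖f y‖ₑ) (volume.restrict (Metric.closedBall 0 1)) := by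
        refine le_antisymm (recipNorm_mono_ae hi ?_) (recipNorm_mono_ae hi ?_)
        all_goals
          filter_upwards [ae_restrict_mem Metric.isClosed_closedBall.measurableSet] with y hy
          rw [hf]
          simp only [(chartCutoff d).one_of_mem_closedBall hy, one_smul, le_refl]
    _ ≤ recipNorm i (fun y => ‖f y‖ₑ) volume := recipNorm_restrict_le hi _ _
    _ ≤ A * recipNorm j (fun y => ‖fderiv ℝ f y‖ₑ) volume := hA f hfc hfs
    _ ≤ A * (K k * (C2 * recipNorm j (fun θ : UnitSphere (d + 1) => ‖w θ‖ₑ + ‖fderiv ℝ w θ‖ₑ)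
          (surfaceMeasure (d + 1)))) := by
        refine mul_le_mul' le_rfl ((recipNorm_mono hj.le (hK k w hw)).trans ?_)
        rw [recipNorm_const_mul hj.le ENNReal.coe_ne_top,
          recipNorm_indicator hj Metric.isClosed_closedBall.measurableSet]
        exact mul_le_mul' le_rfl (hC2 _ hg k)
    _ ≤ A * ((∑ k, K k : ℝ≥0) * (C2 * recipNorm j
          (fun θ : UnitSphere (d + 1) => ‖w θ‖ₑ + ‖fderiv ℝ w θ‖ₑ) (surfaceMeasure (d + 1)))) := by
        gcongr
        exact Finset.single_le_sum (f := K) (fun _ _ => zero_le) (Finset.mem_univ k)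
    _ = _ := by push_cast; ring

/-- The Gagliardo–Nirenberg–Sobolev inequality on the unit sphere of `ℝ^(d+1)`. -/
theorem recipNorm_sphere_le_fderiv [FiniteDimensional ℝ F] (hd : 1 ≤ d) {i j : ℝ} (hi : 0 < i)
    (hj1 : j ≤ 1) (hij : i = j - 1 / d) :
    ∃ C : ℝ≥0, ∀ w : EuclideanSpace ℝ (Fin (d + 1)) → F, ContDiff ℝ 1 w →
      recipNorm i (fun θ : UnitSphere (d + 1) => ‖w θ‖ₑ) (surfaceMeasure (d + 1))
        ≤ C * recipNorm j (fun θ : UnitSphere (d + 1) => ‖w θ‖ₑ + ‖fderiv ℝ w θ‖ₑ)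
          (surfaceMeasure (d + 1)) := by
  have hd0 : (0 : ℝ) < d := by exact_mod_cast hd
  have hj : 0 < j := by
    have : 0 < 1 / (d : ℝ) := by positivity
    linarith
  refine recipNorm_sphere_le_of_euclidean hi.le hj ?_
  set p : ℝ≥0 := Real.toNNReal (1 / j) with hp
  set q : ℝ≥0 := Real.toNNReal (1 / i) with hq
  have hpc : (p : ℝ) = 1 / j := Real.coe_toNNReal _ (by positivity)
  have hqc : (q : ℝ) = 1 / i := Real.coe_toNNReal _ (by positivity)
  have hp1 : 1 ≤ p := by
    rw [← NNReal.coe_le_coe, hpc, NNReal.coe_one, one_le_div hj]; exact hj1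
  have hq0 : q ≠ 0 := by
    rw [← NNReal.coe_ne_zero, hqc]; positivity
  refine ⟨SNormLESNormFDerivOfEqConst F (volume : Measure (Fin d → ℝ)) (1 / j), fun f hf hfc => ?_⟩
  have := eLpNorm_le_eLpNorm_fderiv_of_eq (F := F) (volume : Measure (Fin d → ℝ)) hf hfc hp1
    (p' := q) (by rw [Module.finrank_fin_fun]; exact hd)
    (by rw [NNReal.coe_inv, hpc, hqc, Module.finrank_fin_fun, one_div, inv_inv, one_div, inv_inv, hij, one_div])
  rw [eLpNorm_nnreal_eq_lintegral hq0, eLpNorm_nnreal_eq_lintegral (by positivity), hpc, hqc,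
    one_div_one_div, one_div_one_div] at this
  rwa [recipNorm_of_ne_zero hi.ne', recipNorm_of_ne_zero hj.ne']

/-- On the circle functions are bounded by the integral of the function and its derivative. -/
theorem recipNorm_circle_le_fderiv :
    ∃ C : ℝ≥0, ∀ w : EuclideanSpace ℝ (Fin (1 + 1)) → F, ContDiff ℝ 1 w →
      recipNorm 0 (fun θ : UnitSphere (1 + 1) => ‖w θ‖ₑ) (surfaceMeasure (1 + 1))
        ≤ C * recipNorm 1 (fun θ : UnitSphere (1 + 1) => ‖w θ‖ₑ + ‖fderiv ℝ w θ‖ₑ)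
          (surfaceMeasure (1 + 1)) := by
  refine recipNorm_sphere_le_of_euclidean le_rfl one_pos ⟨1, fun f hf hfc => ?_⟩
  rw [ENNReal.coe_one, one_mul, recipNorm_zero, recipNorm_one]
  refine essSup_le_of_ae_le _ (Filter.Eventually.of_forall fun y => ?_)
  set η : Fin 1 → ℝ := fun _ => 1 with hη
  have hnorm : ‖η‖ = 1 := by simp [hη]
  refine (enorm_le_lintegral_ray hf hfc y η hnorm).trans ((setLIntegral_le_lintegral _ _).trans ?_)
  have hDf : Continuous (fderiv ℝ f) := hf.continuous_fderiv one_ne_zero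
  have h1 : ∫⁻ x : Fin 1 → ℝ, ‖fderiv ℝ f x‖ₑ = ∫⁻ x : Fin 1 → ℝ, ‖fderiv ℝ f (y + x)‖ₑ :=
    (lintegral_add_left_eq_self (fun x => ‖fderiv ℝ f x‖ₑ) y).symm
  have h2 := (volume_preserving_funUnique (Fin 1) ℝ).symm.lintegral_comp
    (f := fun x : Fin 1 → ℝ => ‖fderiv ℝ f (y + x)‖ₑ) (by fun_prop)
  have h3 : ∫⁻ x : Fin 1 → ℝ, ‖fderiv ℝ f x‖ₑ
      = ∫⁻ t : ℝ, ‖fderiv ℝ f (y + (MeasurableEquiv.funUnique (Fin 1) ℝ).symm t)‖ₑ := by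
    rw [h1]; convert h2.symm
  refine le_of_eq (Eq.trans (lintegral_congr fun t => ?_) h3.symm)
  congr 4
  ext l
  simp [hη, MeasurableEquiv.funUnique]

end SphereSobolev

/-! ### The critical multiplicative inequality on the sphere. -/

section CriticalSphere

variable {d : ℕ}

theorem recipNorm_rpow_fun {X : Type*} [MeasurableSpace X] {μ : Measure X} {e k : ℝ} (he : 0 < e)
    (hk : 0 < k) (f : X → ENNReal) :
    recipNorm e (fun x => f x ^ k) μ = recipNorm (e / k) f μ ^ k := by
  rw [recipNorm_of_ne_zero he.ne', recipNorm_of_ne_zero (by positivity), ← ENNReal.rpow_mul,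
    div_mul_cancel₀ _ hk.ne']
  congr 1
  refine lintegral_congr fun x => ?_
  rw [← ENNReal.rpow_mul, one_div_div, mul_one_div]

theorem enorm_rpow_eq {x k : ℝ} (hx : 0 ≤ x) (hk : 0 ≤ k) : ‖x ^ k‖ₑ = ‖x‖ₑ ^ k := by
  rw [Real.enorm_of_nonneg (by positivity), Real.enorm_of_nonneg hx,
    ENNReal.ofReal_rpow_of_nonneg hx hk]

theorem lintegral_mul_le_recipNorm {X : Type*} [MeasurableSpace X] {μ : Measure X} {e : ℝ}
    (he : 0 < e) (he1 : e < 1) {f g : X → ENNReal} (hf : Measurable f) (hg : Measurable g) :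
    ∫⁻ x, f x * g x ∂μ ≤ recipNorm e f μ * recipNorm (1 - e) g μ := by
  have hpq : (1 / e).HolderConjugate (1 / (1 - e)) := by
    rw [Real.holderConjugate_iff]
    exact ⟨by rw [lt_div_iff₀ he]; linarith, by simp⟩
  have := ENNReal.lintegral_mul_le_Lp_mul_Lq μ hpq hf.aemeasurable hg.aemeasurable
  rwa [one_div_one_div, one_div_one_div, ← recipNorm_of_ne_zero he.ne',
    ← recipNorm_of_ne_zero (by linarith)] at this

/-- The Sobolev inequality on the sphere applied to a power of the modulus. -/
theorem recipNorm_sphere_rpow_le (hd : 2 ≤ d) {k : ℝ} (hk : 1 < k) :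
    ∃ C : ℝ≥0, ∀ w : EuclideanSpace ℝ (Fin (d + 1)) → ℂ, ContDiff ℝ 1 w →
      recipNorm (1 - 1 / (d : ℝ)) (fun θ : UnitSphere (d + 1) => ‖w θ‖ₑ ^ k) (surfaceMeasure (d + 1))
        ≤ C * recipNorm (1 / (d : ℝ)) (fun θ : UnitSphere (d + 1) => ‖w θ‖ₑ + ‖fderiv ℝ w θ‖ₑ)
            (surfaceMeasure (d + 1))
          * recipNorm (1 - 1 / (d : ℝ)) (fun θ : UnitSphere (d + 1) => ‖w θ‖ₑ ^ (k - 1))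
            (surfaceMeasure (d + 1)) := by
  have hd2 : (2 : ℝ) ≤ d := by exact_mod_cast hd
  have hd0 : (0 : ℝ) < d := by linarith
  have he : 0 < 1 - 1 / (d : ℝ) := by
    rw [sub_pos, div_lt_one hd0]; linarith
  have he1 : 1 - 1 / (d : ℝ) < 1 := by
    have : 0 < 1 / (d : ℝ) := by positivity
    linarith
  -- The Sobolev inequality from `L^1` to `L^(d/(d-1))`, to be applied to `‖w‖^k`, which is `C^1`
  -- because `k > 1`.
  obtain ⟨C, hC⟩ := recipNorm_sphere_le_fderiv (F := ℝ) (by omega : 1 ≤ d) he le_rfl rfl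
  refine ⟨C * Real.toNNReal k, fun w hw => ?_⟩
  have hwm : Measurable fun θ : UnitSphere (d + 1) => ‖w θ‖ₑ :=
    (continuous_enorm.comp (hw.continuous.comp continuous_subtype_val)).measurable
  have hDm : Measurable fun θ : UnitSphere (d + 1) => ‖fderiv ℝ w θ‖ₑ :=
    (continuous_enorm.comp
      ((hw.continuous_fderiv one_ne_zero).comp continuous_subtype_val)).measurable
  have hpt : ∀ x, ‖(‖w x‖ ^ k)‖ₑ + ‖fderiv ℝ (fun x => ‖w x‖ ^ k) x‖ₑ
      ≤ Real.toNNReal k * (‖w x‖ₑ ^ (k - 1) * (‖w x‖ₑ + ‖fderiv ℝ w x‖ₑ)) := by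
    intro x
    have h1 : ‖fderiv ℝ (fun x => ‖w x‖ ^ k) x‖ₑ
        ≤ Real.toNNReal k * (‖w x‖ₑ ^ (k - 1) * ‖fderiv ℝ w x‖ₑ) := by
      rw [← ofReal_norm, ← ofReal_norm (fderiv ℝ w x), ← ofReal_norm (w x),
        ENNReal.ofReal_rpow_of_nonneg (norm_nonneg _) (by linarith),
        ← ENNReal.ofReal_mul (by positivity)]
      change _ ≤ ENNReal.ofReal k * _
      rw [← ENNReal.ofReal_mul (by linarith), ← mul_assoc]
      exact ENNReal.ofReal_le_ofReal
        (norm_fderiv_norm_rpow_le (hw.differentiable one_ne_zero) hk)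
    have h2 : ‖(‖w x‖ ^ k)‖ₑ ≤ Real.toNNReal k * (‖w x‖ₑ ^ (k - 1) * ‖w x‖ₑ) := by
      rw [enorm_rpow_eq (norm_nonneg _) (by linarith), enorm_norm]
      have h3 : ‖w x‖ₑ ^ (k - 1) * ‖w x‖ₑ = ‖w x‖ₑ ^ k := by
        conv_lhs => rw [← ENNReal.rpow_one ‖w x‖ₑ, ← ENNReal.rpow_mul, one_mul]
        rw [← ENNReal.rpow_add_of_nonneg _ _ (by linarith) zero_le_one]
        congr 1; ring
      rw [h3]
      refine le_mul_of_one_le_left' ?_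
      exact_mod_cast Real.one_le_toNNReal.2 hk.le
    calc _ ≤ _ := add_le_add h2 h1
      _ = _ := by ring
  have hmain := hC (fun x => ‖w x‖ ^ k) (hw.norm_rpow hk)
  have e1 : (fun θ : UnitSphere (d + 1) => ‖w θ‖ₑ ^ k)
      = fun θ : UnitSphere (d + 1) => ‖(‖w θ‖ ^ k)‖ₑ := by
    ext θ; rw [enorm_rpow_eq (norm_nonneg _) (by linarith), enorm_norm]
  rw [e1]
  refine hmain.trans ?_
  rw [recipNorm_one, ENNReal.coe_mul, mul_assoc, mul_assoc]
  refine mul_le_mul' le_rfl ((lintegral_mono fun θ : UnitSphere (d + 1) => hpt θ).trans ?_)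
  rw [lintegral_const_mul' _ _ ENNReal.coe_ne_top]
  refine mul_le_mul' le_rfl ?_
  -- The Hölder partner of `L^d` is again `L^(d/(d-1))`, the space on the left-hand side; therefore
  -- the estimate can be iterated.
  have := lintegral_mul_le_recipNorm (μ := surfaceMeasure (d + 1)) he he1
    (hwm.pow_const (k - 1)) (hwm.add hDm)
  rw [sub_sub_cancel] at this
  rw [mul_comm]
  exact this

/-- Each application of `recipNorm_sphere_rpow_le` lowers the power of the modulus by one at the
price of one gradient factor. -/
theorem recipNorm_sphere_rpow_add_le (hd : 2 ≤ d) {κ : ℝ} (hκ : 0 < κ) (m : ℕ) :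
    ∃ C : ℝ≥0, ∀ w : EuclideanSpace ℝ (Fin (d + 1)) → ℂ, ContDiff ℝ 1 w →
      recipNorm (1 - 1 / (d : ℝ)) (fun θ : UnitSphere (d + 1) => ‖w θ‖ₑ ^ (κ + m))
          (surfaceMeasure (d + 1))
        ≤ C * recipNorm (1 / (d : ℝ)) (fun θ : UnitSphere (d + 1) => ‖w θ‖ₑ + ‖fderiv ℝ w θ‖ₑ)
            (surfaceMeasure (d + 1)) ^ m
          * recipNorm (1 - 1 / (d : ℝ)) (fun θ : UnitSphere (d + 1) => ‖w θ‖ₑ ^ κ)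
            (surfaceMeasure (d + 1)) := by
  induction m with
  | zero => exact ⟨1, fun w _ => by simp⟩
  | succ m ih =>
    obtain ⟨C, hC⟩ := ih
    obtain ⟨C', hC'⟩ := recipNorm_sphere_rpow_le hd (k := κ + (m + 1 : ℕ))
      (by push_cast; have : (0 : ℝ) ≤ m := by positivity
          linarith)
    refine ⟨C' * C, fun w hw => (hC' w hw).trans ?_⟩
    have e : κ + ((m + 1 : ℕ) : ℝ) - 1 = κ + m := by push_cast; ring
    rw [e]
    refine (mul_le_mul' le_rfl (hC w hw)).trans (le_of_eq ?_)
    rw [ENNReal.coe_mul]; ring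

/-- The Gagliardo–Nirenberg inequality on the sphere at the critical exponent, which does not reach
`L^∞`. -/
theorem recipNorm_sphere_le_critical (hd : 1 ≤ d) {a l : ℝ} (ha : 0 < a) (ha1 : a < 1)
    (hl : 0 < l) :
    ∃ C : ℝ≥0, ∀ w : EuclideanSpace ℝ (Fin (d + 1)) → ℂ, ContDiff ℝ 1 w →
      recipNorm ((1 - a) * l) (fun θ : UnitSphere (d + 1) => ‖w θ‖ₑ) (surfaceMeasure (d + 1))
        ≤ C * recipNorm (1 / (d : ℝ)) (fun θ : UnitSphere (d + 1) => ‖w θ‖ₑ + ‖fderiv ℝ w θ‖ₑ)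
            (surfaceMeasure (d + 1)) ^ a
          * recipNorm l (fun θ : UnitSphere (d + 1) => ‖w θ‖ₑ) (surfaceMeasure (d + 1))
            ^ (1 - a) := by
  have hm : ∀ w : EuclideanSpace ℝ (Fin (d + 1)) → ℂ, ContDiff ℝ 1 w →
      Measurable fun θ : UnitSphere (d + 1) => ‖w θ‖ₑ := fun w hw =>
    (continuous_enorm.comp (hw.continuous.comp continuous_subtype_val)).measurable
  have hsplit : ∀ (x : ENNReal) (b : ℝ), 0 ≤ b → b ≤ 1 → x ≤ x ^ b * x ^ (1 - b) := by
    intro x b hb hb1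
    rw [← ENNReal.rpow_add_of_nonneg _ _ hb (by linarith), add_sub_cancel, ENNReal.rpow_one]
  rcases hd.eq_or_lt with rfl | hd
  -- On the circle the embedding into `L^∞` does hold, and Hölder suffices.
  · obtain ⟨C, hC⟩ := recipNorm_circle_le_fderiv (F := ℂ)
    refine ⟨C ^ a, fun w hw => ?_⟩
    refine (recipNorm_interpolate (by nlinarith) le_rfl hl ha ha1.le (by ring) (hm w hw) (hm w hw)
      fun θ => hsplit _ _ ha.le ha1.le).trans (mul_le_mul' ?_ le_rfl)
    rw [ENNReal.coe_rpow_of_nonneg _ ha.le, ← ENNReal.mul_rpow_of_nonneg _ _ ha.le]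
    refine ENNReal.rpow_le_rpow ?_ ha.le
    simpa using hC w hw
  · have hd2 : (2 : ℝ) ≤ d := by exact_mod_cast hd
    set e : ℝ := 1 - 1 / (d : ℝ) with he_def
    have he : 0 < e := by
      rw [he_def, sub_pos, div_lt_one (by linarith)]; linarith
    -- With this `κ` the `L^(1/e)` norm of `‖w‖^κ` is a power of the `L^(1/l)` norm of `w`.
    set κ : ℝ := e / l with hκ_def
    have hκ : 0 < κ := by positivity
    -- So large an `m` places the target exponent `(1-a) l` between `e/(κ+m)` and `l`.
    obtain ⟨m, hm1⟩ := exists_nat_gt (a * κ / (1 - a))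
    have hm0 : (0 : ℝ) < m := lt_of_le_of_lt (by
      have : 0 < 1 - a := by linarith
      positivity) hm1
    have hma : a * κ < (1 - a) * m := by
      rw [div_lt_iff₀ (by linarith)] at hm1; linarith
    -- The iterated bound reads `Q^(κ+m) ≤ C G^m R^κ`; this `b` is the weight of `Q` for which the
    -- gradient factor appears to the power `a`.
    set b : ℝ := a * (κ + m) / m with hb_def
    have hb0 : 0 < b := by positivity
    have hb1 : b ≤ 1 := by
      rw [hb_def, div_le_one hm0]; nlinarith
    obtain ⟨C, hC⟩ := recipNorm_sphere_rpow_add_le (d := d) hd hκ m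
    refine ⟨C ^ (a / m), fun w hw => ?_⟩
    have hκm : 0 < κ + m := by positivity
    have hle : l = e / κ := by rw [hκ_def]; field_simp
    have h1 := hC w hw
    rw [← he_def, recipNorm_rpow_fun he hκm, recipNorm_rpow_fun he hκ, ← hle] at h1
    set G := recipNorm (1 / (d : ℝ)) (fun θ : UnitSphere (d + 1) => ‖w θ‖ₑ + ‖fderiv ℝ w θ‖ₑ)
            (surfaceMeasure (d + 1))
    set R := recipNorm l (fun θ : UnitSphere (d + 1) => ‖w θ‖ₑ) (surfaceMeasure (d + 1))
    have hexp : (1 - a) * l = b * (e / (κ + m)) + (1 - b) * l := by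
      rw [hb_def, hle]; field_simp; ring
    refine (recipNorm_interpolate (by nlinarith) (by positivity) hl hb0 hb1 hexp (hm w hw) (hm w hw)
      fun θ => hsplit _ _ hb0.le hb1).trans ?_
    set Q := recipNorm (e / (κ + m)) (fun θ : UnitSphere (d + 1) => ‖w θ‖ₑ) (surfaceMeasure (d + 1))
    have ham : 0 ≤ a / m := by positivity
    have h2 : Q ^ b ≤ (C : ENNReal) ^ (a / m) * G ^ a * R ^ (κ * (a / m)) := by
      have h3 := ENNReal.rpow_le_rpow h1 ham
      rw [← ENNReal.rpow_mul, ENNReal.mul_rpow_of_nonneg _ _ ham, ENNReal.mul_rpow_of_nonneg _ _ ham,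
        ← ENNReal.rpow_natCast, ← ENNReal.rpow_mul, ← ENNReal.rpow_mul,
        mul_div_cancel₀ a hm0.ne'] at h3
      have : (κ + m) * (a / m) = b := by rw [hb_def]; ring
      rwa [this] at h3
    refine (mul_le_mul' h2 le_rfl).trans (le_of_eq ?_)
    rw [mul_assoc, ← ENNReal.rpow_add_of_nonneg _ _ (by positivity) (by linarith),
      ENNReal.coe_rpow_of_nonneg _ ham]
    congr 2
    rw [hb_def]; field_simp; ring

end CriticalSphere

/-! ### Sobolev inequalities on all spheres at once. -/

section AngularSobolev

variable {d : ℕ} {F : Type*} [NormedAddCommGroup F] [NormedSpace ℝ F]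

theorem fderiv_comp_const_smul {E : Type*} [NormedAddCommGroup E] [NormedSpace ℝ E] {v : E → F}
    (hv : Differentiable ℝ v) (ρ : ℝ) (x : E) :
    fderiv ℝ (fun x => v (ρ • x)) x = ρ • fderiv ℝ v (ρ • x) := by
  have h := (hv (ρ • x)).hasFDerivAt.comp x ((hasFDerivAt_id x).const_smul ρ)
  refine h.fderiv.trans ?_
  ext y
  simp

/-- The gradient of `v(ρ ·)` carries a factor `ρ`, which in the logarithmic variable is the shift of
the weight from `c` to `c + 1`. -/
theorem recipNorm_sphere_scale_le {n : ℕ} {j : ℝ} (hj : 0 ≤ j) (hj1 : j ≤ 1)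
    {v : EuclideanSpace ℝ (Fin n) → F} (hv : ContDiff ℝ 1 v) {ρ : ℝ} (hρ : 0 < ρ) :
    recipNorm j (fun θ : UnitSphere n => ‖v (ρ • (θ : EuclideanSpace ℝ (Fin n)))‖ₑ
        + ‖fderiv ℝ (fun x => v (ρ • x)) θ‖ₑ) (surfaceMeasure n)
      ≤ angNorm j v ρ + ENNReal.ofReal ρ * angNorm j (fderiv ℝ v) ρ := by
  have hDv := hv.continuous_fderiv one_ne_zero
  have e : ∀ θ : UnitSphere n, ‖fderiv ℝ (fun x => v (ρ • x)) θ‖ₑ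
      = ENNReal.ofReal ρ * ‖fderiv ℝ v (ρ • (θ : EuclideanSpace ℝ (Fin n)))‖ₑ := by
    intro θ
    rw [fderiv_comp_const_smul (hv.differentiable one_ne_zero), enorm_smul,
      Real.enorm_of_nonneg hρ.le]
  simp_rw [e]
  refine (recipNorm_add_le hj hj1 (measurable_enorm_smul_sphere hv.continuous ρ)
    ((measurable_enorm_smul_sphere hDv ρ).const_mul _)).trans (add_le_add le_rfl ?_)
  rw [recipNorm_const_mul hj ENNReal.ofReal_ne_top]
  rfl

theorem angNorm_le_fderiv [FiniteDimensional ℝ F] (hd : 1 ≤ d) {i j : ℝ} (hi : 0 < i) (hj1 : j ≤ 1)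
    (hij : i = j - 1 / d) :
    ∃ C : ℝ≥0, ∀ v : EuclideanSpace ℝ (Fin (d + 1)) → F, ContDiff ℝ 1 v → ∀ ρ : ℝ, 0 < ρ →
      angNorm i v ρ ≤ C * (angNorm j v ρ + ENNReal.ofReal ρ * angNorm j (fderiv ℝ v) ρ) := by
  obtain ⟨C, hC⟩ := recipNorm_sphere_le_fderiv (F := F) hd hi hj1 hij
  have hj : 0 ≤ j := by
    have : 0 ≤ 1 / (d : ℝ) := by positivity
    linarith
  refine ⟨C, fun v hv ρ hρ => ?_⟩
  exact (hC (fun x => v (ρ • x)) (hv.comp (contDiff_const_smul ρ))).trans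
    (mul_le_mul' le_rfl (recipNorm_sphere_scale_le hj hj1 hv hρ))

theorem angNorm_le_critical (hd : 1 ≤ d) {a l : ℝ} (ha : 0 < a) (ha1 : a < 1) (hl : 0 < l) :
    ∃ C : ℝ≥0, ∀ v : EuclideanSpace ℝ (Fin (d + 1)) → ℂ, ContDiff ℝ 1 v → ∀ ρ : ℝ, 0 < ρ →
      angNorm ((1 - a) * l) v ρ ≤ C * (angNorm (1 / d) v ρ
        + ENNReal.ofReal ρ * angNorm (1 / d) (fderiv ℝ v) ρ) ^ a * angNorm l v ρ ^ (1 - a) := by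
  obtain ⟨C, hC⟩ := recipNorm_sphere_le_critical hd ha ha1 hl
  have hd1 : 1 / (d : ℝ) ≤ 1 := by
    rw [div_le_one (by exact_mod_cast hd)]; exact_mod_cast hd
  refine ⟨C, fun v hv ρ hρ => ?_⟩
  refine (hC (fun x => v (ρ • x)) (hv.comp (contDiff_const_smul ρ))).trans
    (mul_le_mul' (mul_le_mul' le_rfl (ENNReal.rpow_le_rpow ?_ ha.le)) le_rfl)
  exact recipNorm_sphere_scale_le (by positivity) hd1 hv hρ

theorem logNorm_scale_le {n : ℕ} {c i j : ℝ} (hi : 0 ≤ i) (hi1 : i ≤ 1)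
    {v : EuclideanSpace ℝ (Fin n) → F} (hv : ContDiff ℝ 1 v) :
    recipNorm i (fun t : ℝ => ENNReal.ofReal (Real.exp (c * t)) * (angNorm j v (Real.exp t)
        + ENNReal.ofReal (Real.exp t) * angNorm j (fderiv ℝ v) (Real.exp t))) volume
      ≤ logNorm c i j v + logNorm (c + 1) i j (fderiv ℝ v) := by
  have e : ∀ t : ℝ, ENNReal.ofReal (Real.exp (c * t)) * (angNorm j v (Real.exp t)
        + ENNReal.ofReal (Real.exp t) * angNorm j (fderiv ℝ v) (Real.exp t))
      = ENNReal.ofReal (Real.exp (c * t)) * angNorm j v (Real.exp t)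
        + ENNReal.ofReal (Real.exp ((c + 1) * t)) * angNorm j (fderiv ℝ v) (Real.exp t) := by
    intro t
    rw [mul_add, ← mul_assoc, ← ENNReal.ofReal_mul (by positivity), ← Real.exp_add, add_mul,
      one_mul]
  simp_rw [e]
  exact recipNorm_add_le hi hi1 (measurable_exp_mul_angNorm hv.continuous c j)
    (measurable_exp_mul_angNorm (hv.continuous_fderiv one_ne_zero) (c + 1) j)

/-- The first order weighted Sobolev inequality in which only the angular exponent improves, by the
largest admissible amount. -/
theorem logNorm_le_fderiv_angular [FiniteDimensional ℝ F] {n : ℕ} (hn : 2 ≤ n) {c i i' j' : ℝ}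
    (hc : 0 < c) (hi : 0 < i) (hi1 : i ≤ 1) (hi' : 0 < i') (hj' : j' ≤ 1)
    (h : (n - 1) * (j' - i') = 1) :
    ∃ C : ℝ≥0, ∀ v : EuclideanSpace ℝ (Fin n) → F, ContDiff ℝ 1 v → HasCompactSupport v →
      logNorm c i i' v ≤ C * logNorm (c + 1) i j' (fderiv ℝ v) := by
  obtain ⟨d, rfl⟩ : ∃ d, n = d + 1 := ⟨n - 1, by omega⟩
  have hd : 1 ≤ d := by omega
  have hd0 : (0 : ℝ) < d := by exact_mod_cast hd
  push_cast at h
  rw [add_sub_cancel_right] at h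
  have hij : i' = j' - 1 / d := by field_simp; linarith
  have hj0 : 0 < j' := by
    have : 0 < 1 / (d : ℝ) := by positivity
    linarith
  obtain ⟨C, hC⟩ := angNorm_le_fderiv (F := F) hd hi' hj' hij
  -- The lower order term left by the Sobolev inequality on spheres is absorbed by the first order
  -- inequality without gain in either exponent, which is a Hardy inequality.
  obtain ⟨C1, hC1⟩ := logNorm_le_fderiv (F := F) hn hc hi.le le_rfl hi1 hi hj0.le le_rfl hj' hj0
    (Or.inl (by simp))
  refine ⟨C * (C1 + 1), fun v hv hvc => ?_⟩
  rw [ENNReal.coe_mul, mul_assoc]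
  have h1 : logNorm c i i' v ≤ C * (logNorm c i j' v + logNorm (c + 1) i j' (fderiv ℝ v)) := by
    refine le_trans ?_ (mul_le_mul' le_rfl (logNorm_scale_le hi.le hi1 hv))
    rw [← recipNorm_const_mul hi.le ENNReal.coe_ne_top]
    refine recipNorm_mono hi.le fun t => ?_
    rw [mul_left_comm]
    exact mul_le_mul' le_rfl (hC v hv _ (Real.exp_pos t))
  refine h1.trans (mul_le_mul' le_rfl ?_)
  rw [ENNReal.coe_add, ENNReal.coe_one, add_mul, one_mul]
  exact add_le_add (hC1 v hv hvc) le_rfl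

end AngularSobolev

/-! ### Calculus of multi-indices. -/

section MultiIndex

variable {n : ℕ} {u : EuclideanSpace ℝ (Fin n) → ℂ}

theorem contDiff_partialD (hu : ContDiff ℝ ∞ u) (i : Fin n) : ContDiff ℝ ∞ (partialD i u) :=
  (hu.fderiv_right (m := ∞) (by simp)).clm_apply contDiff_const

theorem hasCompactSupport_partialD (hu : HasCompactSupport u) (i : Fin n) :
    HasCompactSupport (partialD i u) :=
  hu.fderiv_apply ℝ _

theorem partialD_comm (hu : ContDiff ℝ ∞ u) (i j : Fin n) :
    partialD i (partialD j u) = partialD j (partialD i u) := by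
  have hd : Differentiable ℝ (fderiv ℝ u) :=
    (hu.fderiv_right (m := 1) (by norm_cast)).differentiable one_ne_zero
  have h : ∀ (k l : Fin n) x, partialD k (partialD l u) x
      = fderiv ℝ (fderiv ℝ u) x (EuclideanSpace.single k 1) (EuclideanSpace.single l 1) := by
    intro k l x
    change fderiv ℝ (fun y => fderiv ℝ u y (EuclideanSpace.single l 1)) x _ = _
    rw [fderiv_clm_apply (hd x) (differentiableAt_const _)]
    simp
  ext x
  rw [h, h]
  exact (hu.contDiffAt.isSymmSndFDerivAt (by simp; norm_cast)) _ _

theorem contDiff_iterate_partialD (hu : ContDiff ℝ ∞ u) (i : Fin n) (m : ℕ) :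
    ContDiff ℝ ∞ ((partialD i)^[m] u) := by
  induction m with
  | zero => exact hu
  | succ m ih => rw [Function.iterate_succ_apply']; exact contDiff_partialD ih i

theorem iterate_partialD_comm (hu : ContDiff ℝ ∞ u) (i j : Fin n) (m : ℕ) :
    (partialD i)^[m] (partialD j u) = partialD j ((partialD i)^[m] u) := by
  induction m with
  | zero => rfl
  | succ m ih =>
    rw [Function.iterate_succ_apply', Function.iterate_succ_apply', ih,
      partialD_comm (contDiff_iterate_partialD hu i m)]

theorem contDiff_foldr_partialD (hu : ContDiff ℝ ∞ u) (ν : Fin n → ℕ) (l : List (Fin n)) :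
    ContDiff ℝ ∞ (l.foldr (fun i g => (partialD i)^[ν i] g) u) := by
  induction l with
  | nil => exact hu
  | cons k l ih => exact contDiff_iterate_partialD ih k _

theorem contDiff_multiD (hu : ContDiff ℝ ∞ u) (ν : Fin n → ℕ) : ContDiff ℝ ∞ (multiD ν u) :=
  contDiff_foldr_partialD hu ν _

theorem foldr_partialD_comm (hu : ContDiff ℝ ∞ u) (ν : Fin n → ℕ) (j : Fin n) (l : List (Fin n)) :
    l.foldr (fun i g => (partialD i)^[ν i] g) (partialD j u)
      = partialD j (l.foldr (fun i g => (partialD i)^[ν i] g) u) := by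
  induction l with
  | nil => rfl
  | cons k l ih =>
    rw [List.foldr_cons, List.foldr_cons, ih,
      iterate_partialD_comm (contDiff_foldr_partialD hu ν l)]

/-- The alternative `j ∈ l` is what lets the induction on the list close; without repetitions the
extra derivative is met at most once. -/
theorem foldr_partialD_add_single (hu : ContDiff ℝ ∞ u) (ν : Fin n → ℕ) (j : Fin n)
    {l : List (Fin n)} (hl : l.Nodup) :
    l.foldr (fun i g => (partialD i)^[(ν + Pi.single j 1 : Fin n → ℕ) i] g) u
      = if j ∈ l then partialD j (l.foldr (fun i g => (partialD i)^[ν i] g) u)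
        else l.foldr (fun i g => (partialD i)^[ν i] g) u := by
  induction l with
  | nil => rfl
  | cons k l ih =>
    rw [List.nodup_cons] at hl
    rw [List.foldr_cons, List.foldr_cons, ih hl.2]
    by_cases hkj : k = j
    · subst hkj
      rw [if_neg hl.1, if_pos List.mem_cons_self, Pi.add_apply, Pi.single_eq_same,
        Function.iterate_succ_apply']
    · have hjk : j ≠ k := fun h => hkj h.symm
      rw [Pi.add_apply, Pi.single_eq_of_ne hkj, add_zero]
      by_cases hj : j ∈ l
      · rw [if_pos hj, if_pos (List.mem_cons_of_mem _ hj),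
          iterate_partialD_comm (contDiff_foldr_partialD hu ν l)]
      · rw [if_neg hj, if_neg (by simp [hj, hjk])]

theorem multiD_add_single (hu : ContDiff ℝ ∞ u) (ν : Fin n → ℕ) (j : Fin n) :
    multiD (ν + Pi.single j 1) u = multiD ν (partialD j u) := by
  rw [multiD, foldr_partialD_add_single hu ν j (List.nodup_finRange n),
    if_pos (List.mem_finRange j), multiD, foldr_partialD_comm hu]

theorem multiD_zero (u : EuclideanSpace ℝ (Fin n) → ℂ) : multiD 0 u = u := by
  have : ∀ l : List (Fin n),
      l.foldr (fun i g => (partialD i)^[(0 : Fin n → ℕ) i] g) u = u := by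
    intro l
    induction l with
    | nil => rfl
    | cons k l ih => rw [List.foldr_cons, ih]; rfl
  exact this _

theorem enorm_fderiv_le_sum_partialD (u : EuclideanSpace ℝ (Fin n) → ℂ)
    (x : EuclideanSpace ℝ (Fin n)) : ‖fderiv ℝ u x‖ₑ ≤ ∑ i, ‖partialD i u x‖ₑ := by
  have h : ‖fderiv ℝ u x‖ ≤ ∑ i, ‖partialD i u x‖ := by
    refine ContinuousLinearMap.opNorm_le_bound _ (by positivity) fun y => ?_
    have hy : y = ∑ i, y i • EuclideanSpace.single i (1 : ℝ) := by
      have := (EuclideanSpace.basisFun (Fin n) ℝ).sum_repr y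
      simpa using this.symm
    conv_lhs => rw [hy, map_sum]
    rw [Finset.sum_mul]
    refine (norm_sum_le _ _).trans (Finset.sum_le_sum fun i _ => ?_)
    rw [map_smul, norm_smul, mul_comm]
    exact mul_le_mul_of_nonneg_left (PiLp.norm_apply_le y i) (norm_nonneg _)
  rw [← ofReal_norm]
  refine (ENNReal.ofReal_le_ofReal h).trans (le_of_eq ?_)
  rw [ENNReal.ofReal_sum_of_nonneg fun i _ => norm_nonneg _]
  simp only [ofReal_norm]

/-- By `multiD_add_single` each term on the left is one of the terms on the right, and a count of
the terms is enough. -/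
theorem sum_multiD_partialD_le (hu : ContDiff ℝ ∞ u) (Φ : (EuclideanSpace ℝ (Fin n) → ℂ) → ENNReal)
    (σ : ℕ) :
    ∑ k, ∑ ν ∈ Finset.piAntidiag (Finset.univ : Finset (Fin n)) σ, Φ (multiD ν (partialD k u))
      ≤ (n * (Finset.piAntidiag (Finset.univ : Finset (Fin n)) σ).card : ℕ)
        * ∑ ν ∈ Finset.piAntidiag (Finset.univ : Finset (Fin n)) (σ + 1), Φ (multiD ν u) := by
  have h : ∀ k : Fin n, ∀ ν ∈ Finset.piAntidiag (Finset.univ : Finset (Fin n)) σ,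
      Φ (multiD ν (partialD k u))
        ≤ ∑ ν ∈ Finset.piAntidiag (Finset.univ : Finset (Fin n)) (σ + 1), Φ (multiD ν u) := by
    intro k ν hν
    rw [← multiD_add_single hu]
    refine Finset.single_le_sum (f := fun ν => Φ (multiD ν u)) (fun _ _ => zero_le) ?_
    rw [Finset.mem_piAntidiag] at hν ⊢
    refine ⟨?_, fun i _ => Finset.mem_univ i⟩
    simp [Finset.sum_add_distrib, hν.1]
  refine (Finset.sum_le_sum fun k _ => Finset.sum_le_sum (h k)).trans (le_of_eq ?_)
  simp [mul_assoc]

end MultiIndex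

/-! ### Iteration to order `σ`. -/

section HigherOrder

variable {n : ℕ}

/-- The first order inequality, with the derivative split into partial derivatives. -/
theorem logNorm_le_sum_partialD (hn : 2 ≤ n) {c i j i' j' : ℝ} (hc : 0 < c) (hi : 0 ≤ i)
    (hij : i ≤ j) (hj : j ≤ 1) (hj0 : 0 < j) (hi' : 0 ≤ i') (hij' : i' ≤ j') (hj' : j' ≤ 1)
    (hj0' : 0 < j')
    (h : (j - i) + (n - 1) * (j' - i') < 1 ∨
      (j - i) + (n - 1) * (j' - i') = 1 ∧ (j < 1 ∧ 0 < i ∧ i < j ∨ i = j ∧ 0 < i')) :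
    ∃ C : ℝ≥0, ∀ u : EuclideanSpace ℝ (Fin n) → ℂ, ContDiff ℝ ∞ u → HasCompactSupport u →
      logNorm c i i' u ≤ C * ∑ k, logNorm (c + 1) j j' (partialD k u) := by
  suffices H : ∃ C : ℝ≥0, ∀ u : EuclideanSpace ℝ (Fin n) → ℂ, ContDiff ℝ 1 u →
      HasCompactSupport u → logNorm c i i' u ≤ C * logNorm (c + 1) j j' (fderiv ℝ u) by
    obtain ⟨C, hC⟩ := H
    refine ⟨C, fun u hu huc => (hC u (hu.of_le (by simp)) huc).trans (mul_le_mul' le_rfl ?_)⟩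
    exact logNorm_le_sum Finset.univ (fun k => (contDiff_partialD hu k).continuous) hj0.le hj
      hj0'.le hj' (enorm_fderiv_le_sum_partialD u)
  rcases h with h | ⟨h, ⟨h1, h2, h3⟩ | ⟨rfl, h1⟩⟩
  · exact logNorm_le_fderiv hn hc hi hij hj hj0 hi' hij' hj' hj0' (Or.inl h)
  · exact logNorm_le_fderiv hn hc hi hij hj hj0 hi' hij' hj' hj0' (Or.inr ⟨h, h1, h2, h3⟩)
  · exact logNorm_le_fderiv_angular hn hc hj0 hj h1 hj' (by linarith)

/-- The weighted Sobolev inequality of order `σ` in mixed radial-angular norms. -/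
theorem logNorm_le_sum_multiD (hn : 2 ≤ n) (σ : ℕ) {c i j i' j' : ℝ} (hc : 0 < c) (hi : 0 ≤ i)
    (hij : i ≤ j) (hj : j ≤ 1) (hj0 : 0 < j) (hi' : 0 ≤ i') (hij' : i' ≤ j') (hj' : j' ≤ 1)
    (hj0' : 0 < j')
    (h : (j - i) + (n - 1) * (j' - i') < σ ∨
      (j - i) + (n - 1) * (j' - i') = σ ∧ (j < 1 ∧ 0 < i ∧ i < j ∨ i = j ∧ 0 < i')) :
    ∃ C : ℝ≥0, ∀ u : EuclideanSpace ℝ (Fin n) → ℂ, ContDiff ℝ ∞ u → HasCompactSupport u →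
      logNorm c i i' u ≤ C * ∑ ν ∈ Finset.piAntidiag (Finset.univ : Finset (Fin n)) σ,
        logNorm (c + σ) j j' (multiD ν u) := by
  have hn1 : (1 : ℝ) ≤ n - 1 := by
    have : (2 : ℝ) ≤ n := by exact_mod_cast hn
    linarith
  induction σ generalizing c i i' with
  | zero =>
    have hB : j' - i' ≤ ((n : ℝ) - 1) * (j' - i') := le_mul_of_one_le_left (by linarith) hn1
    have hD : (j - i) + (n - 1) * (j' - i') ≤ 0 := by
      rcases h with h | h
      · simpa using h.le
      · simpa using h.1.le
    obtain rfl : i = j := by linarith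
    obtain rfl : i' = j' := by linarith
    refine ⟨1, fun u _ _ => ?_⟩
    simp [multiD_zero]
  | succ σ ih =>
    set D : ℝ := (j - i) + (n - 1) * (j' - i') with hD
    have hs : (0 : ℝ) < σ + 1 := by positivity
    push_cast at h
    -- Each of the `σ + 1` derivatives takes an equal part of both gains, so the condition on `D`
    -- passes to every stage with the same ratio `D/(σ+1)`. The intermediate reciprocals are
    -- positive, so the endpoint 0 occurs at most in the outermost stage.
    set i1 : ℝ := i + (j - i) / (σ + 1) with hi1
    set i1' : ℝ := i' + (j' - i') / (σ + 1) with hi1'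
    have hdiv : ∀ x : ℝ, 0 ≤ x → 0 ≤ x / (σ + 1) ∧ x / (σ + 1) ≤ x := fun x hx =>
      ⟨by positivity, div_le_self hx (by linarith [(Nat.cast_nonneg σ : (0 : ℝ) ≤ σ)])⟩
    have h1 := hdiv _ (sub_nonneg.2 hij)
    have h1' := hdiv _ (sub_nonneg.2 hij')
    have hpos : ∀ x y : ℝ, 0 ≤ x → x ≤ y → 0 < y → 0 < x + (y - x) / (σ + 1) := by
      intro x y hx hxy hy
      rcases hx.eq_or_lt with rfl | hx
      · simp only [zero_add, sub_zero]; positivity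
      · have := (hdiv _ (sub_nonneg.2 hxy)).1
        linarith
    have hi10 : 0 < i1 := hpos _ _ hi hij hj0
    have hi10' : 0 < i1' := hpos _ _ hi' hij' hj0'
    have hD1 : (i1 - i) + (n - 1) * (i1' - i') = D / (σ + 1) := by rw [hi1, hi1', hD]; ring
    have hD2 : (j - i1) + (n - 1) * (j' - i1') = D / (σ + 1) * σ := by
      rw [hi1, hi1', hD]; field_simp; ring
    have hlt : i < j → i < i1 := by
      intro hlt
      have : 0 < (j - i) / (σ + 1) := div_pos (by linarith) hs
      linarith
    obtain ⟨C1, hC1⟩ := logNorm_le_sum_partialD hn hc hi (by linarith : i ≤ i1)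
      (by linarith : i1 ≤ 1) hi10 hi' (by linarith : i' ≤ i1') (by linarith : i1' ≤ 1) hi10' (by
        rw [hD1]
        rcases h with h | ⟨h, h2⟩
        · exact Or.inl (by rwa [div_lt_one hs])
        · refine Or.inr ⟨by rw [h, div_self hs.ne'], ?_⟩
          rcases h2 with ⟨h2, h3, h4⟩ | ⟨h2, h3⟩
          · exact Or.inl ⟨by linarith, h3, hlt h4⟩
          · exact Or.inr ⟨by rw [hi1, h2]; simp, h3⟩)
    obtain ⟨C2, hC2⟩ := ih (by linarith : 0 < c + 1) hi10.le (by linarith : i1 ≤ j) hi10'.le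
      (by linarith : i1' ≤ j') (by
        rw [hD2]
        rcases Nat.eq_zero_or_pos σ with rfl | hσ
        -- With no derivative left there is no gain left either, so `i1 = j` and equality holds.
        · exact Or.inr ⟨by simp, Or.inr ⟨by rw [hi1]; simp, hi10'⟩⟩
        · have hσ0 : (0 : ℝ) < σ := by exact_mod_cast hσ
          rcases h with h | ⟨h, h2⟩
          · exact Or.inl (mul_lt_of_lt_one_left hσ0 (by rwa [div_lt_one hs]))
          · refine Or.inr ⟨by rw [h, div_self hs.ne', one_mul], ?_⟩
            rcases h2 with ⟨h2, h3, h4⟩ | ⟨h2, h3⟩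
            · refine Or.inl ⟨h2, hi10, ?_⟩
              have : (j - i) / (σ + 1) < j - i := div_lt_self (by linarith) (by linarith)
              linarith
            · exact Or.inr ⟨by rw [hi1, h2]; simp, hi10'⟩)
    refine ⟨C1 * (C2 * (n * (Finset.piAntidiag (Finset.univ : Finset (Fin n)) σ).card : ℕ)),
      fun u hu huc => (hC1 u hu huc).trans ?_⟩
    rw [ENNReal.coe_mul, mul_assoc]
    refine mul_le_mul' le_rfl ?_
    refine (Finset.sum_le_sum fun k _ =>
      hC2 _ (contDiff_partialD hu k) (hasCompactSupport_partialD huc k)).trans ?_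
    rw [← Finset.mul_sum, ENNReal.coe_mul, mul_assoc]
    refine mul_le_mul' le_rfl ?_
    have e : c + ((σ + 1 : ℕ) : ℝ) = c + 1 + σ := by push_cast; ring
    rw [e, ENNReal.coe_natCast]
    exact sum_multiD_partialD_le hu (logNorm (c + 1 + σ) j j') σ

end HigherOrder

/-! ### The interpolation inequality in mixed norms. -/

section MixedNorm

variable {n : ℕ}

theorem lintegral_Ioi_zero_exp (φ : ℝ → ENNReal) :
    ∫⁻ R in Set.Ioi (0 : ℝ), φ R = ∫⁻ t, ENNReal.ofReal (Real.exp t) * φ (Real.exp t) := by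
  rw [← Real.range_exp, ← Set.image_univ, lintegral_image_eq_lintegral_abs_deriv_mul .univ
    (fun x _ => (Real.hasDerivAt_exp x).hasDerivWithinAt) Real.exp_injective.injOn]
  simp_rw [Real.abs_exp, Measure.restrict_univ]

theorem angNorm_powWeight {i s ρ : ℝ} (hi : 0 ≤ i) (hρ : 0 < ρ)
    (f : EuclideanSpace ℝ (Fin n) → ℂ) :
    angNorm i (powWeight s f) ρ = ENNReal.ofReal (ρ ^ s) * angNorm i f ρ := by
  rw [angNorm, angNorm, ← recipNorm_const_mul hi ENNReal.ofReal_ne_top]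
  congr 1
  ext θ
  have hθ : ‖ρ • (θ : EuclideanSpace ℝ (Fin n))‖ = ρ := by
    rw [norm_smul, norm_eq_of_mem_sphere θ, mul_one, Real.norm_of_nonneg hρ.le]
  rw [powWeight, enorm_smul, hθ, Real.enorm_of_nonneg (by positivity)]

theorem mixedNorm_eq_angNorm {p p' : ℝ} (hp' : 0 < p') (f : EuclideanSpace ℝ (Fin n) → ℂ) :
    mixedNorm p p' f = (∫⁻ ρ in Set.Ioi (0 : ℝ),
      angNorm (1 / p') f ρ ^ p * ENNReal.ofReal (ρ ^ (n - 1))) ^ (1 / p) := by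
  rw [mixedNorm]
  congr 1
  refine lintegral_congr fun ρ => ?_
  rw [angNorm, recipNorm_one_div hp']

/-- Under `ρ = e^t` the measure `ρ^(n-1) dρ` becomes `e^(nt) dt`, whose `p`-th root contributes
`n/p` to the exponential rate. -/
theorem mixedNorm_powWeight (hn : 1 ≤ n) {p p' : ℝ} (hp : 0 < p) (hp' : 0 < p') (s : ℝ)
    (f : EuclideanSpace ℝ (Fin n) → ℂ) :
    mixedNorm p p' (powWeight s f) = logNorm (n / p + s) (1 / p) (1 / p') f := by
  rw [mixedNorm_eq_angNorm hp', logNorm, recipNorm_one_div hp, lintegral_Ioi_zero_exp]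
  congr 1
  refine lintegral_congr fun t => ?_
  rw [angNorm_powWeight (by positivity) (Real.exp_pos t), ENNReal.mul_rpow_of_nonneg _ _ hp.le,
    ENNReal.mul_rpow_of_nonneg _ _ hp.le, ENNReal.ofReal_rpow_of_nonneg (by positivity) hp.le,
    ENNReal.ofReal_rpow_of_nonneg (by positivity) hp.le, mul_right_comm, ← mul_assoc,
    ← ENNReal.ofReal_mul (by positivity), ← ENNReal.ofReal_mul (by positivity)]
  congr 2
  rw [← Real.exp_mul, ← Real.exp_mul, ← Real.exp_mul, ← Real.exp_nat_mul, ← Real.exp_add,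
    ← Real.exp_add]
  congr 1
  push_cast [Nat.cast_sub hn]
  field_simp
  ring

/-- Radial interpolation from an interpolation inequality on spheres. -/
theorem logNorm_interpolate {a c c0 c1 i i0 j k l : ℝ} (ha : 0 < a) (ha1 : a ≤ 1) (hi0 : 0 < i0)
    (hi : 0 ≤ i) (hk : 0 < k) (hi0e : i0 = a * i + (1 - a) * k) (hc : c0 = a * c + (1 - a) * c1)
    {K : ℝ≥0} {u : EuclideanSpace ℝ (Fin n) → ℂ} (hu : Continuous u) {Z : ℝ → ENNReal}
    (hZ : Measurable Z)
    (h : ∀ ρ, 0 < ρ → angNorm j u ρ ≤ K * Z ρ ^ a * angNorm l u ρ ^ (1 - a)) :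
    logNorm c0 i0 j u ≤ K * recipNorm i
      (fun t : ℝ => ENNReal.ofReal (Real.exp (c * t)) * Z (Real.exp t)) volume ^ a
        * logNorm c1 k l u ^ (1 - a) := by
  have ha1' : 0 ≤ 1 - a := by linarith
  have hZm : Measurable fun t : ℝ => ENNReal.ofReal (Real.exp (c * t)) * Z (Real.exp t) :=
    Measurable.mul (by fun_prop) (hZ.comp Real.measurable_exp)
  have key : recipNorm i0 (fun t : ℝ =>
        (ENNReal.ofReal (Real.exp (c * t)) * Z (Real.exp t)) ^ a
          * (ENNReal.ofReal (Real.exp (c1 * t)) * angNorm l u (Real.exp t)) ^ (1 - a)) volume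
      ≤ recipNorm i
      (fun t : ℝ => ENNReal.ofReal (Real.exp (c * t)) * Z (Real.exp t)) volume ^ a
        * logNorm c1 k l u ^ (1 - a) :=
    recipNorm_interpolate hi0 hi hk ha ha1 hi0e hZm (measurable_exp_mul_angNorm hu c1 l)
      fun _ => le_rfl
  rw [mul_assoc]
  refine le_trans ?_ (mul_le_mul' le_rfl key)
  rw [← recipNorm_const_mul hi0.le ENNReal.coe_ne_top]
  refine recipNorm_mono hi0.le fun t => ?_
  refine (mul_le_mul' le_rfl (h _ (Real.exp_pos t))).trans (le_of_eq ?_)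
  have e : ENNReal.ofReal (Real.exp (c0 * t))
      = ENNReal.ofReal (Real.exp (c * t)) ^ a * ENNReal.ofReal (Real.exp (c1 * t)) ^ (1 - a) := by
    rw [ENNReal.ofReal_rpow_of_nonneg (by positivity) ha.le,
      ENNReal.ofReal_rpow_of_nonneg (by positivity) ha1', ← ENNReal.ofReal_mul (by positivity),
      ← Real.exp_mul, ← Real.exp_mul, ← Real.exp_add, hc]
    congr 2; ring
  rw [e, ENNReal.mul_rpow_of_nonneg _ _ ha.le, ENNReal.mul_rpow_of_nonneg _ _ ha1']
  ring

/-- The multiplicative inequality when the angular Sobolev embedding reaches the critical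
exponent. -/
theorem logNorm_le_critical (hn : 2 ≤ n) {σ : ℕ} (hσ : 1 ≤ σ) {a c c0 c1 i0 j j' k l : ℝ}
    (ha : 0 < a) (ha1 : a < 1) (hc : 0 < c) (hi0 : 0 < i0) (hj : 0 < j) (hj1 : j ≤ 1)
    (hj'1 : j' ≤ 1) (hk : 0 < k) (hl : 0 < l) (hi0e : i0 = a * j + (1 - a) * k)
    (hc0 : c0 = a * c + (1 - a) * c1) (h : (n - 1) * j' = σ) :
    ∃ C : ℝ≥0, ∀ u : EuclideanSpace ℝ (Fin n) → ℂ, ContDiff ℝ ∞ u → HasCompactSupport u →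
      logNorm c0 i0 ((1 - a) * l) u
        ≤ C * (∑ ν ∈ Finset.piAntidiag (Finset.univ : Finset (Fin n)) σ,
            logNorm (c + σ) j j' (multiD ν u)) ^ a * logNorm c1 k l u ^ (1 - a) := by
  obtain ⟨d, rfl⟩ : ∃ d, n = d + 1 := ⟨n - 1, by omega⟩
  obtain ⟨τ, rfl⟩ : ∃ τ, σ = τ + 1 := ⟨σ - 1, by omega⟩
  have hd : 1 ≤ d := by omega
  have hd1 : (1 : ℝ) ≤ d := by exact_mod_cast hd
  have hd0 : (0 : ℝ) < d := by linarith
  have hdi : 0 < 1 / (d : ℝ) := by positivity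
  have hdi1 : 1 / (d : ℝ) ≤ 1 := by rwa [div_le_one hd0]
  push_cast at h
  rw [add_sub_cancel_right] at h
  have hj' : j' = (τ + 1) / d := by field_simp; linarith
  have hdj : 1 / (d : ℝ) ≤ j' := by rw [hj']; gcongr; simp
  obtain ⟨C1, hC1⟩ := angNorm_le_critical hd ha ha1 hl
  obtain ⟨C2, hC2⟩ := logNorm_le_fderiv (F := ℂ) hn hc hj.le le_rfl hj1 hj hdi.le le_rfl hdi1 hdi
    (Or.inl (by simp))
  -- The spherical inequality uses one derivative in angular `L^d`. The other `τ = σ - 1`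
  -- derivatives lead there from `L^(1/j')` by a purely angular gain, with equality `d (j' - 1/d) =
  -- τ`.
  obtain ⟨C3, hC3⟩ := logNorm_le_sum_multiD hn τ (by linarith : 0 < c + 1) hj.le le_rfl hj1 hj
    hdi.le hdj hj'1 (by linarith) (Or.inr ⟨by rw [hj']; push_cast; field_simp; ring,
      Or.inr ⟨rfl, hdi⟩⟩)
  set M : ℝ≥0 :=
    (((d + 1) * (Finset.piAntidiag (Finset.univ : Finset (Fin (d + 1))) τ).card : ℕ) : ℝ≥0) with hM
  refine ⟨C1 * ((C2 + 1) * (C3 * M)) ^ a, fun u hu huc => ?_⟩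
  have hu1 : ContDiff ℝ 1 u := hu.of_le (by simp)
  have hZm : Measurable fun ρ : ℝ => angNorm (1 / d) u ρ
      + ENNReal.ofReal ρ * angNorm (1 / d) (fderiv ℝ u) ρ :=
    (measurable_angNorm hu1.continuous _).add (Measurable.mul (by fun_prop)
      (measurable_angNorm (hu1.continuous_fderiv one_ne_zero) _))
  refine (logNorm_interpolate ha ha1.le hi0 hj.le hk hi0e hc0 hu1.continuous hZm
    (hC1 u hu1)).trans (mul_le_mul' ?_ le_rfl)
  rw [ENNReal.coe_mul, mul_assoc, ENNReal.coe_rpow_of_nonneg _ ha.le,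
    ← ENNReal.mul_rpow_of_nonneg _ _ ha.le]
  refine mul_le_mul' le_rfl (ENNReal.rpow_le_rpow ?_ ha.le)
  have e : c + ((τ + 1 : ℕ) : ℝ) = c + 1 + τ := by push_cast; ring
  calc _ ≤ _ := logNorm_scale_le hj.le hj1 hu1
    _ ≤ (C2 + 1 : ℝ≥0) * logNorm (c + 1) j (1 / d) (fderiv ℝ u) := by
        rw [ENNReal.coe_add, ENNReal.coe_one, add_mul, one_mul]
        exact add_le_add (hC2 u hu1 huc) le_rfl
    _ ≤ (C2 + 1 : ℝ≥0) * ∑ k, logNorm (c + 1) j (1 / d) (partialD k u) :=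
        mul_le_mul' le_rfl (logNorm_le_sum Finset.univ
          (fun k => (contDiff_partialD hu k).continuous) hj.le hj1 hdi.le hdi1
          (enorm_fderiv_le_sum_partialD u))
    _ ≤ (C2 + 1 : ℝ≥0) * (C3 * (M *
          ∑ ν ∈ Finset.piAntidiag (Finset.univ : Finset (Fin (d + 1))) (τ + 1),
            logNorm (c + 1 + τ) j j' (multiD ν u))) := by
        refine mul_le_mul' le_rfl ((Finset.sum_le_sum fun k _ =>
          hC3 _ (contDiff_partialD hu k) (hasCompactSupport_partialD huc k)).trans ?_)
        rw [← Finset.mul_sum, hM, ENNReal.coe_natCast]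
        exact mul_le_mul' le_rfl (sum_multiD_partialD_le hu (logNorm (c + 1 + τ) j j') τ)
    _ = _ := by rw [e, ENNReal.coe_mul, ENNReal.coe_mul]; ring

/-- The multiplicative inequality away from the critical angular exponent. -/
theorem logNorm_le_subcritical (hn : 2 ≤ n) {σ : ℕ} {a c c0 c1 i i' i0 i0' j j' k l : ℝ}
    (ha : 0 < a) (ha1 : a ≤ 1) (hc : 0 < c) (hi0 : 0 < i0) (hi0' : 0 < i0') (hi : 0 ≤ i)
    (hij : i ≤ j) (hj : j ≤ 1) (hj0 : 0 < j) (hi' : 0 ≤ i') (hij' : i' ≤ j') (hj' : j' ≤ 1)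
    (hj0' : 0 < j') (hk : 0 < k) (hl : 0 < l) (hi0e : i0 = a * i + (1 - a) * k)
    (hi0e' : i0' = a * i' + (1 - a) * l) (hc0 : c0 = a * c + (1 - a) * c1)
    (h : (j - i) + (n - 1) * (j' - i') < σ ∨
      (j - i) + (n - 1) * (j' - i') = σ ∧ (j < 1 ∧ 0 < i ∧ i < j ∨ i = j ∧ 0 < i')) :
    ∃ C : ℝ≥0, ∀ u : EuclideanSpace ℝ (Fin n) → ℂ, ContDiff ℝ ∞ u → HasCompactSupport u →
      logNorm c0 i0 i0' u
        ≤ C * (∑ ν ∈ Finset.piAntidiag (Finset.univ : Finset (Fin n)) σ,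
            logNorm (c + σ) j j' (multiD ν u)) ^ a * logNorm c1 k l u ^ (1 - a) := by
  obtain ⟨C, hC⟩ := logNorm_le_sum_multiD hn σ hc hi hij hj hj0 hi' hij' hj' hj0' h
  refine ⟨C ^ a, fun u hu huc => ?_⟩
  have hang : ∀ ρ : ℝ, 0 < ρ → angNorm i0' u ρ
      ≤ (1 : ℝ≥0) * angNorm i' u ρ ^ a * angNorm l u ρ ^ (1 - a) := by
    intro ρ _
    rw [ENNReal.coe_one, one_mul]
    have hm := measurable_enorm_smul_sphere hu.continuous ρ
    refine recipNorm_interpolate hi0' hi' hl ha ha1 hi0e' hm hm fun θ => ?_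
    rw [← ENNReal.rpow_add_of_nonneg _ _ ha.le (by linarith), add_sub_cancel, ENNReal.rpow_one]
  refine (logNorm_interpolate ha ha1 hi0 hi hk hi0e hc0 hu.continuous
    (measurable_angNorm hu.continuous i') hang).trans (mul_le_mul' ?_ le_rfl)
  rw [ENNReal.coe_one, one_mul, ENNReal.coe_rpow_of_nonneg _ ha.le,
    ← ENNReal.mul_rpow_of_nonneg _ _ ha.le]
  exact ENNReal.rpow_le_rpow (hC u hu huc) ha.le

/-- The weighted interpolation inequality in mixed radial-angular norms. -/
theorem mixedNorm_le_mixedNormD (hn : 2 ≤ n) {σ : ℕ} {α β γ a p p' q q' r r' : ℝ} (hσ : 1 ≤ σ)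
    (hp : 1 ≤ p) (hp' : 1 ≤ p') (hq : 1 ≤ q) (hq' : 1 ≤ q') (hr : 0 < r) (hr' : 1 ≤ r')
    (ha : 0 < a) (ha1 : a ≤ 1) (hα : α < n / p - σ)
    (hscale : γ - n / r = a * (α + σ - n / p) + (1 - a) * (β - n / q))
    (hΔ : cknDelta n σ a p q r ≤ a * σ) (hΔ0 : a * (σ - n / p') ≤ cknDelta n σ a p' q' r')
    (hΔ' : cknDelta n σ a p' q' r' ≤ a * σ)
    (h : (0 ≤ cknDelta n σ a p q r + (n - 1) * cknDelta n σ a p' q' r' ∧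
          1 < p ∧ a * (σ - n / p) < cknDelta n σ a p q r) ∨
        (0 < cknDelta n σ a p q r + (n - 1) * cknDelta n σ a p' q' r' ∧
          a * (σ - n / p) ≤ cknDelta n σ a p q r)) :
    ∃ C : ℝ≥0, ∀ u : EuclideanSpace ℝ (Fin n) → ℂ, ContDiff ℝ ∞ u → HasCompactSupport u →
      mixedNorm r r' (powWeight (-γ) u) ≤
        C * mixedNormD p p' (-α) σ u ^ a * mixedNorm q q' (powWeight (-β) u) ^ (1 - a) := by
  have hn0 : (0 : ℝ) < n := by exact_mod_cast (by omega : 0 < n)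
  have hp0 : 0 < p := by linarith
  have hp0' : 0 < p' := by linarith
  have hq0 : 0 < q := by linarith
  have hq0' : 0 < q' := by linarith
  have hr0' : 0 < r' := by linarith
  -- Reciprocals of the exponents in which the factor raised to the power `a` must be measured, so
  -- that Hölder against `q`, `q'` produces `r`, `r'`.
  set i : ℝ := (1 / r - (1 - a) * (1 / q)) / a with hi_def
  set i' : ℝ := (1 / r' - (1 - a) * (1 / q')) / a with hi'_def
  have hai : a * i = 1 / r - (1 - a) * (1 / q) := by rw [hi_def]; field_simp
  have hai' : a * i' = 1 / r' - (1 - a) * (1 / q') := by rw [hi'_def]; field_simp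
  have hD : cknDelta n σ a p q r = a * σ - n * (a * (1 / p - i)) := by
    rw [cknDelta, mul_sub a, hai]; ring
  have hD' : cknDelta n σ a p' q' r' = a * σ - n * (a * (1 / p' - i')) := by
    rw [cknDelta, mul_sub a, hai']; ring
  have hna : 0 < n * a := by positivity
  have hij : i ≤ 1 / p := by
    rw [hD] at hΔ
    exact le_of_mul_le_mul_left (by linarith : n * a * i ≤ n * a * (1 / p)) hna
  have hij' : i' ≤ 1 / p' := by
    rw [hD'] at hΔ'
    exact le_of_mul_le_mul_left (by linarith : n * a * i' ≤ n * a * (1 / p')) hna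
  have e1 : a * (σ - n / p) = a * σ - n * a * (1 / p) := by ring
  have e1' : a * (σ - n / p') = a * σ - n * a * (1 / p') := by ring
  have hi' : 0 ≤ i' := by
    rw [hD', e1'] at hΔ0
    exact le_of_mul_le_mul_left (by linarith : n * a * 0 ≤ n * a * i') hna
  set D : ℝ := (1 / p - i) + (n - 1) * (1 / p' - i') with hD_def
  -- The sign condition on the weighted sum is thereby `D ≤ σ`, or `D < σ` in the relaxed
  -- alternative.
  have hsum : cknDelta n σ a p q r + (n - 1) * cknDelta n σ a p' q' r' = n * a * (σ - D) := by
    rw [hD, hD', hD_def]; ring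
  rw [hsum, e1, hD] at h
  have hi : 0 ≤ i := by
    have h2 : a * σ - n * a * (1 / p) ≤ a * σ - n * (a * (1 / p - i)) := by
      rcases h with h | h
      · exact h.2.2.le
      · exact h.2
    exact le_of_mul_le_mul_left (by linarith : n * a * 0 ≤ n * a * i) hna
  have hcase : D < σ ∨ D = σ ∧ 1 < p ∧ 0 < i := by
    rcases h with ⟨h1, h2, h3⟩ | ⟨h1, _⟩
    · have h4 : D ≤ σ := by linarith [nonneg_of_mul_nonneg_right h1 hna]
      rcases h4.lt_or_eq with h4 | h4
      · exact Or.inl h4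
      · refine Or.inr ⟨h4, h2, ?_⟩
        rcases hi.eq_or_lt with h5 | h5
        · rw [← h5] at h3; exfalso; linarith
        · exact h5
    · left; linarith [pos_of_mul_pos_right h1 hna.le]
  have hc : 0 < n / p + -α - σ := by linarith
  -- The scaling condition, read as interpolation of the exponential rates.
  have hc0 : n / r + -γ = a * (n / p + -α - σ) + (1 - a) * (n / q + -β) := by linarith
  have hinv : ∀ {x : ℝ}, 1 ≤ x → 1 / x ≤ 1 := fun hx => (div_le_one (by linarith)).2 hx
  have main : ∃ C : ℝ≥0, ∀ u : EuclideanSpace ℝ (Fin n) → ℂ, ContDiff ℝ ∞ u →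
      HasCompactSupport u → logNorm (n / r + -γ) (1 / r) (1 / r') u
        ≤ C * (∑ ν ∈ Finset.piAntidiag (Finset.univ : Finset (Fin n)) σ,
            logNorm (n / p + -α - σ + σ) (1 / p) (1 / p') (multiD ν u)) ^ a
          * logNorm (n / q + -β) (1 / q) (1 / q') u ^ (1 - a) := by
    -- The single configuration covered neither by fractional integration nor by the angular Sobolev
    -- inequality.
    by_cases hcrit : D = σ ∧ i = 1 / p ∧ i' = 0
    · obtain ⟨hDσ, hip, hi0⟩ := hcrit
      have hr'e : 1 / r' = (1 - a) * (1 / q') := by rw [hi0] at hai'; linarith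
      -- `a = 1` together with `i' = 0` would give `1/r' = 0`.
      have ha1' : a < 1 := by
        refine lt_of_le_of_ne ha1 fun h1 => ?_
        rw [h1] at hr'e
        have : 0 < 1 / r' := by positivity
        linarith
      rw [hr'e]
      refine logNorm_le_critical hn hσ ha ha1' hc (by positivity) (by positivity) (hinv hp)
        (hinv hp') (by positivity) (by positivity) (by rw [← hip]; linarith) hc0 ?_
      rw [← hDσ, hD_def, hip, hi0]; ring
    · refine logNorm_le_subcritical hn ha ha1 hc (by positivity) (by positivity) hi hij (hinv hp)
        (by positivity) hi' hij' (hinv hp') (by positivity) (by positivity) (by positivity)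
        (by linarith) (by linarith) hc0 ?_
      rcases hcase with h1 | ⟨h1, h2, h3⟩
      · exact Or.inl h1
      · refine Or.inr ⟨h1, ?_⟩
        rcases hij.lt_or_eq with h4 | h4
        · exact Or.inl ⟨by rwa [div_lt_one hp0], h3, h4⟩
        · exact Or.inr ⟨h4, hi'.lt_of_ne fun h5 => hcrit ⟨h1, h4, h5.symm⟩⟩
  obtain ⟨C, hC⟩ := main
  refine ⟨C, fun u hu huc => ?_⟩
  have hn1 : 1 ≤ n := by omega
  rw [mixedNormD, mixedNorm_powWeight hn1 hr hr0', mixedNorm_powWeight hn1 hq0 hq0']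
  simp_rw [mixedNorm_powWeight hn1 hp0 hp0']
  have := hC u hu huc
  rwa [sub_add_cancel] at this

end MixedNorm

/-! ### Ordinary Lebesgue norms and radial functions. -/

section Lebesgue

variable {n : ℕ}

theorem measurable_powWeight {f : EuclideanSpace ℝ (Fin n) → ℂ} (hf : Continuous f) (s : ℝ) :
    Measurable (powWeight s f) :=
  Measurable.smul (measurable_norm.pow_const s) hf.measurable

theorem eLpNorm_eq_mixedNorm (hn : 1 ≤ n) {p : ℝ} (hp : 0 < p)
    {f : EuclideanSpace ℝ (Fin n) → ℂ} (hf : Measurable f) :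
    eLpNorm f (ENNReal.ofReal p) volume = mixedNorm p p f := by
  rw [eLpNorm_eq_lintegral_rpow_enorm_toReal (by simpa using hp) ENNReal.ofReal_ne_top,
    ENNReal.toReal_ofReal hp.le, mixedNorm]
  congr 1
  have hm : Measurable fun z : UnitSphere n × ℝ => ENNReal.ofReal (z.2 ^ (n - 1)) *
      ‖f (z.2 • (z.1 : EuclideanSpace ℝ (Fin n)))‖ₑ ^ p := by
    refine Measurable.mul (by fun_prop) (Measurable.pow_const (Measurable.enorm ?_) p)
    exact hf.comp (by fun_prop)
  rw [lintegral_polar hn (hf.enorm.pow_const p), lintegral_lintegral_swap hm.aemeasurable]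
  refine lintegral_congr fun ρ => ?_
  rw [← ENNReal.rpow_mul, one_div_mul_cancel hp.ne', ENNReal.rpow_one, mul_comm,
    lintegral_const_mul' _ _ ENNReal.ofReal_ne_top]

theorem mixedNorm_le_of_angNorm_le {p p₁ p₂ : ℝ} (hp : 0 < p) (hp₁ : 0 < p₁) (hp₂ : 0 < p₂)
    {K : ℝ≥0} {f : EuclideanSpace ℝ (Fin n) → ℂ}
    (h : ∀ ρ, 0 < ρ → angNorm (1 / p₁) f ρ ≤ K * angNorm (1 / p₂) f ρ) :
    mixedNorm p p₁ f ≤ K * mixedNorm p p₂ f := by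
  rw [mixedNorm_eq_angNorm hp₁, mixedNorm_eq_angNorm hp₂]
  have hK : (K : ENNReal) = ((K : ENNReal) ^ p) ^ (1 / p) := by
    rw [← ENNReal.rpow_mul, mul_one_div_cancel hp.ne', ENNReal.rpow_one]
  rw [hK, ← ENNReal.mul_rpow_of_nonneg _ _ (by positivity), ← lintegral_const_mul' _ _
    (ENNReal.rpow_ne_top_of_nonneg hp.le ENNReal.coe_ne_top)]
  refine ENNReal.rpow_le_rpow (setLIntegral_mono' measurableSet_Ioi fun ρ hρ => ?_) (by positivity)
  rw [← mul_assoc, ← ENNReal.mul_rpow_of_nonneg _ _ hp.le]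
  exact mul_le_mul' (ENNReal.rpow_le_rpow (h ρ hρ) hp.le) le_rfl

/-- On the sphere the `L^1` norm is controlled by the `L^p` norm. -/
theorem exists_mixedNorm_one_le {p : ℝ} (hp : 1 ≤ p) :
    ∃ K : ℝ≥0, ∀ f : EuclideanSpace ℝ (Fin n) → ℂ, Measurable f →
      mixedNorm p 1 f ≤ K * mixedNorm p p f := by
  have hp0 : 0 < p := by linarith
  rcases hp.eq_or_lt with rfl | hp1
  · exact ⟨1, fun f _ => by simp⟩
  have he : 0 < 1 / p := by positivity
  have he1 : 1 / p < 1 := (div_lt_one hp0).2 hp1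
  set K : ENNReal := recipNorm (1 - 1 / p) (fun _ => 1) (surfaceMeasure n) with hK
  have hKtop : K ≠ ⊤ := by
    rw [hK, recipNorm_of_ne_zero (by linarith)]
    refine ENNReal.rpow_ne_top_of_nonneg (by linarith) ?_
    simp only [ENNReal.one_rpow, lintegral_one]
    exact measure_ne_top _ _
  refine ⟨K.toNNReal, fun f hf => mixedNorm_le_of_angNorm_le hp0 one_pos hp0 fun ρ _ => ?_⟩
  have hm : Measurable fun θ : UnitSphere n => ‖f (ρ • (θ : EuclideanSpace ℝ (Fin n)))‖ₑ :=
    (hf.comp (by fun_prop)).enorm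
  have := lintegral_mul_le_recipNorm (μ := surfaceMeasure n) he he1 hm
    (measurable_const (a := (1 : ENNReal)))
  rw [ENNReal.coe_toNNReal hKtop, mul_comm, angNorm, one_div_one, recipNorm_one]
  simp only [mul_one] at this
  exact this

/-- On spheres all norms of a radial function are comparable. -/
theorem exists_mixedNorm_le_of_radial (hn : 1 ≤ n) {r : ℝ} (hr : 0 < r) :
    ∃ K : ℝ≥0, ∀ f : EuclideanSpace ℝ (Fin n) → ℂ, (∀ x y, ‖x‖ = ‖y‖ → f x = f y) →
      mixedNorm r r f ≤ K * mixedNorm r 1 f := by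
  have := nontrivial_euclideanSpace hn
  set μ := surfaceMeasure n with hμ
  have hμ0 : μ Set.univ ≠ 0 := by
    have : NeZero μ := ⟨Measure.toSphere_ne_zero _⟩
    exact NeZero.ne _
  have hμt : μ Set.univ ≠ ⊤ := measure_ne_top _ _
  set K : ENNReal := μ Set.univ ^ (1 / r) / μ Set.univ with hK
  have hKtop : K ≠ ⊤ := ENNReal.div_ne_top (ENNReal.rpow_ne_top_of_nonneg (by positivity) hμt) hμ0
  refine ⟨K.toNNReal, fun f hf => mixedNorm_le_of_angNorm_le hr hr one_pos fun ρ hρ => ?_⟩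
  obtain ⟨θ₀⟩ : Nonempty (UnitSphere n) := (NormedSpace.sphere_nonempty.2 zero_le_one).to_subtype
  have hconst : ∀ θ : UnitSphere n, f (ρ • (θ : EuclideanSpace ℝ (Fin n)))
      = f (ρ • (θ₀ : EuclideanSpace ℝ (Fin n))) := fun θ => hf _ _ (by
    rw [norm_smul, norm_smul, norm_eq_of_mem_sphere θ, norm_eq_of_mem_sphere θ₀])
  rw [ENNReal.coe_toNNReal hKtop, angNorm, angNorm, one_div_one, recipNorm_one,
    recipNorm_one_div hr]
  simp_rw [hconst]
  rw [lintegral_const, lintegral_const, ENNReal.mul_rpow_of_nonneg _ _ (by positivity),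
    ← ENNReal.rpow_mul, mul_one_div_cancel hr.ne', ENNReal.rpow_one, mul_comm, mul_left_comm,
    ENNReal.div_mul_cancel hμ0 hμt]
  rw [mul_comm]

theorem exists_multiD_eq_partialD {u : EuclideanSpace ℝ (Fin n) → ℂ} (hu : ContDiff ℝ ∞ u)
    {ν : Fin n → ℕ} (hν : ∑ i, ν i = 1) : ∃ i, multiD ν u = partialD i u := by
  obtain ⟨i, -, hi⟩ := Finset.exists_ne_zero_of_sum_ne_zero (s := Finset.univ) (f := ν) (by omega)
  refine ⟨i, ?_⟩
  have hsplit : (ν - Pi.single i 1) + Pi.single i 1 = ν := by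
    ext k
    by_cases hk : k = i
    · subst hk; simp; omega
    · simp [hk]
  have h0 : ν - Pi.single i 1 = 0 := by
    have h1 : ∑ k, (ν - Pi.single i 1 + Pi.single i 1 : Fin n → ℕ) k = 1 := by rw [hsplit, hν]
    simp only [Pi.add_apply, Finset.sum_add_distrib, Finset.sum_pi_single', Finset.mem_univ,
      if_true] at h1
    have h2 : ∑ k, (ν - Pi.single i 1 : Fin n → ℕ) k = 0 := by simpa using h1
    ext k
    exact (Finset.sum_eq_zero_iff.1 h2) k (Finset.mem_univ k)
  rw [← hsplit, multiD_add_single hu, h0, multiD_zero]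

theorem mixedNormD_one_le (hn : 1 ≤ n) {p : ℝ} (hp : 0 < p) (s : ℝ) :
    ∃ K : ℝ≥0, ∀ u : EuclideanSpace ℝ (Fin n) → ℂ, ContDiff ℝ ∞ u →
      mixedNormD p p s 1 u
        ≤ K * eLpNorm (fun x => ‖x‖ ^ s * gradLength u x) (ENNReal.ofReal p) volume := by
  refine ⟨(Finset.piAntidiag (Finset.univ : Finset (Fin n)) 1).card, fun u hu => ?_⟩
  have h : ∀ ν ∈ Finset.piAntidiag (Finset.univ : Finset (Fin n)) 1,
      mixedNorm p p (powWeight s (multiD ν u))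
        ≤ eLpNorm (fun x => ‖x‖ ^ s * gradLength u x) (ENNReal.ofReal p) volume := by
    intro ν hν
    obtain ⟨i, hi⟩ := exists_multiD_eq_partialD hu (Finset.mem_piAntidiag.1 hν).1
    rw [hi, ← eLpNorm_eq_mixedNorm hn hp
      (measurable_powWeight (contDiff_partialD hu i).continuous s)]
    refine eLpNorm_mono fun x => ?_
    rw [powWeight, norm_smul, norm_mul]
    refine mul_le_mul_of_nonneg_left ?_ (norm_nonneg _)
    rw [gradLength, Real.norm_of_nonneg (Real.sqrt_nonneg _)]
    exact Real.le_sqrt_of_sq_le (Finset.single_le_sum (f := fun i => ‖partialD i u x‖ ^ 2)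
      (fun _ _ => by positivity) (Finset.mem_univ i))
  refine (Finset.sum_le_sum h).trans (le_of_eq ?_)
  rw [Finset.sum_const, nsmul_eq_mul, ENNReal.coe_natCast]

/-- `Δ ≤ a` means `1/r ≤ (1-a)/q + a/p ≤ 1`. The bound is needed because `r` also serves as the
angular exponent. -/
theorem one_le_of_cknDelta_le (hn : 1 ≤ n) {a p q r : ℝ} (hp : 1 ≤ p) (hq : 1 ≤ q) (hr : 0 < r)
    (ha : 0 < a) (ha1 : a ≤ 1) (hΔ : cknDelta n 1 a p q r ≤ a) : 1 ≤ r := by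
  have hn0 : (0 : ℝ) < n := by exact_mod_cast hn
  have h1 : 1 / r - (1 - a) / q - a / p ≤ 0 := by
    rw [cknDelta] at hΔ
    push_cast at hΔ
    by_contra hcon
    have := mul_pos hn0 (not_le.1 hcon)
    linarith
  have h2 : (1 - a) / q ≤ 1 - a := div_le_self (by linarith) hq
  have h3 : a / p ≤ a := div_le_self ha.le hp
  rw [← div_le_one hr]
  linarith

/-- The Caffarelli–Kohn–Nirenberg inequality. -/
theorem exists_classicalCKN (hn : 2 ≤ n) {α β γ a p q r : ℝ} (hp : 1 ≤ p) (hq : 1 ≤ q)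
    (hr : 0 < r) (ha : 0 < a) (ha1 : a ≤ 1) (hα : α < n / p - 1)
    (hscale : γ - n / r = a * (α + 1 - n / p) + (1 - a) * (β - n / q))
    (hΔ : cknDelta n 1 a p q r ≤ a)
    (h : (0 ≤ cknDelta n 1 a p q r ∧ 1 < p ∧ a * (1 - n / p) < cknDelta n 1 a p q r) ∨
        (0 < cknDelta n 1 a p q r ∧ a * (1 - n / p) ≤ cknDelta n 1 a p q r)) :
    ∃ C : ℝ≥0, ∀ u : EuclideanSpace ℝ (Fin n) → ℂ, ContDiff ℝ ∞ u → HasCompactSupport u →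
      ClassicalCKN α β γ a p q r C u := by
  have hn1 : 1 ≤ n := by omega
  have hn0 : (0 : ℝ) < n := by exact_mod_cast hn1
  have hr1 := one_le_of_cknDelta_le hn1 hp hq hr ha ha1 hΔ
  -- With equal radial and angular exponents `Δ̃ = Δ`, so the sign of the weighted sum is that of
  -- `Δ`.
  have hsum : cknDelta n 1 a p q r + (n - 1) * cknDelta n 1 a p q r
      = n * cknDelta n 1 a p q r := by ring
  obtain ⟨C, hC⟩ := mixedNorm_le_mixedNormD hn (σ := 1) le_rfl hp hp hq hq hr hr1 ha ha1
    (by simpa using hα) (by simpa using hscale) (by simpa using hΔ)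
    (by rw [Nat.cast_one]; rcases h with h | h
        · exact h.2.2.le
        · exact h.2) (by simpa using hΔ) (by
      rw [hsum, Nat.cast_one]
      rcases h with h | h
      · exact Or.inl ⟨mul_nonneg hn0.le h.1, h.2⟩
      · exact Or.inr ⟨mul_pos hn0 h.1, h.2⟩)
  obtain ⟨K, hK⟩ := mixedNormD_one_le hn1 (by linarith : 0 < p) (-α)
  refine ⟨C * K ^ a, fun u hu huc => ?_⟩
  rw [ClassicalCKN, eLpNorm_eq_mixedNorm hn1 hr (measurable_powWeight hu.continuous _),
    eLpNorm_eq_mixedNorm hn1 (by linarith : 0 < q) (measurable_powWeight hu.continuous _)]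
  refine (hC u hu huc).trans (mul_le_mul' ?_ le_rfl)
  rw [ENNReal.coe_mul, mul_assoc, ENNReal.coe_rpow_of_nonneg _ ha.le,
    ← ENNReal.mul_rpow_of_nonneg _ _ ha.le]
  exact mul_le_mul' le_rfl (ENNReal.rpow_le_rpow (hK u hu) ha.le)

/-- The improvement of the Caffarelli–Kohn–Nirenberg inequality for radial functions. -/
theorem exists_classicalCKN_of_radial (hn : 2 ≤ n) {α β γ a p q r : ℝ} (hp : 1 ≤ p) (hq : 1 ≤ q)
    (hr : 0 < r) (ha : 0 < a) (ha1 : a ≤ 1) (hα : α < n / p - 1)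
    (hscale : γ - n / r = a * (α + 1 - n / p) + (1 - a) * (β - n / q))
    (hΔ : cknDelta n 1 a p q r ≤ a) (hΔ0 : a * (1 - n / p) ≤ cknDelta n 1 a p q r)
    (hΔ1 : p = 1 → a * (1 - n / p) < cknDelta n 1 a p q r) :
    ∃ C : ℝ≥0, ∀ u : EuclideanSpace ℝ (Fin n) → ℂ, ContDiff ℝ ∞ u → HasCompactSupport u →
      (∀ x y, ‖x‖ = ‖y‖ → u x = u y) → ClassicalCKN α β γ a p q r C u := by
  have hn1 : 1 ≤ n := by omega
  have hn2 : (2 : ℝ) ≤ n := by exact_mod_cast hn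
  have hn0 : (0 : ℝ) < n := by linarith
  have ha1' : 0 ≤ 1 - a := by linarith
  have hp0 : 0 < p := by linarith
  have hq0 : 0 < q := by linarith
  -- The choice of 1 for all angular exponents gives `Δ̃` its largest admissible value `a`.
  have hang : cknDelta n 1 a 1 1 1 = a := by rw [cknDelta]; push_cast; ring
  -- `a (1 - n/p) + (n-1) a = a n (1 - 1/p)` is positive for `p > 1` and zero for `p = 1`; in the
  -- latter case the strict hypothesis is what remains.
  have hpos : 0 < cknDelta n 1 a p q r + (n - 1) * a := by
    rcases hp.eq_or_lt with h1 | h1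
    · have := hΔ1 h1.symm
      rw [← h1, div_one] at this
      rw [← h1]
      linarith
    · have h2 : (n : ℝ) / p < n := div_lt_self hn0 h1
      have h3 : a * (n / p) < a * n := mul_lt_mul_of_pos_left h2 ha
      linarith
  obtain ⟨C, hC⟩ := mixedNorm_le_mixedNormD hn (σ := 1) (p' := 1) (q' := 1) (r' := 1) le_rfl hp
    le_rfl hq le_rfl hr le_rfl ha ha1 (by simpa using hα) (by simpa using hscale)
    (by simpa using hΔ) (by rw [hang, Nat.cast_one, div_one]; nlinarith) (by rw [hang]; simp)
    (Or.inr ⟨by rwa [hang], by simpa using hΔ0⟩)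
  obtain ⟨K, hK⟩ := mixedNormD_one_le hn1 hp0 (-α)
  -- Radial symmetry is used only on the left, to raise the angular exponent from 1 to `r`. On the
  -- right the angular `L^1` norms are bounded by Hölder on the sphere, which has finite measure.
  obtain ⟨Kr, hKr⟩ := exists_mixedNorm_le_of_radial hn1 hr
  obtain ⟨Kp, hKp⟩ := exists_mixedNorm_one_le (n := n) hp
  obtain ⟨Kq, hKq⟩ := exists_mixedNorm_one_le (n := n) hq
  refine ⟨Kr * C * (Kp * K) ^ a * Kq ^ (1 - a), fun u hu huc hrad => ?_⟩
  have hD : mixedNormD p 1 (-α) 1 u ≤ (Kp * K : ℝ≥0)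
      * eLpNorm (fun x => ‖x‖ ^ (-α) * gradLength u x) (ENNReal.ofReal p) volume := by
    rw [ENNReal.coe_mul, mul_assoc]
    refine le_trans ?_ (mul_le_mul' le_rfl (hK u hu))
    rw [mixedNormD, mixedNormD, Finset.mul_sum]
    exact Finset.sum_le_sum fun ν _ =>
      hKp _ (measurable_powWeight (contDiff_multiD hu ν).continuous _)
  have hqm := measurable_powWeight hu.continuous (-β)
  have hγ : ∀ x y, ‖x‖ = ‖y‖ → powWeight (-γ) u x = powWeight (-γ) u y := fun x y hxy => by
    rw [powWeight, powWeight, hxy, hrad x y hxy]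
  rw [ClassicalCKN, eLpNorm_eq_mixedNorm hn1 hr (measurable_powWeight hu.continuous _),
    eLpNorm_eq_mixedNorm hn1 hq0 hqm]
  set G := eLpNorm (fun x => ‖x‖ ^ (-α) * gradLength u x) (ENNReal.ofReal p) volume
  calc mixedNorm r r (powWeight (-γ) u)
      ≤ Kr * (C * mixedNormD p 1 (-α) 1 u ^ a * mixedNorm q 1 (powWeight (-β) u) ^ (1 - a)) :=
        (hKr _ hγ).trans (mul_le_mul' le_rfl (hC u hu huc))
    _ ≤ Kr * (C * (((Kp * K : ℝ≥0) : ENNReal) * G) ^ a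
          * (Kq * mixedNorm q q (powWeight (-β) u)) ^ (1 - a)) :=
        mul_le_mul' le_rfl (mul_le_mul' (mul_le_mul' le_rfl (ENNReal.rpow_le_rpow hD ha.le))
          (ENNReal.rpow_le_rpow (hKq _ hqm) ha1'))
    _ = _ := by
        rw [ENNReal.mul_rpow_of_nonneg _ _ ha.le, ENNReal.mul_rpow_of_nonneg _ _ ha1',
          ENNReal.coe_mul (_ * _), ENNReal.coe_mul (_ * _), ENNReal.coe_mul Kr,
          ENNReal.coe_rpow_of_nonneg _ ha.le, ENNReal.coe_rpow_of_nonneg _ ha1']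
        ring

end Lebesgue

theorem mainTheorem5 (n : ℕ) (hn : 2 ≤ n) :
    -- the inequality in mixed radial-angular norms, for derivatives of integer order
    (∀ (σ : ℕ) (α β γ a p p' q q' r r' : ℝ),
      1 ≤ σ → σ ≤ n - 1 →
      1 ≤ p → 1 ≤ p' → 1 ≤ q → 1 ≤ q' → 1 ≤ r → 1 ≤ r' →
      0 < a → a ≤ 1 →
      γ < n / r → β < n / q → α < n / p - σ →
      γ - n / r = a * (α + σ - n / p) + (1 - a) * (β - n / q) →
      cknDelta n σ a p q r ≤ a * σ →
      a * (σ - n / p') ≤ cknDelta n σ a p' q' r' →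
      cknDelta n σ a p' q' r' ≤ a * σ →
      ((0 ≤ cknDelta n σ a p q r + (n - 1) * cknDelta n σ a p' q' r' ∧
          1 < p ∧ a * (σ - n / p) < cknDelta n σ a p q r) ∨
        (0 < cknDelta n σ a p q r + (n - 1) * cknDelta n σ a p' q' r' ∧
          a * (σ - n / p) ≤ cknDelta n σ a p q r)) →
      ∃ C : ℝ≥0, ∀ u : EuclideanSpace ℝ (Fin n) → ℂ, ContDiff ℝ ∞ u → HasCompactSupport u →
        mixedNorm r r' (powWeight (-γ) u) ≤
          C * mixedNormD p p' (-α) σ u ^ a * mixedNorm q q' (powWeight (-β) u) ^ (1 - a)) ∧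
    -- the classical inequality, in the range that the choice of equal exponents gives
    (∀ α β γ a p q r : ℝ,
      1 ≤ p → 1 ≤ q → 0 < r → 0 < a → a ≤ 1 →
      γ < n / r → β < n / q → α < n / p - 1 →
      γ - n / r = a * (α + 1 - n / p) + (1 - a) * (β - n / q) →
      cknDelta n 1 a p q r ≤ a →
      ((0 ≤ cknDelta n 1 a p q r ∧ 1 < p ∧ a * (1 - n / p) < cknDelta n 1 a p q r) ∨
        (0 < cknDelta n 1 a p q r ∧ a * (1 - n / p) ≤ cknDelta n 1 a p q r)) →
      ∃ C : ℝ≥0, ∀ u : EuclideanSpace ℝ (Fin n) → ℂ, ContDiff ℝ ∞ u → HasCompactSupport u →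
        ClassicalCKN α β γ a p q r C u) ∧
    -- the improvement for radial functions
    (∀ α β γ a p q r : ℝ,
      1 ≤ p → 1 ≤ q → 0 < r → 0 < a → a ≤ 1 →
      γ < n / r → β < n / q → α < n / p - 1 →
      γ - n / r = a * (α + 1 - n / p) + (1 - a) * (β - n / q) →
      cknDelta n 1 a p q r ≤ a →
      a * (1 - n / p) ≤ cknDelta n 1 a p q r →
      (p = 1 → a * (1 - n / p) < cknDelta n 1 a p q r) →
      ∃ C : ℝ≥0, ∀ u : EuclideanSpace ℝ (Fin n) → ℂ, ContDiff ℝ ∞ u → HasCompactSupport u →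
        (∀ x y, ‖x‖ = ‖y‖ → u x = u y) →
        ClassicalCKN α β γ a p q r C u) := by
  refine ⟨?_, ?_, ?_⟩
  · intro σ α β γ a p p' q q' r r' hσ _ hp hp' hq hq' hr hr' ha ha1 _ _ hα hscale hΔ hΔ0 hΔ' h
    exact mixedNorm_le_mixedNormD hn hσ hp hp' hq hq' (by linarith) hr' ha ha1 hα hscale hΔ hΔ0
      hΔ' h
  · intro α β γ a p q r hp hq hr ha ha1 _ _ hα hscale hΔ h
    exact exists_classicalCKN hn hp hq hr ha ha1 hα hscale hΔ h
  · intro α β γ a p q r hp hq hr ha ha1 _ _ hα hscale hΔ hΔ0 hΔ1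
    exact exists_classicalCKN_of_radial hn hp hq hr ha ha1 hα hscale hΔ hΔ0 hΔ1
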